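/- **Setting.** Let $X^\star\in\mathbb R^{n\times q}$ have rank $r\ge 1$, with reduced SVD $X^\star=U^\star\Sigma V^{\star\top}$ ($U^\star\in\mathbb R^{n\times r}$ and $V^\star\in\mathbb R^{q\times r}$ with orthonormal columns, $\Sigma$ diagonal with positive diagonal), and let $\sigma_{\max},\sigma_{\min}$ be the largest and smallest diagonal entries of $\Sigma$, $\kappa=\sigma_{\max}/\sigma_{\min}$, $B^\star=\Sigma V^{\star\top}=[b_1^\star,\dots,b_q^\star]$. Assume $\max_k\|b^\star_k\|\le\mu\sqrt{r/q}\,\sigma_{\max}$ for some $\mu\ge1$. For batches $\tau=1,\dots,2T$ and columns $k=1,\dots,q$ we are given $A^{(\tau)}_k\in\mathbb R^{m\times n}$ and $y_k^{(\tau)}=A_k^{(\tau)}x_k^\star+v_k^{(\tau)}\in\mathbb R^m$, where $x_k^\star$ is the $k$-th column of $X^\star$, the entries of all $A_k^{(\tau)}$ are standard Gaussian, those of all $v_k^{(\tau)}$ are Gaussian with mean $0$ and variance $\sigma_v^2\ge 0$, and all of these entries are mutually independent. Let $\mathrm{NSR}=q\sigma_v^2/\sigma_{\min}^2$. For $U_1,U_2$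 with orthonormal columns let $\mathrm{SD}_2(U_1,U_2)=\|(I-U_1U_1^\top)U_2\|$ (induced $\ell_2$ norm), and $M^\dagger=(M^\top M)^{-1}M^\top$. **AltGDmin.** Given an initial $U_0\in\mathbb R^{n\times r}$ with orthonormal columns that is independent of the batches $1,\dots,2T$, and a step size $\eta>0$, for $t=0,\dots,T-1$ set $b_k=(A_k^{(t+1)}U_t)^\dagger y_k^{(t+1)}$ for all $k$, then $$\hat U=U_t-\frac{\eta}{m}\sum_{k=1}^q A_k^\top(A_kU_tb_k-y_k)b_k^\top\quad\text{with } A_k=A_k^{(T+t+1)},\ y_k=y_k^{(T+t+1)},$$ and let $U_{t+1}$ be the orthonormal factor of a QR decomposition of $\hat U$ (any fixed measurable rule for computing it). **Theorem.** There are numerical constants $0<c<1$ and $C_1,C_2,C_3\ge1$ such that the following holds for all such data and every $\varepsilon>0$. Let $\delta_0=\dfrac{c}{\sqrt r\,\kappa^2}$. If almost surely $\mathrm{SD}_2(U^\star,U_0)\le\delta_0$, if $0<\eta\le0.5/\sigma_{\max}^2$, and if $$mq\ \ge\ C_1\kappa^4\mu^2(n+r)r+C_2\frac{(n+r)r}{\varepsilon^2}\,\mathrm{NSR}\,\mu^2\kappa^6,\qquad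 m\ \ge\ C_3\max(\log q,r)\,\max\Bigl(1,\frac{\mathrm{NSR}}{\varepsilon^2r}\Bigr),$$ then for every $t$ with $0\le t\le T-1$, with probability at least $1-\max(t,1)\,n^{-10}$, $$\mathrm{SD}_2(U^\star,U_{t+1})\ \le\ (1-0.5\,\eta\,\sigma_{\min}^2)^t\,\delta_0+\varepsilon .$$ -/

import Mathlib

open MeasureTheory ProbabilityTheory
open scoped NNReal ENNReal Matrix

noncomputable section

namespace LRCS

/-- Matrices carry the product (Borel) σ-algebra of their entries. -/
instance instMeasurableSpaceMatrix {n r : ℕ} : MeasurableSpace (Matrix (Fin n) (Fin r) ℝ) :=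
  inferInstanceAs (MeasurableSpace (Fin n → Fin r → ℝ))

/-- `X = U Σ Vᵀ` is a reduced singular value decomposition: `U` and `V` have orthonormal columns
and `Σ = diag σ` has positive diagonal entries (so `X` has rank exactly `r`). -/
structure IsReducedSVD {n q r : ℕ} (X : Matrix (Fin n) (Fin q) ℝ) (U : Matrix (Fin n) (Fin r) ℝ)
    (σ : Fin r → ℝ) (V : Matrix (Fin q) (Fin r) ℝ) : Prop where
  left_orthonormal : Uᵀ * U = 1
  right_orthonormal : Vᵀ * V = 1
  pos : ∀ i, 0 < σ i
  eq_mul : X = U * Matrix.diagonal σ * Vᵀ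

/-- The largest singular value. -/
def sigmaMax {r : ℕ} (σ : Fin r → ℝ) : ℝ := ⨆ i, σ i

/-- The smallest nonzero singular value. -/
def sigmaMin {r : ℕ} (σ : Fin r → ℝ) : ℝ := ⨅ i, σ i

/-- The condition number. -/
def kappa {r : ℕ} (σ : Fin r → ℝ) : ℝ := sigmaMax σ / sigmaMin σ

/-- Right singular vectors' incoherence: every column of `B = Σ Vᵀ` has Euclidean norm at most
`μ √(r/q) σ_max`. -/
def RightIncoherent {q r : ℕ} (μ : ℝ) (σ : Fin r → ℝ) (V : Matrix (Fin q) (Fin r) ℝ) : Prop :=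
  ∀ k : Fin q, ‖WithLp.toLp 2 (fun i => (Matrix.diagonal σ * Vᵀ) i k)‖
    ≤ μ * √((r : ℝ) / q) * sigmaMax σ

/-- The noise-to-signal ratio; `σv` is the standard deviation of a noise entry. -/
def nsr {r : ℕ} (q : ℕ) (σv : ℝ≥0) (σ : Fin r → ℝ) : ℝ := q * (σv : ℝ) ^ 2 / sigmaMin σ ^ 2

open scoped Matrix.Norms.L2Operator in
/-- The subspace distance `‖(I - U₁ U₁ᵀ) U₂‖`, in the induced `ℓ₂` operator norm. -/
def sd2 {n r : ℕ} (U₁ U₂ : Matrix (Fin n) (Fin r) ℝ) : ℝ := ‖(1 - U₁ * U₁ᵀ) * U₂‖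

/-- `Q` is the orthonormal factor of a (thin) QR decomposition `M = Q R`. -/
def IsQRFactor {n r : ℕ} (M Q : Matrix (Fin n) (Fin r) ℝ) : Prop :=
  Qᵀ * Q = 1 ∧ ∃ R : Matrix (Fin r) (Fin r) ℝ, (∀ i j, j < i → R i j = 0) ∧ M = Q * R

/-- `M† = (Mᵀ M)⁻¹ Mᵀ`. -/
def pinv {m r : ℕ} (M : Matrix (Fin m) (Fin r) ℝ) : Matrix (Fin r) (Fin m) ℝ := (Mᵀ * M)⁻¹ * Mᵀ

/-- The least squares update `b_k = (A_k U)† y_k` of all columns of `B`. -/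
def updateB {n q r m : ℕ} (A : Fin q → Matrix (Fin m) (Fin n) ℝ) (y : Fin q → Fin m → ℝ)
    (U : Matrix (Fin n) (Fin r) ℝ) (k : Fin q) : Fin r → ℝ :=
  pinv (A k * U) *ᵥ y k

/-- The gradient `∑ k, A_kᵀ (A_k U b_k - y_k) b_kᵀ`. -/
def gradU {n q r m : ℕ} (A : Fin q → Matrix (Fin m) (Fin n) ℝ) (y : Fin q → Fin m → ℝ)
    (U : Matrix (Fin n) (Fin r) ℝ) (b : Fin q → Fin r → ℝ) : Matrix (Fin n) (Fin r) ℝ :=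
  ∑ k, Matrix.vecMulVec ((A k)ᵀ *ᵥ (A k *ᵥ (U *ᵥ b k) - y k)) (b k)

/-- The AltGDmin iterates with `T` planned iterations, step size `η`, orthonormalization routine
`qr` and initialization `U₀`. Iteration `t + 1` updates `B` with batch number `t + 1` and computes
the gradient with batch number `T + (t + 1)`. -/
def altGDmin {n q r m : ℕ} (qr : Matrix (Fin n) (Fin r) ℝ → Matrix (Fin n) (Fin r) ℝ) (η : ℝ)
    (T : ℕ) (A : ℕ → Fin q → Matrix (Fin m) (Fin n) ℝ) (y : ℕ → Fin q → Fin m → ℝ)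
    (U₀ : Matrix (Fin n) (Fin r) ℝ) : ℕ → Matrix (Fin n) (Fin r) ℝ
  | 0 => U₀
  | t + 1 =>
    let U := altGDmin qr η T A y U₀ t
    let b := updateB (A (t + 1)) (y (t + 1)) U
    qr (U - (η / m) • gradU (A (T + (t + 1))) (y (T + (t + 1))) U b)

/-- The measurements `y_k = A_k x_k + v_k`, where `x_k` is the `k`-th column of `X`. -/
def measurements {n q m : ℕ} (X : Matrix (Fin n) (Fin q) ℝ)
    (A : ℕ → Fin q → Matrix (Fin m) (Fin n) ℝ) (v : ℕ → Fin q → Fin m → ℝ)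
    (τ : ℕ) (k : Fin q) : Fin m → ℝ :=
  A τ k *ᵥ (fun i => X i k) + v τ k

/-- Indices of all the scalar entries of the sensing matrices (left) and of the noise vectors
(right) in the batches `1, …, N`. -/
abbrev EntryIndex (N n q m : ℕ) : Type :=
  (Finset.Icc 1 N × Fin q × Fin m × Fin n) ⊕ (Finset.Icc 1 N × Fin q × Fin m)

/-- All the scalar entries of the sensing matrices and of the noise in the batches `1, …, N`. -/
def entry {n q m : ℕ} {Ω : Type*} (N : ℕ) (A : ℕ → Fin q → Ω → Matrix (Fin m) (Fin n) ℝ)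
    (v : ℕ → Fin q → Ω → Fin m → ℝ) : EntryIndex N n q m → Ω → ℝ
  | Sum.inl (τ, k, i, j) => fun ω => A τ k ω i j
  | Sum.inr (τ, k, i) => fun ω => v τ k ω i

/-- In the batches `1, …, N` all entries of all sensing matrices `A_k` are standard Gaussian, all
entries of all noise vectors `v_k` are centered Gaussian of variance `σv ^ 2`, and all these
scalar random variables are mutually independent. -/
structure IsGaussianData {n q m : ℕ} {Ω : Type*} [MeasurableSpace Ω] (P : Measure Ω) (N : ℕ)
    (σv : ℝ≥0) (A : ℕ → Fin q → Ω → Matrix (Fin m) (Fin n) ℝ)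
    (v : ℕ → Fin q → Ω → Fin m → ℝ) : Prop where
  measurable_entry : ∀ e, Measurable (entry N A v e)
  law_sensing : ∀ τ ∈ Finset.Icc 1 N, ∀ k i j,
    P.map (fun ω => A τ k ω i j) = gaussianReal 0 1
  law_noise : ∀ τ ∈ Finset.Icc 1 N, ∀ k i,
    P.map (fun ω => v τ k ω i) = gaussianReal 0 (σv ^ 2)
  indep : iIndepFun (entry N A v) P

end LRCS

end

/-! Sample splitting turns each iteration into a problem with a frozen subspace. The current iterate
`U` depends only on `U₀` and on earlier batches, so it is independent of the two batches its
iteration consumes. By `measure_le_of_indepFun` it suffices to bound the failure probability for a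
deterministic orthonormal `U` at subspace distance at most `δ`.

For such `U` put `G = Uᵀ X⋆` and `p_k = (1 - U Uᵀ) x_k`. When the matrices `A_k U` are well
conditioned, least squares returns `b_k = G_k + (A_k U)† (A_k p_k + v_k)`. Since `p_k` is orthogonal
to the range of `U`, the residual `A_k p_k + v_k` is independent of `A_k U`. Given a good `A_k U`,
the error `E = B - G` is thus a linear image of a Gaussian vector, with variance at most
`(2/m)(‖p_k‖² + σv²)` in every unit direction. Finite nets turn this into bounds on the columns of
`E`, on `‖G Eᵀ‖` and on `‖E‖²` (`measure_errMat_le`). The cross term `G Eᵀ` is centered and is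
estimated directly; using `‖G‖ ‖E‖` would be too lossy. Hence `B Bᵀ` has its spectrum between about
`σ_min²` and `σ_max²`.

The second batch is independent of `B`, and the gradient divided by `m` equals `(U B - X⋆) Bᵀ + D`.
Each bilinear form of `D` averages products of Gaussian forms, minus their means, over `m q`
independent rows. A Bernstein inequality and nets give `‖D‖ ≤ 0.01 σ_min² (δ + ξ)`, where `ξ` is a
noise floor (`measure_gradDev_le`).

The rest of a step is deterministic (`sd2_step_le`). The projection `1 - U⋆ U⋆ᵀ` kills `X⋆`, so
before orthonormalization only `U (1 - η B Bᵀ) - η D` matters. With `x = η σ_min²` the first factor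
contracts by `1 - 0.72 x`, and the QR factor costs at most a division by `1 - 0.051 x`. Thus `δ`
becomes `(1 - 0.5 x) δ + 0.02 x ξ`, a recursion with fixed point `0.04 ξ`.

The theorem takes `ξ = ε δ₀`; its sample size assumptions imply those of every step
(`stepAssumptions_of_sampleSize`). Each iteration fails with probability at most `n⁻¹⁰ / 2`, and
`measure_iter_le` adds these up. The cases `n = 1` and `ε ≥ 1` are trivial. -/

noncomputable section

namespace LRCS

set_option linter.unusedSectionVars false

/-! ### Linear forms in independent centered Gaussian variables. -/

section GaussianFamily

variable {Ω : Type*} [MeasurableSpace Ω] {P : Measure Ω} {ι J κ : Type*}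

/-- A family of independent centered Gaussian variables with variances `v`. -/
structure IsGaussianFamily (P : Measure Ω) (v : ι → ℝ≥0) (Z : ι → Ω → ℝ) : Prop where
  meas : ∀ i, Measurable (Z i)
  law : ∀ i, P.map (Z i) = gaussianReal 0 (v i)
  indep : iIndepFun Z P

/-- The linear form with coefficients `c` in the variables `Z`. -/
def linForm [Fintype ι] (Z : ι → Ω → ℝ) (c : ι → ℝ) (ω : Ω) : ℝ := ∑ i, c i * Z i ω

/-- The covariance of two linear forms. -/
def covForm [Fintype ι] (v : ι → ℝ≥0) (c d : ι → ℝ) : ℝ := ∑ i, c i * d i * v i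

variable [Fintype ι] {v : ι → ℝ≥0} {Z : ι → Ω → ℝ}

lemma IsGaussianFamily.measurable_linForm (h : IsGaussianFamily P v Z) (c : ι → ℝ) :
    Measurable (linForm Z c) :=
  Finset.measurable_fun_sum _ fun i _ => (h.meas i).const_mul _

lemma covForm_self_nonneg (c : ι → ℝ) : 0 ≤ covForm v c c :=
  Finset.sum_nonneg fun i _ => mul_nonneg (mul_self_nonneg _) (v i).2

lemma covForm_comm (c d : ι → ℝ) : covForm v c d = covForm v d c := by
  simp only [covForm, mul_comm (c _)]

lemma linForm_add (c d : ι → ℝ) (ω : Ω) : linForm Z (c + d) ω = linForm Z c ω + linForm Z d ω := by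
  simp [linForm, add_mul, Finset.sum_add_distrib]

lemma linForm_sub (c d : ι → ℝ) (ω : Ω) : linForm Z (c - d) ω = linForm Z c ω - linForm Z d ω := by
  simp [linForm, sub_mul, Finset.sum_sub_distrib]

lemma linForm_smul (a : ℝ) (c : ι → ℝ) (ω : Ω) : linForm Z (a • c) ω = a * linForm Z c ω := by
  simp [linForm, Finset.mul_sum, mul_assoc]

lemma covForm_add_add (c d : ι → ℝ) :
    covForm v (c + d) (c + d) = covForm v c c + 2 * covForm v c d + covForm v d d := by
  simp only [covForm, Finset.mul_sum, ← Finset.sum_add_distrib, Pi.add_apply]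
  exact Finset.sum_congr rfl fun i _ => by ring

lemma covForm_sub_sub (c d : ι → ℝ) :
    covForm v (c - d) (c - d) = covForm v c c - 2 * covForm v c d + covForm v d d := by
  simp only [covForm, Finset.mul_sum, ← Finset.sum_add_distrib, ← Finset.sum_sub_distrib,
    Pi.sub_apply]
  exact Finset.sum_congr rfl fun i _ => by ring

lemma covForm_smul_smul (a b : ℝ) (c d : ι → ℝ) :
    covForm v (a • c) (b • d) = a * b * covForm v c d := by
  simp only [covForm, Finset.mul_sum, Pi.smul_apply, smul_eq_mul]
  exact Finset.sum_congr rfl fun i _ => by ring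

lemma IsGaussianFamily.hasGaussianLaw (h : IsGaussianFamily P v Z) :
    HasGaussianLaw (fun ω => (Z · ω)) P := by
  refine iIndepFun.hasGaussianLaw (fun i => ?_) h.indep
  have : IsGaussian (P.map (Z i)) := by rw [h.law]; infer_instance
  exact IsGaussian.hasGaussianLaw

lemma IsGaussianFamily.hasGaussianLaw_apply (h : IsGaussianFamily P v Z) (i : ι) :
    HasGaussianLaw (Z i) P := by
  have : IsGaussian (P.map (Z i)) := by rw [h.law]; infer_instance
  exact IsGaussian.hasGaussianLaw

lemma IsGaussianFamily.cov_self (h : IsGaussianFamily P v Z) (i : ι) :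
    cov[Z i, Z i; P] = v i := by
  rw [covariance_self (h.meas i).aemeasurable]
  have := variance_id_gaussianReal (μ := 0) (v := v i)
  rwa [← h.law i, variance_map (by fun_prop) (h.meas i).aemeasurable] at this

lemma IsGaussianFamily.cov_linForm (h : IsGaussianFamily P v Z) (c d : ι → ℝ) :
    cov[linForm Z c, linForm Z d; P] = covForm v c d := by
  classical
  have := h.indep.isProbabilityMeasure
  have hm : ∀ i, MemLp (Z i) 2 P := fun i => (h.hasGaussianLaw_apply i).memLp_two
  have e : ∀ c, linForm Z c = fun ω => ∑ i, (fun ω => c i * Z i ω) ω := fun c => rfl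
  rw [e c, e d, covariance_fun_sum_fun_sum (fun i => (hm i).const_mul _) fun i => (hm i).const_mul _]
  refine Finset.sum_congr rfl fun i _ => ?_
  rw [Finset.sum_eq_single i]
  · rw [covariance_const_mul_left, covariance_const_mul_right, h.cov_self]; ring
  · intro j _ hj
    rw [covariance_const_mul_left, covariance_const_mul_right,
      (h.indep.indepFun hj.symm).covariance_eq_zero (hm i) (hm j)]
    simp
  · simp

/-- A linear form as a continuous linear map. -/
def linFormCLM (c : ι → ℝ) : (ι → ℝ) →L[ℝ] ℝ :=
  ∑ i, c i • ContinuousLinearMap.proj (R := ℝ) (φ := fun _ : ι => ℝ) i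

lemma linFormCLM_apply (c : ι → ℝ) (ω : Ω) : linFormCLM c (fun i => Z i ω) = linForm Z c ω := by
  simp [linFormCLM, linForm]

lemma IsGaussianFamily.hasGaussianLaw_linForm (h : IsGaussianFamily P v Z) (c : ι → ℝ) :
    HasGaussianLaw (linForm Z c) P := by
  simpa only [linFormCLM_apply] using h.hasGaussianLaw.map_fun (linFormCLM c)

lemma IsGaussianFamily.integral_eq_zero (h : IsGaussianFamily P v Z) (i : ι) :
    ∫ ω, Z i ω ∂P = 0 := by
  have := integral_id_gaussianReal (μ := 0) (v := v i)
  rwa [← h.law i, integral_map (h.meas i).aemeasurable (by fun_prop)] at this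

lemma IsGaussianFamily.map_linForm (h : IsGaussianFamily P v Z) (c : ι → ℝ) :
    P.map (linForm Z c) = gaussianReal 0 (covForm v c c).toNNReal := by
  rw [(h.hasGaussianLaw_linForm c).map_eq_gaussianReal, ← h.cov_linForm,
    covariance_self (h.measurable_linForm c).aemeasurable]
  congr 1
  have hm : ∀ i, Integrable (Z i) P := fun i => (h.hasGaussianLaw_apply i).integrable
  unfold linForm
  rw [integral_finsetSum _ fun i _ => (hm i).const_mul _]
  simp [integral_const_mul, h.integral_eq_zero]

/-- Linear images of a Gaussian vector are jointly Gaussian, so vanishing covariances between blocks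
already give independence of the blocks. -/
lemma IsGaussianFamily.iIndepFun_linForm [Finite J] [Finite κ] (h : IsGaussianFamily P v Z)
    (c : J → κ → ι → ℝ)
    (ho : ∀ j j', j ≠ j' → ∀ k k', covForm v (c j k) (c j' k') = 0) :
    iIndepFun (fun j ω k => linForm Z (c j k) ω) P := by
  have := Fintype.ofFinite J
  have := Fintype.ofFinite κ
  refine HasGaussianLaw.iIndepFun_of_covariance_eval
    (X := fun j k ω => linForm Z (c j k) ω) ?_ fun j j' hj k k' => ?_
  · have := h.hasGaussianLaw.map_fun (ContinuousLinearMap.pi fun j => ContinuousLinearMap.pi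
      fun k => linFormCLM (c j k))
    have e : (fun ω => (ContinuousLinearMap.pi fun j => ContinuousLinearMap.pi
        fun k => linFormCLM (c j k)) fun i => Z i ω) = fun ω j k => linForm Z (c j k) ω := by
      ext ω j k
      exact linFormCLM_apply (Z := Z) _ _
    rwa [e] at this
  · exact (h.cov_linForm _ _).trans (ho j j' hj k k')

lemma IsGaussianFamily.linForm_family [Finite J] (h : IsGaussianFamily P v Z)
    (c : J → ι → ℝ) (ho : ∀ j j', j ≠ j' → covForm v (c j) (c j') = 0) :
    IsGaussianFamily P (fun j => (covForm v (c j) (c j)).toNNReal) fun j => linForm Z (c j) where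
  meas _ := h.measurable_linForm _
  law _ := h.map_linForm _
  indep := (h.iIndepFun_linForm (κ := Unit) (fun j _ => c j)
    fun j j' hj _ _ => ho j j' hj).comp (fun _ f => f ()) fun _ => measurable_pi_apply ()

lemma IsGaussianFamily.indepFun_linForm [Finite J] [Finite κ] (h : IsGaussianFamily P v Z)
    (c : J → ι → ℝ) (d : κ → ι → ℝ) (ho : ∀ j k, covForm v (c j) (d k) = 0) :
    IndepFun (fun ω j => linForm Z (c j) ω) (fun ω k => linForm Z (d k) ω) P := by
  have := Fintype.ofFinite J
  have := Fintype.ofFinite κ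
  refine HasGaussianLaw.indepFun_of_covariance_eval (X := fun j ω => linForm Z (c j) ω)
    (Y := fun k ω => linForm Z (d k) ω) ?_ fun j k => ?_
  · have := h.hasGaussianLaw.map_fun ((ContinuousLinearMap.pi fun j =>
      linFormCLM (c j)).prod (ContinuousLinearMap.pi fun k => linFormCLM (d k)))
    have e : (fun ω => ((ContinuousLinearMap.pi fun j =>
        linFormCLM (c j)).prod (ContinuousLinearMap.pi fun k => linFormCLM (d k))) fun i => Z i ω) =
        fun ω => (fun j => linForm Z (c j) ω, fun k => linForm Z (d k) ω) := by
      ext ω j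
      · exact linFormCLM_apply (Z := Z) _ _
      · exact linFormCLM_apply (Z := Z) _ _
    rwa [e] at this
  · exact (h.cov_linForm _ _).trans (ho j k)

lemma IsGaussianFamily.precomp {g : J → ι} (h : IsGaussianFamily P v Z) (hg : g.Injective) :
    IsGaussianFamily P (v ∘ g) (fun j => Z (g j)) where
  meas _ := h.meas _
  law _ := h.law _
  indep := h.indep.precomp hg

end GaussianFamily

/-! ### Freezing one of two independent variables. -/

section Freezing

variable {Ω α β : Type*} [MeasurableSpace Ω] [MeasurableSpace α] [MeasurableSpace β]
  {P : Measure Ω} [IsProbabilityMeasure P]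

/-- If `X` and `Y` are independent, the probability of an event in `(X, Y)` is at most its
largest probability with `X` frozen. -/
lemma measure_le_of_indepFun {X : Ω → α} {Y : Ω → β} (hX : Measurable X) (hY : Measurable Y)
    (hXY : IndepFun X Y P) {S : Set (α × β)} (hS : MeasurableSet S) {p : ℝ≥0∞} {Q : α → Prop}
    (hQ : ∀ᵐ ω ∂P, Q (X ω)) (h : ∀ x, Q x → P {ω | (x, Y ω) ∈ S} ≤ p) :
    P {ω | (X ω, Y ω) ∈ S} ≤ p := by
  have hXYm : Measurable fun ω => (X ω, Y ω) := hX.prodMk hY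
  have h1 := (indepFun_iff_map_prod_eq_prod_map_map hX.aemeasurable hY.aemeasurable).1 hXY
  have h2 : P {ω | (X ω, Y ω) ∈ S} = (P.map fun ω => (X ω, Y ω)) S := by
    rw [Measure.map_apply hXYm hS]; rfl
  have := Measure.isProbabilityMeasure_map (μ := P) hY.aemeasurable
  rw [h2, h1, Measure.prod_apply hS, lintegral_map (measurable_measure_prodMk_left hS) hX]
  calc ∫⁻ ω, (P.map Y) (Prod.mk (X ω) ⁻¹' S) ∂P ≤ ∫⁻ _, p ∂P := by
        refine lintegral_mono_ae ?_
        filter_upwards [hQ] with ω hω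
        rw [Measure.map_apply hY (measurable_prodMk_left hS)]
        exact h _ hω
    _ = p := by simp

end Freezing

/-! ### Exponential moments and tail bounds for Gaussian forms and their products. -/

section Tails

variable {Ω : Type*} [MeasurableSpace Ω] {P : Measure Ω} {ι J κ : Type*}

/-- The left side, at `u = 2 s v`, is the moment generating function of a centered squared Gaussian
of variance `v` at `s`. The bound amounts to `-log (1 - u) ≤ u + 2 u²` for `|u| ≤ 1/2`. -/
lemma exp_neg_mul_sqrt_inv_le {u : ℝ} (h : |u| ≤ 1 / 2) :
    Real.exp (-(u / 2)) * √(1 / (1 - u)) ≤ Real.exp (u ^ 2) := by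
  obtain ⟨h1, h2⟩ := abs_le.1 h
  have hpos : 0 < 1 - u := by linarith
  have hlog : 1 / (1 - u) ≤ Real.exp (u + 2 * u ^ 2) := by
    have h3 := Real.one_sub_inv_le_log_of_pos hpos
    have h4 : (1 - u)⁻¹ ≤ 1 + u + 2 * u ^ 2 := by
      rw [inv_le_iff_one_le_mul₀ hpos]
      nlinarith [sq_nonneg u]
    have h5 : -(u + 2 * u ^ 2) ≤ Real.log (1 - u) := by linarith
    rw [← Real.exp_log hpos, one_div, ← Real.exp_neg]
    exact Real.exp_le_exp.2 (by linarith)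
  have : √(1 / (1 - u)) ≤ Real.exp (u / 2 + u ^ 2) := by
    apply Real.sqrt_le_iff.2 ⟨(Real.exp_pos _).le, ?_⟩
    rw [← Real.exp_nat_mul]
    refine hlog.trans (Real.exp_le_exp.2 ?_)
    push_cast; linarith
  calc _ ≤ Real.exp (-(u / 2)) * Real.exp (u / 2 + u ^ 2) := by gcongr
    _ = _ := by rw [← Real.exp_add]; ring_nf

/-- The centered square of a Gaussian variable is subexponential. -/
lemma lintegral_exp_sq_gaussianReal_le {v : ℝ≥0} {s : ℝ} (h : |s| * v ≤ 1 / 4) :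
    ∫⁻ x, ENNReal.ofReal (Real.exp (s * (x ^ 2 - v))) ∂gaussianReal 0 v
      ≤ ENNReal.ofReal (Real.exp (4 * s ^ 2 * v ^ 2)) := by
  rcases eq_or_ne v 0 with rfl | hv
  · simp
  have hv0 : (0 : ℝ) < v := by positivity
  have hu : |2 * s * v| ≤ 1 / 2 := by
    rw [abs_mul, abs_mul, abs_of_pos hv0, abs_two]; linarith
  have hb : 0 < 1 / (2 * v) - s := by
    have := (abs_le.1 hu).2
    have : 1 / (2 * v) - s = (1 - 2 * s * v) / (2 * v) := by field_simp
    rw [this]; apply div_pos <;> linarith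
  have hfun : ∀ x : ℝ, gaussianPDF 0 v x * ENNReal.ofReal (Real.exp (s * (x ^ 2 - v))) =
      ENNReal.ofReal ((√(2 * Real.pi * v))⁻¹ * Real.exp (-(s * v)) *
        Real.exp (-(1 / (2 * v) - s) * x ^ 2)) := by
    intro x
    rw [gaussianPDF, ← ENNReal.ofReal_mul (gaussianPDFReal_nonneg _ _ _), gaussianPDFReal]
    congr 1
    rw [mul_assoc (√(2 * Real.pi * v))⁻¹, mul_assoc (√(2 * Real.pi * v))⁻¹, ← Real.exp_add,
      ← Real.exp_add]
    congr 2
    field_simp; ring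
  rw [gaussianReal_of_var_ne_zero _ hv,
    lintegral_withDensity_eq_lintegral_mul _ (measurable_gaussianPDF _ _) (by fun_prop)]
  simp only [Pi.mul_apply, hfun]
  rw [← ofReal_integral_eq_lintegral_ofReal ((integrable_exp_neg_mul_sq hb).const_mul _)
    (Filter.Eventually.of_forall fun x => by positivity), integral_const_mul, integral_gaussian]
  apply ENNReal.ofReal_le_ofReal
  have h1 := exp_neg_mul_sqrt_inv_le hu
  have h2 : (√(2 * Real.pi * v))⁻¹ * √(Real.pi / (1 / (2 * v) - s)) = √(1 / (1 - 2 * s * v)) := by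
    rw [← Real.sqrt_inv, ← Real.sqrt_mul (by positivity)]
    congr 1
    have : 1 - 2 * s * v ≠ 0 := by have := (abs_le.1 hu).2; linarith
    have h3 : 1 / (2 * v) - s = (1 - 2 * s * v) / (2 * v) := by field_simp
    rw [h3]
    field_simp
  calc _ = Real.exp (-(2 * s * v / 2)) * ((√(2 * Real.pi * v))⁻¹ *
        √(Real.pi / (1 / (2 * v) - s))) := by
        rw [show -(2 * s * v / 2) = -(s * v) by ring]; ring
    _ ≤ _ := by rw [h2]; exact h1.trans_eq (by ring_nf)

variable [Fintype ι] {v : ι → ℝ≥0} {Z : ι → Ω → ℝ}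

lemma IsGaussianFamily.lintegral_exp_sq_le (h : IsGaussianFamily P v Z) (c : ι → ℝ) {s : ℝ}
    (hs : |s| * covForm v c c ≤ 1 / 4) :
    ∫⁻ ω, ENNReal.ofReal (Real.exp (s * (linForm Z c ω ^ 2 - covForm v c c))) ∂P
      ≤ ENNReal.ofReal (Real.exp (4 * s ^ 2 * covForm v c c ^ 2)) := by
  have h1 : ((covForm v c c).toNNReal : ℝ) = covForm v c c :=
    Real.coe_toNNReal _ (covForm_self_nonneg c)
  have := lintegral_exp_sq_gaussianReal_le (v := (covForm v c c).toNNReal) (s := s) (by rwa [h1])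
  rwa [← h.map_linForm, lintegral_map (by fun_prop) (h.measurable_linForm c), h1] at this

lemma covForm_eq_zero_of_self {c : ι → ℝ} (h : covForm v c c = 0) (d : ι → ℝ) :
    covForm v c d = 0 := by
  refine Finset.sum_eq_zero fun i _ => ?_
  have := (Finset.sum_eq_zero_iff_of_nonneg
    fun i _ => mul_nonneg (mul_self_nonneg (c i)) (v i).2).1 h i (Finset.mem_univ i)
  rcases mul_eq_zero.1 this with h | h
  · simp [mul_self_eq_zero.1 h]
  · have : ((v i : ℝ≥0) : ℝ) = 0 := h
    simp [this]

/-- Degenerate forms do occur (noiseless data, a column orthogonal to the tested direction), and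
products containing one must be treated apart because the variances cannot be normalized. -/
lemma IsGaussianFamily.linForm_ae_eq_zero (h : IsGaussianFamily P v Z) {c : ι → ℝ}
    (hc : covForm v c c = 0) : ∀ᵐ ω ∂P, linForm Z c ω = 0 := by
  have h1 := h.map_linForm c
  rw [hc, Real.toNNReal_zero, gaussianReal_zero_var] at h1
  have h2 : ∀ᵐ x ∂(P.map (linForm Z c)), x = 0 := by
    rw [h1, ae_dirac_iff (measurableSet_eq (a := (0 : ℝ)))]
  exact ae_of_ae_map (h.measurable_linForm c).aemeasurable h2

/-- The centered product of two linear forms is subexponential. -/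
lemma IsGaussianFamily.lintegral_exp_mul_le (h : IsGaussianFamily P v Z) (c d : ι → ℝ) {l : ℝ}
    (hl : l ^ 2 * (covForm v c c * covForm v d d) ≤ 1 / 64) :
    ∫⁻ ω, ENNReal.ofReal (Real.exp (l * (linForm Z c ω * linForm Z d ω - covForm v c d))) ∂P
      ≤ ENNReal.ofReal (Real.exp (16 * l ^ 2 * (covForm v c c * covForm v d d))) := by
  have := h.indep.isProbabilityMeasure
  rcases eq_or_ne (covForm v c c) 0 with hc | hc
  · have h0 : ∫⁻ ω, ENNReal.ofReal (Real.exp (l * (linForm Z c ω * linForm Z d ω -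
        covForm v c d))) ∂P = ∫⁻ ω, 1 ∂P := by
      refine lintegral_congr_ae ?_
      filter_upwards [h.linForm_ae_eq_zero hc] with ω hω
      simp [hω, covForm_eq_zero_of_self hc]
    rw [h0]; simp [hc]
  rcases eq_or_ne (covForm v d d) 0 with hd | hd
  · have h0 : ∫⁻ ω, ENNReal.ofReal (Real.exp (l * (linForm Z c ω * linForm Z d ω -
        covForm v c d))) ∂P = ∫⁻ ω, 1 ∂P := by
      refine lintegral_congr_ae ?_
      filter_upwards [h.linForm_ae_eq_zero hd] with ω hω
      simp [hω, covForm_comm c, covForm_eq_zero_of_self hd]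
    rw [h0]; simp [hd]
  have hc0 : 0 < covForm v c c := lt_of_le_of_ne (covForm_self_nonneg c) hc.symm
  have hd0 : 0 < covForm v d d := lt_of_le_of_ne (covForm_self_nonneg d) hd.symm
  set σ := √(covForm v c c * covForm v d d) with hσ
  have hσ2 : σ ^ 2 = covForm v c c * covForm v d d := Real.sq_sqrt (by positivity)
  have hσ0 : 0 < σ := Real.sqrt_pos.2 (by positivity)
  -- Replacing `c, d` by `t c, t⁻¹ d` keeps their product and gives both forms variance `σ`. The
  -- polarization variances then sum to `4 σ`, so each is at most `4 σ`.
  set t := √(σ / covForm v c c) with ht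
  have ht2 : t ^ 2 = σ / covForm v c c := Real.sq_sqrt (by positivity)
  have ht0 : 0 < t := Real.sqrt_pos.2 (by positivity)
  have hcc : covForm v (t • c) (t • c) = σ := by
    rw [covForm_smul_smul, ← pow_two, ht2]; field_simp
  have hdd : covForm v (t⁻¹ • d) (t⁻¹ • d) = σ := by
    rw [covForm_smul_smul, ← pow_two, inv_pow, ht2, inv_div, div_mul_eq_mul_div, ← hσ2]
    field_simp
  have hcd : covForm v (t • c) (t⁻¹ • d) = covForm v c d := by
    rw [covForm_smul_smul, mul_inv_cancel₀ ht0.ne', one_mul]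
  set p := t • c + t⁻¹ • d with hp
  set m := t • c - t⁻¹ • d with hm
  have hpp : covForm v p p = 2 * σ + 2 * covForm v c d := by
    rw [hp, covForm_add_add, hcc, hdd, hcd]; ring
  have hmm : covForm v m m = 2 * σ - 2 * covForm v c d := by
    rw [hm, covForm_sub_sub, hcc, hdd, hcd]; ring
  have hp0 := covForm_self_nonneg (v := v) p
  have hm0 := covForm_self_nonneg (v := v) m
  have hp4 : covForm v p p ≤ 4 * σ := by linarith
  have hm4 : covForm v m m ≤ 4 * σ := by linarith
  have hlσ : |l| * σ ≤ 1 / 8 := by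
    refine abs_le_of_sq_le_sq' (a := |l| * σ) ?_ (by norm_num) |>.2
    rw [mul_pow, sq_abs, hσ2]; linarith
  have key : ∀ ω, l * (linForm Z c ω * linForm Z d ω - covForm v c d) =
      2⁻¹ * (l / 2 * (linForm Z p ω ^ 2 - covForm v p p)) +
      2⁻¹ * (-(l / 2) * (linForm Z m ω ^ 2 - covForm v m m)) := by
    intro ω
    rw [hpp, hmm, hp, hm, linForm_add, linForm_sub, linForm_smul, linForm_smul]
    field_simp; ring
  -- The two squares of the polarization may be dependent; convexity of `exp` separates them without
  -- independence.
  have hconv : ∀ x y : ℝ, Real.exp (2⁻¹ * x + 2⁻¹ * y) ≤ 2⁻¹ * Real.exp x + 2⁻¹ * Real.exp y :=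
    fun x y => convexOn_exp.2 (Set.mem_univ x) (Set.mem_univ y) (by norm_num) (by norm_num)
      (by norm_num)
  have hb : ∀ w : ι → ℝ, covForm v w w ≤ 4 * σ → ∀ s : ℝ, |s| = |l| / 2 →
      ∫⁻ ω, ENNReal.ofReal (Real.exp (s * (linForm Z w ω ^ 2 - covForm v w w))) ∂P
      ≤ ENNReal.ofReal (Real.exp (16 * l ^ 2 * (covForm v c c * covForm v d d))) := by
    intro w hw s hs
    have hw0 := covForm_self_nonneg (v := v) w
    refine (h.lintegral_exp_sq_le w ?_).trans (ENNReal.ofReal_le_ofReal (Real.exp_le_exp.2 ?_))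
    · rw [hs]
      nlinarith [abs_nonneg l]
    · rw [← hσ2, ← sq_abs s, hs, div_pow, sq_abs]
      have : covForm v w w ^ 2 ≤ (4 * σ) ^ 2 := pow_le_pow_left₀ hw0 hw 2
      nlinarith [sq_nonneg l]
  calc _ ≤ ∫⁻ ω, (ENNReal.ofReal 2⁻¹ *
        ENNReal.ofReal (Real.exp (l / 2 * (linForm Z p ω ^ 2 - covForm v p p))) +
        ENNReal.ofReal 2⁻¹ *
        ENNReal.ofReal (Real.exp (-(l / 2) * (linForm Z m ω ^ 2 - covForm v m m)))) ∂P := by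
        refine lintegral_mono fun ω => ?_
        rw [← ENNReal.ofReal_mul (by norm_num), ← ENNReal.ofReal_mul (by norm_num),
          ← ENNReal.ofReal_add (by positivity) (by positivity), key]
        exact ENNReal.ofReal_le_ofReal (hconv _ _)
    _ ≤ _ := by
        have hmeas := h.measurable_linForm
        rw [lintegral_add_left (by have := hmeas p; fun_prop),
          lintegral_const_mul' _ _ ENNReal.ofReal_ne_top,
          lintegral_const_mul' _ _ ENNReal.ofReal_ne_top]
        refine (add_le_add
          (mul_le_mul_right (hb p hp4 (l / 2) (by rw [abs_div, abs_two])) _)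
          (mul_le_mul_right (hb m hm4 (-(l / 2)) (by rw [abs_neg, abs_div, abs_two])) _)).trans_eq ?_
        rw [← add_mul, ← ENNReal.ofReal_add (by norm_num) (by norm_num)]
        norm_num

/-- A Bernstein inequality for sums of products of Gaussian linear forms. -/
lemma IsGaussianFamily.bernstein [Fintype J] (h : IsGaussianFamily P v Z) (c d : J → ι → ℝ)
    (hcc : ∀ j j', j ≠ j' → covForm v (c j) (c j') = 0)
    (hcd : ∀ j j', j ≠ j' → covForm v (c j) (d j') = 0)
    (hdd : ∀ j j', j ≠ j' → covForm v (d j) (d j') = 0) {u M V τ : ℝ} (hu : 0 ≤ u) (hτ : 0 < τ)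
    (hM0 : 0 ≤ M) (hM : ∀ j, covForm v (c j) (c j) * covForm v (d j) (d j) ≤ M ^ 2)
    (hV : ∑ j, covForm v (c j) (c j) * covForm v (d j) (d j) ≤ V)
    (h1 : 16 * u * M ≤ τ) (h2 : 64 * u * V ≤ τ ^ 2) :
    P {ω | τ ≤ ∑ j, (linForm Z (c j) ω * linForm Z (d j) ω - covForm v (c j) (d j))}
      ≤ ENNReal.ofReal (Real.exp (-u)) := by
  have := h.indep.isProbabilityMeasure
  -- Chernoff parameter: `l τ = 2 u`, while the logarithm of the moment generating function is at
  -- most `16 l² V ≤ u`, which leaves `exp (-u)`.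
  set l := 2 * u / τ with hl
  have hl0 : 0 ≤ l := by positivity
  have hlτ : l * τ = 2 * u := by rw [hl]; field_simp
  have hlM : l * M ≤ 1 / 8 := by
    rw [hl, div_mul_eq_mul_div, div_le_iff₀ hτ]; linarith
  have hlV : 16 * l ^ 2 * V ≤ u := by
    have : 16 * l ^ 2 * V = u * (64 * u * V) / τ ^ 2 := by rw [hl]; field_simp; ring
    rw [this, div_le_iff₀ (by positivity)]
    gcongr
  set Y : J → Ω → ℝ≥0∞ := fun j ω =>
    ENNReal.ofReal (Real.exp (l * (linForm Z (c j) ω * linForm Z (d j) ω - covForm v (c j) (d j))))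
    with hY
  have hmeas := h.measurable_linForm
  have hYm : ∀ j, Measurable (Y j) := fun j => by
    have := hmeas (c j)
    have := hmeas (d j)
    fun_prop
  have hind : iIndepFun Y P := by
    -- The pairs `(c j, d j)` are the independent blocks; within a pair the two forms may be
    -- correlated.
    have h0 := h.iIndepFun_linForm (κ := Bool) (fun j b => if b then c j else d j) (by
      intro j j' hj k k'
      cases k <;> cases k' <;> simp only [if_true, Bool.false_eq_true, if_false]
      · exact hdd j j' hj
      · rw [covForm_comm]; exact hcd j' j hj.symm
      · exact hcd j j' hj
      · exact hcc j j' hj)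
    exact h0.comp (fun j f => ENNReal.ofReal (Real.exp (l * (f true * f false -
      covForm v (c j) (d j))))) fun j => by fun_prop
  have hprod : ∫⁻ ω, ∏ j, Y j ω ∂P ≤ ENNReal.ofReal (Real.exp u) := by
    rw [lintegral_prod_eq_prod_lintegral_of_indepFun _ Y hind hYm]
    calc _ ≤ ∏ j, ENNReal.ofReal (Real.exp (16 * l ^ 2 *
          (covForm v (c j) (c j) * covForm v (d j) (d j)))) := by
          refine Finset.prod_le_prod' fun j _ => h.lintegral_exp_mul_le _ _ ?_
          calc _ ≤ l ^ 2 * M ^ 2 := by gcongr; exact hM j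
            _ = (l * M) ^ 2 := by ring
            _ ≤ (1 / 8) ^ 2 := pow_le_pow_left₀ (by positivity) hlM 2
            _ = _ := by norm_num
      _ = ENNReal.ofReal (Real.exp (16 * l ^ 2 *
          ∑ j, covForm v (c j) (c j) * covForm v (d j) (d j))) := by
          rw [← ENNReal.ofReal_prod_of_nonneg fun _ _ => (Real.exp_pos _).le, ← Real.exp_sum,
            Finset.mul_sum]
      _ ≤ _ := by
          refine ENNReal.ofReal_le_ofReal (Real.exp_le_exp.2 (le_trans ?_ hlV))
          gcongr
  have hsub : {ω | τ ≤ ∑ j, (linForm Z (c j) ω * linForm Z (d j) ω - covForm v (c j) (d j))} ⊆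
      {ω | ENNReal.ofReal (Real.exp (2 * u)) ≤ ∏ j, Y j ω} := by
    intro ω hω
    simp only [Set.mem_ofPred_eq, hY] at hω ⊢
    rw [← ENNReal.ofReal_prod_of_nonneg fun _ _ => (Real.exp_pos _).le, ← Real.exp_sum,
      ← Finset.mul_sum, ← hlτ]
    exact ENNReal.ofReal_le_ofReal (Real.exp_le_exp.2 (by gcongr))
  refine (measure_mono hsub).trans ((meas_ge_le_lintegral_div (by fun_prop) ?_
    ENNReal.ofReal_ne_top).trans ?_)
  · simp [Real.exp_pos]
  · refine (ENNReal.div_le_div_right hprod _).trans_eq ?_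
    rw [← ENNReal.ofReal_div_of_pos (Real.exp_pos _), ← Real.exp_sub]
    ring_nf

/-- The Gaussian tail of a linear form. -/
lemma IsGaussianFamily.tail_linForm (h : IsGaussianFamily P v Z) (c : ι → ℝ) {u τ : ℝ}
    (hu : 0 ≤ u) (hτ : 0 < τ) (hc : 2 * u * covForm v c c ≤ τ ^ 2) :
    P {ω | τ ≤ linForm Z c ω} ≤ ENNReal.ofReal (Real.exp (-u)) := by
  have := h.indep.isProbabilityMeasure
  set l := 2 * u / τ with hl
  have hl0 : 0 ≤ l := by positivity
  have hmgf := mgf_gaussianReal (h.map_linForm c) l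
  rw [Real.coe_toNNReal _ (covForm_self_nonneg c)] at hmgf
  have hint : Integrable (fun ω => Real.exp (l * linForm Z c ω)) P := by
    have := integrable_exp_mul_gaussianReal (μ := 0) (v := (covForm v c c).toNNReal) l
    rw [← h.map_linForm c] at this
    exact this.comp_measurable (h.measurable_linForm c)
  have h1 := measure_ge_le_exp_mul_mgf (X := linForm Z c) τ hl0 hint
  rw [hmgf, ← Real.exp_add] at h1
  rw [← ofReal_measureReal (measure_ne_top _ _)]
  refine ENNReal.ofReal_le_ofReal (h1.trans (Real.exp_le_exp.2 ?_))
  have h2 : l * τ = 2 * u := by rw [hl]; field_simp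
  have h3 : covForm v c c * l ^ 2 / 2 ≤ u := by
    have : covForm v c c * l ^ 2 / 2 = u * (2 * u * covForm v c c) / τ ^ 2 := by
      rw [hl]; field_simp
    rw [this, div_le_iff₀ (by positivity)]
    gcongr
  linarith

end Tails

open scoped Matrix.Norms.L2Operator

/-! ### Euclidean norms, operator norms and orthogonal projections. -/

section EuclideanNorm

variable {ι κ : Type*} [Fintype ι] [Fintype κ]

/-- The Euclidean norm of a coordinate vector. -/
def vnorm (x : ι → ℝ) : ℝ := ‖WithLp.toLp 2 x‖

lemma vnorm_nonneg (x : ι → ℝ) : 0 ≤ vnorm x := norm_nonneg _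

lemma vnorm_sq (x : ι → ℝ) : vnorm x ^ 2 = x ⬝ᵥ x := by
  rw [vnorm, EuclideanSpace.norm_sq_eq]
  simp [dotProduct, sq]

lemma vnorm_sq_eq_sum (x : ι → ℝ) : vnorm x ^ 2 = ∑ i, x i * x i := vnorm_sq x

lemma vnorm_add_le (x y : ι → ℝ) : vnorm (x + y) ≤ vnorm x + vnorm y := norm_add_le _ _

lemma vnorm_sub_le (x y : ι → ℝ) : vnorm (x - y) ≤ vnorm x + vnorm y := norm_sub_le _ _

lemma vnorm_smul (a : ℝ) (x : ι → ℝ) : vnorm (a • x) = |a| * vnorm x := norm_smul a (WithLp.toLp 2 x)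

lemma vnorm_eq_zero {x : ι → ℝ} : vnorm x = 0 ↔ x = 0 := by
  simp [vnorm]

@[simp] lemma vnorm_zero : vnorm (0 : ι → ℝ) = 0 := vnorm_eq_zero.2 rfl

lemma dotProduct_le_vnorm (x y : ι → ℝ) : x ⬝ᵥ y ≤ vnorm x * vnorm y := by
  have := real_inner_le_norm (WithLp.toLp 2 y) (WithLp.toLp 2 x)
  simp only [EuclideanSpace.inner_toLp_toLp, star_trivial] at this
  rw [mul_comm]
  exact this

lemma abs_dotProduct_le_vnorm (x y : ι → ℝ) : |x ⬝ᵥ y| ≤ vnorm x * vnorm y := by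
  refine abs_le.2 ⟨?_, dotProduct_le_vnorm x y⟩
  have := dotProduct_le_vnorm (-x) y
  rw [neg_dotProduct, show vnorm (-x) = vnorm x from norm_neg (WithLp.toLp 2 x)] at this
  linarith

variable [DecidableEq κ] [DecidableEq ι]

lemma vnorm_mulVec_le (M : Matrix ι κ ℝ) (y : κ → ℝ) : vnorm (M *ᵥ y) ≤ ‖M‖ * vnorm y :=
  Matrix.l2_opNorm_mulVec M (WithLp.toLp 2 y)

lemma l2norm_le {M : Matrix ι κ ℝ} {c : ℝ} (hc : 0 ≤ c)
    (h : ∀ y, vnorm (M *ᵥ y) ≤ c * vnorm y) : ‖M‖ ≤ c := by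
  rw [Matrix.l2_opNorm_def]
  exact ContinuousLinearMap.opNorm_le_bound _ hc fun y => h y.ofLp

lemma l2norm_transpose (M : Matrix ι κ ℝ) : ‖Mᵀ‖ = ‖M‖ := by
  rw [← Matrix.conjTranspose_eq_transpose_of_trivial, Matrix.l2_opNorm_conjTranspose]

lemma dotProduct_mulVec_transpose (M : Matrix ι κ ℝ) (x : ι → ℝ) (y : κ → ℝ) :
    x ⬝ᵥ M *ᵥ y = y ⬝ᵥ Mᵀ *ᵥ x := by
  rw [Matrix.dotProduct_mulVec, Matrix.mulVec_transpose, dotProduct_comm]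

lemma dotProduct_mulVec_le (M : Matrix ι κ ℝ) (x : ι → ℝ) (y : κ → ℝ) :
    |x ⬝ᵥ M *ᵥ y| ≤ ‖M‖ * vnorm x * vnorm y := by
  refine (abs_dotProduct_le_vnorm _ _).trans ?_
  calc _ ≤ vnorm x * (‖M‖ * vnorm y) :=
        mul_le_mul_of_nonneg_left (vnorm_mulVec_le M y) (vnorm_nonneg x)
    _ = _ := by ring

lemma vnorm_mulVec_orthonormal {U : Matrix ι κ ℝ} (hU : Uᵀ * U = 1) (y : κ → ℝ) :
    vnorm (U *ᵥ y) = vnorm y := by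
  rw [← sq_eq_sq₀ (vnorm_nonneg _) (vnorm_nonneg _), vnorm_sq, vnorm_sq,
    dotProduct_mulVec_transpose, Matrix.mulVec_mulVec, hU, Matrix.one_mulVec]

lemma vnorm_proj_sq {U : Matrix ι κ ℝ} (hU : Uᵀ * U = 1) (x : ι → ℝ) :
    vnorm ((1 - U * Uᵀ) *ᵥ x) ^ 2 = vnorm x ^ 2 - vnorm (Uᵀ *ᵥ x) ^ 2 := by
  have h1 : (1 - U * Uᵀ)ᵀ * (1 - U * Uᵀ) = 1 - U * Uᵀ := by
    have : U * Uᵀ * (U * Uᵀ) = U * Uᵀ := by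
      rw [Matrix.mul_assoc, ← Matrix.mul_assoc Uᵀ, hU, Matrix.one_mul]
    simp only [Matrix.transpose_sub, Matrix.transpose_one, Matrix.transpose_mul,
      Matrix.transpose_transpose]
    rw [Matrix.sub_mul, Matrix.one_mul, Matrix.mul_sub, Matrix.mul_one, this]; simp
  rw [vnorm_sq, dotProduct_mulVec_transpose, Matrix.mulVec_mulVec, h1, Matrix.sub_mulVec,
    Matrix.one_mulVec, dotProduct_sub, vnorm_sq, vnorm_sq, ← Matrix.mulVec_mulVec,
    dotProduct_mulVec_transpose]

lemma vnorm_proj_le {U : Matrix ι κ ℝ} (hU : Uᵀ * U = 1) (x : ι → ℝ) :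
    vnorm ((1 - U * Uᵀ) *ᵥ x) ≤ vnorm x := by
  have := vnorm_proj_sq hU x
  exact abs_le_of_sq_le_sq' (by nlinarith [sq_nonneg (vnorm (Uᵀ *ᵥ x))]) (vnorm_nonneg x) |>.2

/-- The subspace distance is symmetric for subspaces of the same dimension. -/
lemma l2norm_proj_symm {U W : Matrix ι κ ℝ} (hU : Uᵀ * U = 1) (hW : Wᵀ * W = 1) {δ : ℝ}
    (hδ : δ < 1) (h : ‖(1 - W * Wᵀ) * U‖ ≤ δ) : ‖(1 - U * Uᵀ) * W‖ ≤ δ := by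
  have hδ0 : 0 ≤ δ := (norm_nonneg _).trans h
  have hlow : ∀ y, (1 - δ ^ 2) * vnorm y ^ 2 ≤ vnorm ((Wᵀ * U) *ᵥ y) ^ 2 := by
    intro y
    have h1 := vnorm_mulVec_le ((1 - W * Wᵀ) * U) y
    have h2 := vnorm_proj_sq hW (U *ᵥ y)
    rw [vnorm_mulVec_orthonormal hU] at h2
    rw [← Matrix.mulVec_mulVec] at h1 ⊢
    have h3 : vnorm ((1 - W * Wᵀ) *ᵥ U *ᵥ y) ≤ δ * vnorm y :=
      h1.trans (mul_le_mul_of_nonneg_right h (vnorm_nonneg y))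
    have h4 := pow_le_pow_left₀ (vnorm_nonneg _) h3 2
    nlinarith
  have hpos : 0 < 1 - δ ^ 2 := by nlinarith
  have hinj : Function.Injective (Wᵀ * U).mulVec := by
    intro a b hab
    have h1 := hlow (a - b)
    rw [Matrix.mulVec_sub, hab, sub_self, vnorm_zero] at h1
    have : vnorm (a - b) = 0 := by
      have := sq_nonneg (vnorm (a - b))
      exact pow_eq_zero_iff (n := 2) (by norm_num) |>.1 (by nlinarith)
    exact sub_eq_zero.1 (vnorm_eq_zero.1 this)
  -- Because `δ < 1`, the square matrix `Wᵀ U` is invertible. Every `z` is then some `Wᵀ U y`, and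
  -- `‖z‖² = ⟨Uᵀ W z, y⟩` bounds `Uᵀ W` from below by the same constant as `Wᵀ U`.
  have hsurj : Function.Surjective (Wᵀ * U).mulVec :=
    Matrix.mulVec_surjective_iff_isUnit.2 (Matrix.mulVec_injective_iff_isUnit.1 hinj)
  refine l2norm_le hδ0 fun z => ?_
  obtain ⟨y, rfl⟩ := hsurj z
  set z := (Wᵀ * U) *ᵥ y
  have h1 : vnorm z ^ 2 ≤ vnorm (Uᵀ *ᵥ W *ᵥ z) * vnorm y := by
    have : vnorm z ^ 2 = (Uᵀ *ᵥ W *ᵥ z) ⬝ᵥ y := by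
      rw [vnorm_sq, Matrix.mulVec_mulVec, dotProduct_mulVec_transpose, dotProduct_comm]
      simp [Matrix.transpose_mul]
    rw [this]; exact dotProduct_le_vnorm _ _
  have h2 := vnorm_proj_sq hU (W *ᵥ z)
  rw [vnorm_mulVec_orthonormal hW] at h2
  rw [← Matrix.mulVec_mulVec]
  refine abs_le_of_sq_le_sq' ?_ (mul_nonneg hδ0 (vnorm_nonneg z)) |>.2
  rw [h2, mul_pow]
  set p := vnorm (Uᵀ *ᵥ W *ᵥ z)
  have h3 := hlow y
  have h4 : (vnorm z ^ 2) ^ 2 ≤ p ^ 2 * vnorm y ^ 2 := by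
    rw [← mul_pow]; exact pow_le_pow_left₀ (sq_nonneg _) h1 2
  rcases (vnorm_nonneg z).eq_or_lt with h0 | h0
  · rw [← h0]; nlinarith [sq_nonneg p]
  · have h5 : (1 - δ ^ 2) * (vnorm z ^ 2) ^ 2 ≤ p ^ 2 * vnorm z ^ 2 := by
      nlinarith [sq_nonneg p]
    have h6 : (1 - δ ^ 2) * vnorm z ^ 2 ≤ p ^ 2 := by
      refine le_of_mul_le_mul_right (a := vnorm z ^ 2) ?_ (by positivity)
      linarith
    linarith

end EuclideanNorm

/-! ### Nets of the unit sphere and the operator norm. -/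

section Net

/-- A finite set of unit vectors that is a half-net of the unit sphere, in dual form. -/
structure IsHalfNet {d : ℕ} (N : Finset (Fin d → ℝ)) : Prop where
  card_le : N.card ≤ 5 ^ d
  unit : ∀ x ∈ N, vnorm x = 1
  le : ∀ (v : Fin d → ℝ) (τ : ℝ), 0 ≤ τ → (∀ y ∈ N, y ⬝ᵥ v ≤ τ) → vnorm v ≤ 2 * τ

/-- A 1-separated set on the sphere of radius 2 has at most `5 ^ d` points by a volume argument. One
of maximal size is a 1-net of that sphere, and halving it yields a half-net of the unit sphere. -/
lemma exists_isHalfNet (d : ℕ) : ∃ N : Finset (Fin d → ℝ), IsHalfNet N := by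
  classical
  set S : Set ℕ := {k | ∃ N : Finset (EuclideanSpace ℝ (Fin d)), N.card = k ∧
    (∀ x ∈ N, ‖x‖ = 2) ∧ ∀ x ∈ N, ∀ y ∈ N, x ≠ y → 1 ≤ ‖x - y‖} with hS
  have hle : ∀ k ∈ S, k ≤ 5 ^ d := by
    rintro k ⟨N, rfl, h1, h2⟩
    have := Besicovitch.card_le_of_separated N (fun c hc => (h1 c hc).le) h2
    simpa using this
  have hmem : sSup S ∈ S := Nat.sSup_mem ⟨0, ∅, by simp⟩ ⟨5 ^ d, hle⟩
  obtain ⟨N, hN, h1, h2⟩ := hmem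
  have hnet : ∀ x : EuclideanSpace ℝ (Fin d), ‖x‖ = 2 → ∃ y ∈ N, ‖x - y‖ ≤ 1 := by
    intro x hx
    by_contra! hcon
    have hxN : x ∉ N := fun h => by have := hcon x h; simp at this; linarith
    have hins : (insert x N).card ∈ S := by
      refine ⟨insert x N, rfl, ?_, ?_⟩
      · intro z hz
        rcases Finset.mem_insert.1 hz with rfl | hz
        exacts [hx, h1 z hz]
      · intro z hz w hw hzw
        rcases Finset.mem_insert.1 hz with hz' | hz' <;>
          rcases Finset.mem_insert.1 hw with hw' | hw'
        · exact absurd (hz'.trans hw'.symm) hzw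
        · rw [hz']; exact (hcon w hw').le
        · rw [hw', norm_sub_rev]; exact (hcon z hz').le
        · exact h2 z hz' w hw' hzw
    have := le_csSup ⟨5 ^ d, hle⟩ hins
    rw [Finset.card_insert_of_notMem hxN, hN] at this
    omega
  refine ⟨N.image fun x => ((1 / 2 : ℝ) • x).ofLp,
    Finset.card_image_le.trans (hN ▸ hle _ ⟨N, hN, h1, h2⟩), ?_, ?_⟩
  · intro x hx
    obtain ⟨y, hy, rfl⟩ := Finset.mem_image.1 hx
    have : vnorm ((1 / 2 : ℝ) • y).ofLp = ‖(1 / 2 : ℝ) • y‖ := rfl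
    rw [this, norm_smul, h1 y hy]; norm_num
  · intro v τ hτ h
    rcases (vnorm_nonneg v).eq_or_lt with h0 | h0
    · rw [← h0]; positivity
    set w : EuclideanSpace ℝ (Fin d) := WithLp.toLp 2 v with hw
    have hwv : ‖w‖ = vnorm v := rfl
    obtain ⟨y, hy, hxy⟩ := hnet ((2 / vnorm v) • w) (by
      rw [norm_smul, hwv, Real.norm_of_nonneg (by positivity)]; field_simp)
    have h3 := h _ (Finset.mem_image_of_mem _ hy)
    have h4 := dotProduct_le_vnorm (((2 / vnorm v) • w - y).ofLp) v
    have h5 : vnorm (((2 / vnorm v) • w - y).ofLp) ≤ 1 := hxy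
    have h6 : ((2 / vnorm v) • w - y).ofLp ⬝ᵥ v = 2 * vnorm v - y.ofLp ⬝ᵥ v := by
      have : ((2 / vnorm v) • w - y).ofLp = (2 / vnorm v) • v - y.ofLp := rfl
      rw [this, sub_dotProduct, smul_dotProduct, ← vnorm_sq, smul_eq_mul]
      field_simp
    have h7 : ((1 / 2 : ℝ) • y).ofLp ⬝ᵥ v = 1 / 2 * (y.ofLp ⬝ᵥ v) := by
      have : ((1 / 2 : ℝ) • y).ofLp = (1 / 2 : ℝ) • y.ofLp := rfl
      rw [this, smul_dotProduct, smul_eq_mul]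
    nlinarith

/-- Each half-net costs a factor 2, one for either argument of the bilinear form. -/
lemma l2norm_le_of_net {a b : ℕ} {N₁ : Finset (Fin a → ℝ)} {N₂ : Finset (Fin b → ℝ)}
    (h₁ : IsHalfNet N₁) (h₂ : IsHalfNet N₂) {M : Matrix (Fin a) (Fin b) ℝ} {τ : ℝ} (hτ : 0 ≤ τ)
    (h : ∀ x ∈ N₁, ∀ y ∈ N₂, x ⬝ᵥ M *ᵥ y ≤ τ) : ‖M‖ ≤ 4 * τ := by
  rw [← l2norm_transpose]
  refine l2norm_le (by positivity) fun z => ?_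
  have := h₂.le (Mᵀ *ᵥ z) (2 * τ * vnorm z) (by have := vnorm_nonneg z; positivity) fun y hy => by
    rw [← dotProduct_mulVec_transpose, dotProduct_comm]
    exact (dotProduct_le_vnorm _ _).trans (mul_le_mul_of_nonneg_right
      (h₁.le _ τ hτ fun x hx => h x hx y hy) (vnorm_nonneg z))
  linarith

lemma l2norm_le_of_net_right {a b : ℕ} {N : Finset (Fin b → ℝ)}
    (hN : IsHalfNet N) {M : Matrix (Fin a) (Fin b) ℝ} {τ : ℝ} (hτ : 0 ≤ τ)
    (h : ∀ y ∈ N, vnorm (M *ᵥ y) ≤ τ) : ‖M‖ ≤ 2 * τ := by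
  rw [← l2norm_transpose]
  refine l2norm_le (by positivity) fun z => ?_
  have := hN.le (Mᵀ *ᵥ z) (τ * vnorm z) (by have := vnorm_nonneg z; positivity) fun y hy => by
    rw [← dotProduct_mulVec_transpose, dotProduct_comm]
    exact (dotProduct_le_vnorm _ _).trans (mul_le_mul_of_nonneg_right (h y hy) (vnorm_nonneg z))
  linarith

end Net

/-! ### The deterministic gradient step and its orthonormalization. -/

section Contraction

variable {n q r : ℕ}

lemma l2norm_le_one_of_orthonormal {U : Matrix (Fin n) (Fin r) ℝ} (hU : Uᵀ * U = 1) : ‖U‖ ≤ 1 :=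
  l2norm_le zero_le_one fun y => by rw [vnorm_mulVec_orthonormal hU, one_mul]

lemma sd2_le_one {Us Q : Matrix (Fin n) (Fin r) ℝ} (hUs : Usᵀ * Us = 1) (hQ : Qᵀ * Q = 1) :
    sd2 Us Q ≤ 1 :=
  l2norm_le zero_le_one fun y => by
    rw [← Matrix.mulVec_mulVec, one_mul]
    exact (vnorm_proj_le hUs _).trans_eq (vnorm_mulVec_orthonormal hQ y)

/-- If `M` is bounded below and `Q` is an orthonormal factor of `M`, then `F Q` is controlled by
`F M`. -/
lemma l2norm_mul_qrFactor_le {F : Matrix (Fin n) (Fin n) ℝ} {M Q : Matrix (Fin n) (Fin r) ℝ}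
    (hQ : IsQRFactor M Q) {a l : ℝ} (hl : 0 < l) (ha : ‖F * M‖ ≤ a)
    (hM : ∀ y, l * vnorm y ≤ vnorm (M *ᵥ y)) : ‖F * Q‖ ≤ a / l := by
  obtain ⟨hQ1, R, -, hR⟩ := hQ
  have ha0 : 0 ≤ a := (norm_nonneg _).trans ha
  have hRl : ∀ y, l * vnorm y ≤ vnorm (R *ᵥ y) := fun y => by
    rw [← vnorm_mulVec_orthonormal hQ1 (R *ᵥ y), Matrix.mulVec_mulVec, ← hR]; exact hM y
  have hinj : Function.Injective R.mulVec := by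
    intro x y hxy
    have h1 := hRl (x - y)
    rw [Matrix.mulVec_sub, hxy, sub_self, vnorm_zero] at h1
    have h2 : vnorm (x - y) = 0 := by
      have := vnorm_nonneg (x - y)
      nlinarith
    exact sub_eq_zero.1 (vnorm_eq_zero.1 h2)
  have hsurj : Function.Surjective R.mulVec :=
    Matrix.mulVec_surjective_iff_isUnit.2 (Matrix.mulVec_injective_iff_isUnit.1 hinj)
  refine l2norm_le (by positivity) fun z => ?_
  obtain ⟨y, rfl⟩ := hsurj z
  have h1 : (F * Q) *ᵥ R *ᵥ y = (F * M) *ᵥ y := by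
    rw [Matrix.mulVec_mulVec, Matrix.mul_assoc, ← hR]
  have h2 := vnorm_mulVec_le (F * M) y
  have h3 := vnorm_nonneg y
  rw [h1, div_mul_eq_mul_div, le_div_iff₀ hl]
  calc _ ≤ (a * vnorm y) * l := by gcongr; exact h2.trans (by gcongr)
    _ = a * (l * vnorm y) := by ring
    _ ≤ _ := by gcongr; exact hRl y

/-- In `‖y - η B Bᵀ y‖² = ‖y‖² - 2 η ‖Bᵀ y‖² + η² ‖B Bᵀ y‖²` the last term is at most `0.515 η ‖Bᵀ
y‖²` by the step size condition. What remains of the negative term is bounded through the lower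
bound on `Bᵀ`. -/
lemma l2norm_one_sub_smul_le {B : Matrix (Fin r) (Fin q) ℝ} {s₁ s₂ η : ℝ} (hη : 0 < η)
    (hηs : η * s₂ ^ 2 ≤ 0.5) (hx1 : η * s₁ ^ 2 ≤ 0.5)
    (hBlow : ∀ y, 0.97 * s₁ ^ 2 * vnorm y ^ 2 ≤ vnorm (Bᵀ *ᵥ y) ^ 2)
    (hBhigh : ‖B‖ ^ 2 ≤ 1.03 * s₂ ^ 2) :
    ‖1 - η • (B * Bᵀ)‖ ≤ 1 - 0.72 * (η * s₁ ^ 2) := by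
  have hBBt : ∀ y, y ⬝ᵥ (B * Bᵀ) *ᵥ y = vnorm (Bᵀ *ᵥ y) ^ 2 := by
    intro y
    rw [← Matrix.mulVec_mulVec, Matrix.dotProduct_mulVec, ← Matrix.mulVec_transpose, vnorm_sq]
  refine l2norm_le (by linarith) fun y => ?_
  refine abs_le_of_sq_le_sq' ?_ (mul_nonneg (by linarith) (vnorm_nonneg y)) |>.2
  rw [Matrix.sub_mulVec, Matrix.one_mulVec, Matrix.smul_mulVec]
  have h1 : vnorm (y - η • (B * Bᵀ) *ᵥ y) ^ 2 = vnorm y ^ 2 - 2 * η * vnorm (Bᵀ *ᵥ y) ^ 2 +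
      η ^ 2 * vnorm ((B * Bᵀ) *ᵥ y) ^ 2 := by
    simp only [vnorm_sq (y - _), vnorm_sq y, vnorm_sq ((B * Bᵀ) *ᵥ y), ← hBBt, sub_dotProduct,
      dotProduct_sub, smul_dotProduct, dotProduct_smul, smul_eq_mul,
      dotProduct_comm ((B * Bᵀ) *ᵥ y) y]
    ring
  have h2 : vnorm ((B * Bᵀ) *ᵥ y) ^ 2 ≤ 1.03 * s₂ ^ 2 * vnorm (Bᵀ *ᵥ y) ^ 2 := by
    rw [← Matrix.mulVec_mulVec]
    have := pow_le_pow_left₀ (vnorm_nonneg _) (vnorm_mulVec_le B (Bᵀ *ᵥ y)) 2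
    rw [mul_pow] at this
    exact this.trans (mul_le_mul_of_nonneg_right hBhigh (sq_nonneg _))
  have h3 := hBlow y
  rw [h1, mul_pow]
  set b := vnorm (Bᵀ *ᵥ y) ^ 2
  have hb0 : 0 ≤ b := sq_nonneg _
  have h4 : η ^ 2 * vnorm ((B * Bᵀ) *ᵥ y) ^ 2 ≤ 0.515 * η * b := by
    calc _ ≤ η ^ 2 * (1.03 * s₂ ^ 2 * b) := by gcongr
      _ = 1.03 * η * b * (η * s₂ ^ 2) := by ring
      _ ≤ 1.03 * η * b * 0.5 := by gcongr
      _ = _ := by ring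
  have h5 : 0.97 * (η * s₁ ^ 2 * vnorm y ^ 2) ≤ η * b := by
    have := mul_le_mul_of_nonneg_left h3 hη.le
    linarith
  have h6 : 0 ≤ η * s₁ ^ 2 * vnorm y ^ 2 := by positivity
  have h7 : 0 ≤ (η * s₁ ^ 2) ^ 2 * vnorm y ^ 2 := by positivity
  have h8 : (1 - 0.72 * (η * s₁ ^ 2)) ^ 2 * vnorm y ^ 2 = vnorm y ^ 2 -
      1.44 * (η * s₁ ^ 2 * vnorm y ^ 2) + 0.5184 * ((η * s₁ ^ 2) ^ 2 * vnorm y ^ 2) := by ring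
  rw [h8]
  linarith

set_option maxHeartbeats 1000000 in
/-- One gradient step contracts the subspace distance, up to the deviation `D` of the gradient
from its mean. -/
lemma sd2_step_le {U Us Q D : Matrix (Fin n) (Fin r) ℝ} {B Bs : Matrix (Fin r) (Fin q) ℝ}
    {s₁ s₂ δ η ξ : ℝ} (hU : Uᵀ * U = 1) (hUs : Usᵀ * Us = 1) (hs₁ : 0 < s₁) (hs₂ : s₁ ≤ s₂)
    (hlow : ∀ y, s₁ * vnorm y ≤ vnorm (Bsᵀ *ᵥ y)) (hhigh : ‖Bs‖ ≤ s₂)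
    (hδ : sd2 Us U ≤ δ) (hδs : δ * s₂ ^ 2 ≤ 0.01 * s₁ ^ 2) (hη : 0 < η) (hηs : η * s₂ ^ 2 ≤ 0.5)
    (hξ : ξ ≤ 1) (hξ0 : 0 ≤ ξ)
    (hGE : ‖(Uᵀ * (Us * Bs)) * (B - Uᵀ * (Us * Bs))ᵀ‖ ≤ 0.01 * s₁ ^ 2)
    (hE : ‖B - Uᵀ * (Us * Bs)‖ ^ 2 ≤ 0.01 * s₁ ^ 2) (hD : ‖D‖ ≤ 0.01 * s₁ ^ 2 * (δ + ξ))
    (hQ : IsQRFactor (U - η • ((U * B - Us * Bs) * Bᵀ + D)) Q) :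
    sd2 Us Q ≤ (1 - 0.5 * η * s₁ ^ 2) * δ + 0.02 * (η * s₁ ^ 2) * ξ := by
  have hδ0 : 0 ≤ δ := (norm_nonneg _).trans hδ
  have hs₁₂ : s₁ ^ 2 ≤ s₂ ^ 2 := pow_le_pow_left₀ hs₁.le hs₂ 2
  have hs₂0 : 0 < s₂ := hs₁.trans_le hs₂
  have hs₁2 : 0 < s₁ ^ 2 := by positivity
  have hδ1 : δ ≤ 0.01 := by
    have : δ * s₁ ^ 2 ≤ 0.01 * s₁ ^ 2 := (mul_le_mul_of_nonneg_left hs₁₂ hδ0).trans hδs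
    exact le_of_mul_le_mul_right this hs₁2
  set G := Uᵀ * (Us * Bs) with hG
  set E := B - G with hEdef
  have hB : B = G + E := by rw [hEdef]; abel
  have hx0 : 0 < η * s₁ ^ 2 := by positivity
  have hx1 : η * s₁ ^ 2 ≤ 0.5 := (mul_le_mul_of_nonneg_left hs₁₂ hη.le).trans hηs
  have hUn : ‖U‖ ≤ 1 := l2norm_le_one_of_orthonormal hU
  have hUsn : ‖Us‖ ≤ 1 := l2norm_le_one_of_orthonormal hUs
  have hUtn : ‖Uᵀ‖ ≤ 1 := by rw [l2norm_transpose]; exact hUn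
  have hGn : ‖G‖ ≤ s₂ := by
    calc ‖G‖ ≤ ‖Uᵀ‖ * (‖Us‖ * ‖Bs‖) := (Matrix.l2_opNorm_mul _ _).trans
          (mul_le_mul_of_nonneg_left (Matrix.l2_opNorm_mul _ _) (norm_nonneg _))
      _ ≤ 1 * (1 * s₂) := by gcongr
      _ = s₂ := by ring
  have hEt : ‖Eᵀ‖ = ‖E‖ := l2norm_transpose E
  have hEE : ‖E * Eᵀ‖ ≤ 0.01 * s₁ ^ 2 :=
    (Matrix.l2_opNorm_mul _ _).trans (by rw [hEt, ← sq]; exact hE)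
  have hEG : ‖E * Gᵀ‖ ≤ 0.01 * s₁ ^ 2 := by
    rw [← l2norm_transpose, Matrix.transpose_mul, Matrix.transpose_transpose]; exact hGE
  have hEB : ‖E * Bᵀ‖ ≤ 0.02 * s₁ ^ 2 := by
    rw [hB, Matrix.transpose_add, Matrix.mul_add]
    exact (norm_add_le _ _).trans (by linarith)
  -- the quadratic form of `B Bᵀ`
  have hBt : ∀ y, vnorm (Bᵀ *ᵥ y) ^ 2 =
      vnorm (Gᵀ *ᵥ y) ^ 2 + 2 * (y ⬝ᵥ (G * Eᵀ) *ᵥ y) + vnorm (Eᵀ *ᵥ y) ^ 2 := by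
    intro y
    have h1 : y ⬝ᵥ (G * Eᵀ) *ᵥ y = (Gᵀ *ᵥ y) ⬝ᵥ (Eᵀ *ᵥ y) := by
      rw [← Matrix.mulVec_mulVec, Matrix.dotProduct_mulVec, Matrix.mulVec_transpose G]
    rw [h1, hB, Matrix.transpose_add, Matrix.add_mulVec, vnorm_sq, vnorm_sq, vnorm_sq,
      add_dotProduct, dotProduct_add, dotProduct_add, dotProduct_comm (Eᵀ *ᵥ y)]
    ring
  have hcross : ∀ y, |y ⬝ᵥ (G * Eᵀ) *ᵥ y| ≤ 0.01 * s₁ ^ 2 * vnorm y ^ 2 := by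
    intro y
    refine (dotProduct_mulVec_le _ _ _).trans ?_
    have := vnorm_nonneg y
    rw [mul_assoc, ← sq]
    gcongr
  -- Here `Gᵀ y = Bsᵀ (Usᵀ U y)`, and by Pythagoras `Usᵀ U` shrinks squared norms by at most `1 -
  -- δ²`.
  have hGlow : ∀ y, s₁ ^ 2 * (1 - δ ^ 2) * vnorm y ^ 2 ≤ vnorm (Gᵀ *ᵥ y) ^ 2 := by
    intro y
    have h1 : Gᵀ *ᵥ y = Bsᵀ *ᵥ (Usᵀ *ᵥ (U *ᵥ y)) := by
      rw [hG, Matrix.transpose_mul, Matrix.transpose_mul, Matrix.transpose_transpose,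
        Matrix.mulVec_mulVec, Matrix.mulVec_mulVec, Matrix.mul_assoc]
    have h2 := hlow (Usᵀ *ᵥ (U *ᵥ y))
    have h3 := vnorm_proj_sq hUs (U *ᵥ y)
    rw [vnorm_mulVec_orthonormal hU, Matrix.mulVec_mulVec] at h3
    have h4 : vnorm (((1 - Us * Usᵀ) * U) *ᵥ y) ≤ δ * vnorm y :=
      (vnorm_mulVec_le _ y).trans (mul_le_mul_of_nonneg_right hδ (vnorm_nonneg y))
    have h5 := pow_le_pow_left₀ (vnorm_nonneg _) h4 2
    have h6 := pow_le_pow_left₀ (mul_nonneg hs₁.le (vnorm_nonneg _)) h2 2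
    rw [h1]
    rw [mul_pow] at h5 h6
    have h7 : (1 - δ ^ 2) * vnorm y ^ 2 ≤ vnorm (Usᵀ *ᵥ (U *ᵥ y)) ^ 2 := by linarith
    calc _ = s₁ ^ 2 * ((1 - δ ^ 2) * vnorm y ^ 2) := by ring
      _ ≤ s₁ ^ 2 * vnorm (Usᵀ *ᵥ (U *ᵥ y)) ^ 2 := by gcongr
      _ ≤ _ := h6
  have hBlow : ∀ y, 0.97 * s₁ ^ 2 * vnorm y ^ 2 ≤ vnorm (Bᵀ *ᵥ y) ^ 2 := by
    intro y
    have h1 := (abs_le.1 (hcross y)).1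
    have h2 := hGlow y
    have h3 : 0 ≤ s₁ ^ 2 * vnorm y ^ 2 := by positivity
    have h4 : δ ^ 2 * (s₁ ^ 2 * vnorm y ^ 2) ≤ 0.01 * (s₁ ^ 2 * vnorm y ^ 2) := by
      gcongr; nlinarith
    rw [hBt]
    nlinarith [sq_nonneg (vnorm (Eᵀ *ᵥ y))]
  have hBhigh : ‖B‖ ^ 2 ≤ 1.03 * s₂ ^ 2 := by
    have h0 : ‖Bᵀ‖ ≤ √(1.03 * s₂ ^ 2) := by
      refine l2norm_le (Real.sqrt_nonneg _) fun y => ?_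
      refine abs_le_of_sq_le_sq' ?_ (mul_nonneg (Real.sqrt_nonneg _) (vnorm_nonneg y)) |>.2
      rw [mul_pow, Real.sq_sqrt (by positivity), hBt]
      have h1 := (abs_le.1 (hcross y)).2
      have h2 : vnorm (Gᵀ *ᵥ y) ^ 2 ≤ s₂ ^ 2 * vnorm y ^ 2 := by
        rw [← mul_pow]
        refine pow_le_pow_left₀ (vnorm_nonneg _) ((vnorm_mulVec_le _ y).trans ?_) 2
        rw [l2norm_transpose]
        exact mul_le_mul_of_nonneg_right hGn (vnorm_nonneg y)
      have h3 : vnorm (Eᵀ *ᵥ y) ^ 2 ≤ 0.01 * s₁ ^ 2 * vnorm y ^ 2 := by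
        have h4 := pow_le_pow_left₀ (vnorm_nonneg _) (vnorm_mulVec_le Eᵀ y) 2
        rw [mul_pow, hEt] at h4
        exact h4.trans (mul_le_mul_of_nonneg_right hE (sq_nonneg _))
      nlinarith [mul_le_mul_of_nonneg_right hs₁₂ (sq_nonneg (vnorm y))]
    rw [l2norm_transpose] at h0
    have := pow_le_pow_left₀ (norm_nonneg _) h0 2
    rwa [Real.sq_sqrt (by positivity)] at this
  have hBn : ‖B‖ ≤ 1.02 * s₂ :=
    abs_le_of_sq_le_sq' (hBhigh.trans (by nlinarith)) (by positivity) |>.2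
  have hcontr : ‖1 - η • (B * Bᵀ)‖ ≤ 1 - 0.72 * (η * s₁ ^ 2) :=
    l2norm_one_sub_smul_le hη hηs hx1 hBlow hBhigh
  -- lower bound for the iterate before orthonormalization
  set M := U - η • ((U * B - Us * Bs) * Bᵀ + D) with hM
  have hres : ‖(U * B - Us * Bs) * Bᵀ‖ ≤ 0.0302 * s₁ ^ 2 := by
    -- The misfit splits into the least squares error inside the range of `U` and the part of `X⋆`
    -- outside it. The symmetry of the subspace distance bounds the latter.
    have h1 : U * B - Us * Bs = U * E - (1 - U * Uᵀ) * Us * Bs := by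
      rw [hEdef, hG, Matrix.mul_sub, Matrix.sub_mul, Matrix.one_mul, Matrix.sub_mul]
      simp only [Matrix.mul_assoc]; abel
    have h2 := l2norm_proj_symm hU hUs (by linarith) hδ
    rw [h1, Matrix.sub_mul, Matrix.mul_assoc U, Matrix.mul_assoc _ Bs]
    refine (norm_sub_le _ _).trans ?_
    have h3 : ‖U * (E * Bᵀ)‖ ≤ 1 * (0.02 * s₁ ^ 2) := (Matrix.l2_opNorm_mul _ _).trans (by gcongr)
    have h4 : ‖(1 - U * Uᵀ) * Us * (Bs * Bᵀ)‖ ≤ δ * (s₂ * (1.02 * s₂)) := by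
      refine (Matrix.l2_opNorm_mul _ _).trans (mul_le_mul h2 ?_ (norm_nonneg _) hδ0)
      refine (Matrix.l2_opNorm_mul _ _).trans ?_
      rw [l2norm_transpose]
      exact mul_le_mul hhigh hBn (norm_nonneg _) hs₂0.le
    have h5 : δ * (s₂ * (1.02 * s₂)) = 1.02 * (δ * s₂ ^ 2) := by ring
    rw [h5] at h4
    linarith
  -- The step moves `U` by at most `η (0.0302 + 0.02) s₁²` in operator norm, so the iterate stays
  -- nearly an isometry before orthonormalization.
  have hMlow : ∀ y, (1 - 0.051 * (η * s₁ ^ 2)) * vnorm y ≤ vnorm (M *ᵥ y) := by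
    intro y
    have h1 : U *ᵥ y = M *ᵥ y + η • (((U * B - Us * Bs) * Bᵀ + D) *ᵥ y) := by
      rw [hM, Matrix.sub_mulVec, Matrix.smul_mulVec]; abel
    have h2 := vnorm_add_le (M *ᵥ y) (η • (((U * B - Us * Bs) * Bᵀ + D) *ᵥ y))
    rw [← h1, vnorm_mulVec_orthonormal hU, vnorm_smul, abs_of_pos hη] at h2
    have h3 : vnorm (((U * B - Us * Bs) * Bᵀ + D) *ᵥ y) ≤ 0.051 * s₁ ^ 2 * vnorm y := by
      refine (vnorm_mulVec_le _ y).trans (mul_le_mul_of_nonneg_right ?_ (vnorm_nonneg y))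
      refine (norm_add_le _ _).trans ?_
      have : ‖D‖ ≤ 0.01 * s₁ ^ 2 * 2 := hD.trans (by gcongr; linarith)
      linarith
    have h4 := mul_le_mul_of_nonneg_left h3 hη.le
    nlinarith
  have hnum : ‖(1 - Us * Usᵀ) * M‖ ≤ (1 - 0.72 * (η * s₁ ^ 2)) * δ +
      η * (0.01 * s₁ ^ 2 * (δ + ξ)) := by
    have h0 : (1 - Us * Usᵀ) * Us = 0 := by
      rw [Matrix.sub_mul, Matrix.one_mul, Matrix.mul_assoc, hUs, Matrix.mul_one, sub_self]
    have h1 : (1 - Us * Usᵀ) * M = ((1 - Us * Usᵀ) * U) * (1 - η • (B * Bᵀ)) -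
        η • ((1 - Us * Usᵀ) * D) := by
      have h2 : (1 - Us * Usᵀ) * ((U * B - Us * Bs) * Bᵀ) = (1 - Us * Usᵀ) * U * (B * Bᵀ) := by
        rw [← Matrix.mul_assoc, Matrix.mul_sub, ← Matrix.mul_assoc _ Us, h0, Matrix.zero_mul,
          sub_zero, ← Matrix.mul_assoc, Matrix.mul_assoc _ B]
      rw [hM, Matrix.mul_sub, Matrix.mul_smul, Matrix.mul_add, h2, Matrix.mul_sub, Matrix.mul_one,
        Matrix.mul_smul, smul_add]
      abel
    rw [h1]
    refine (norm_sub_le _ _).trans (add_le_add ?_ ?_)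
    · refine (Matrix.l2_opNorm_mul _ _).trans ?_
      rw [mul_comm]
      exact mul_le_mul hcontr hδ (norm_nonneg _) (by linarith)
    · rw [norm_smul, Real.norm_of_nonneg hη.le]
      refine mul_le_mul_of_nonneg_left ?_ hη.le
      refine le_trans ?_ hD
      refine l2norm_le (norm_nonneg _) fun y => ?_
      rw [← Matrix.mulVec_mulVec]
      exact (vnorm_proj_le hUs _).trans (vnorm_mulVec_le D y)
  have hfin := l2norm_mul_qrFactor_le hQ (by linarith) hnum hMlow
  refine hfin.trans ?_
  -- With `x = η s₁² ≤ 1/2`, the claim becomes `(1 - 0.72 x) δ + 0.01 x (δ + ξ) ≤ ((1 - 0.5 x) δ +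
  -- 0.02 x ξ)(1 - 0.051 x)`; the gap between 0.72 and 0.5 absorbs both the deviation and the QR
  -- loss.
  rw [div_le_iff₀ (by linarith)]
  set x := η * s₁ ^ 2 with hx
  have e1 : 0.5 * η * s₁ ^ 2 = 0.5 * x := by rw [hx]; ring
  have e2 : η * (0.01 * s₁ ^ 2 * (δ + ξ)) = 0.01 * x * (δ + ξ) := by rw [hx]; ring
  rw [e1, e2]
  have p1 : 0 ≤ x * δ := by positivity
  have p2 : 0 ≤ x * ξ := by positivity
  have p3 : x * (x * ξ) ≤ 0.5 * (x * ξ) := by gcongr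
  have p4 : 0 ≤ x * (x * δ) := by positivity
  have p5 : ((1 - 0.5 * x) * δ + 0.02 * x * ξ) * (1 - 0.051 * x) = δ - 0.551 * (x * δ) +
      0.0255 * (x * (x * δ)) + 0.02 * (x * ξ) - 0.00102 * (x * (x * ξ)) := by ring
  rw [p5]
  linarith

end Contraction

/-! ### Measurability and norm bounds for the pseudoinverse. -/

section PseudoInverse

variable {m r : ℕ}

instance instBorelSpaceMatrix {n r : ℕ} : BorelSpace (Matrix (Fin n) (Fin r) ℝ) :=
  inferInstanceAs (BorelSpace (Fin n → Fin r → ℝ))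

lemma measurable_matrix_iff {α : Type*} [MeasurableSpace α] {n r : ℕ}
    {f : α → Matrix (Fin n) (Fin r) ℝ} : Measurable f ↔ ∀ i j, Measurable fun a => f a i j :=
  (measurable_pi_iff (X := fun _ : Fin n => Fin r → ℝ)).trans
    (forall_congr' fun _ => measurable_pi_iff)

lemma measurable_matrix_mul {α : Type*} [MeasurableSpace α] {l n r : ℕ}
    {f : α → Matrix (Fin l) (Fin n) ℝ} {g : α → Matrix (Fin n) (Fin r) ℝ}
    (hf : Measurable f) (hg : Measurable g) : Measurable fun a => f a * g a := by
  rw [measurable_matrix_iff] at *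
  intro i j
  simp only [Matrix.mul_apply]
  exact Finset.measurable_fun_sum _ fun k _ => (hf i k).mul (hg k j)

lemma measurable_matrix_transpose {α : Type*} [MeasurableSpace α] {n r : ℕ}
    {f : α → Matrix (Fin n) (Fin r) ℝ} (hf : Measurable f) : Measurable fun a => (f a)ᵀ := by
  rw [measurable_matrix_iff] at *
  exact fun i j => hf j i

lemma measurable_mulVec {α : Type*} [MeasurableSpace α] {n r : ℕ}
    {f : α → Matrix (Fin n) (Fin r) ℝ} {g : α → Fin r → ℝ}
    (hf : Measurable f) (hg : Measurable g) : Measurable fun a => f a *ᵥ g a := by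
  rw [measurable_matrix_iff] at hf
  rw [measurable_pi_iff] at *
  intro i
  simp only [Matrix.mulVec, dotProduct]
  exact Finset.measurable_fun_sum _ fun k _ => (hf i k).mul (hg k)

/-- The formula `det⁻¹ • adjugate` holds for singular matrices as well, since both sides are then
zero; no case distinction on invertibility is needed. -/
lemma measurable_matrix_inv : Measurable fun M : Matrix (Fin r) (Fin r) ℝ => M⁻¹ := by
  have h1 : Measurable fun M : Matrix (Fin r) (Fin r) ℝ => M.det :=
    (Continuous.matrix_det continuous_id).measurable
  have h2 : Measurable fun M : Matrix (Fin r) (Fin r) ℝ => M.adjugate :=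
    (Continuous.matrix_adjugate continuous_id).measurable
  rw [measurable_matrix_iff] at h2 ⊢
  intro i j
  have : (fun M : Matrix (Fin r) (Fin r) ℝ => M⁻¹ i j) = fun M => M.det⁻¹ * M.adjugate i j := by
    funext M
    rw [Matrix.inv_def, Ring.inverse_eq_inv']; rfl
  rw [this]
  exact h1.inv.mul (h2 i j)

lemma measurable_pinv {α : Type*} [MeasurableSpace α] {f : α → Matrix (Fin m) (Fin r) ℝ}
    (hf : Measurable f) : Measurable fun a => pinv (f a) :=
  measurable_matrix_mul (measurable_matrix_inv.comp
    (measurable_matrix_mul (measurable_matrix_transpose hf) hf)) (measurable_matrix_transpose hf)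

lemma isUnit_gram {M : Matrix (Fin m) (Fin r) ℝ} {a : ℝ} (ha : 0 < a)
    (h : ∀ y, a * vnorm y ^ 2 ≤ vnorm (M *ᵥ y) ^ 2) : IsUnit (Mᵀ * M) := by
  rw [← Matrix.mulVec_injective_iff_isUnit]
  intro x y hxy
  have h1 := h (x - y)
  have h2 : vnorm (M *ᵥ (x - y)) ^ 2 = 0 := by
    rw [vnorm_sq, dotProduct_mulVec_transpose, Matrix.mulVec_mulVec, Matrix.mulVec_sub, hxy]
    simp
  have h3 : vnorm (x - y) ^ 2 = 0 := by
    have := sq_nonneg (vnorm (x - y))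
    rw [h2] at h1
    nlinarith
  exact sub_eq_zero.1 (vnorm_eq_zero.1 (pow_eq_zero_iff (by norm_num) |>.1 h3))

lemma pinv_mul_self {M : Matrix (Fin m) (Fin r) ℝ} {a : ℝ} (ha : 0 < a)
    (h : ∀ y, a * vnorm y ^ 2 ≤ vnorm (M *ᵥ y) ^ 2) : pinv M * M = 1 := by
  have := (Matrix.isUnit_iff_isUnit_det _).1 (isUnit_gram ha h)
  rw [pinv, Matrix.mul_assoc, Matrix.nonsing_inv_mul _ this]

/-- With `w = (Mᵀ M)⁻¹ y` the transposed pseudoinverse sends `y` to `M w`. Then `‖M w‖² = ⟨w, y⟩`,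
and `a ‖w‖² ≤ ‖M w‖²` closes the estimate by Cauchy–Schwarz. -/
lemma vnorm_pinv_transpose_sq_le {M : Matrix (Fin m) (Fin r) ℝ} {a : ℝ} (ha : 0 < a)
    (h : ∀ y, a * vnorm y ^ 2 ≤ vnorm (M *ᵥ y) ^ 2) (y : Fin r → ℝ) :
    vnorm ((pinv M)ᵀ *ᵥ y) ^ 2 ≤ a⁻¹ * vnorm y ^ 2 := by
  have hdet := (Matrix.isUnit_iff_isUnit_det _).1 (isUnit_gram ha h)
  set w := (Mᵀ * M)⁻¹ *ᵥ y with hw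
  have hsymm : ((Mᵀ * M)⁻¹)ᵀ = (Mᵀ * M)⁻¹ := by
    rw [Matrix.transpose_nonsing_inv, Matrix.transpose_mul, Matrix.transpose_transpose]
  have h1 : (pinv M)ᵀ *ᵥ y = M *ᵥ w := by
    rw [pinv, Matrix.transpose_mul, Matrix.transpose_transpose, hsymm, hw, Matrix.mulVec_mulVec]
  have h2 : vnorm (M *ᵥ w) ^ 2 ≤ vnorm w * vnorm y := by
    have : vnorm (M *ᵥ w) ^ 2 = w ⬝ᵥ y := by
      rw [vnorm_sq, dotProduct_mulVec_transpose, Matrix.mulVec_mulVec, hw, Matrix.mulVec_mulVec,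
        Matrix.mul_nonsing_inv _ hdet, Matrix.one_mulVec]
    rw [this]; exact dotProduct_le_vnorm _ _
  rw [h1]
  set b := vnorm (M *ᵥ w) ^ 2 with hb
  have hb0 : 0 ≤ b := sq_nonneg _
  have h3 : a * vnorm w ^ 2 ≤ b := h w
  have h4 : b ^ 2 ≤ vnorm w ^ 2 * vnorm y ^ 2 := by
    rw [← mul_pow]; exact pow_le_pow_left₀ hb0 h2 2
  rcases hb0.eq_or_lt with h0 | h0
  · rw [← h0]; positivity
  · rw [inv_mul_eq_div, le_div_iff₀ ha]
    have h5 : a * b ^ 2 ≤ b * vnorm y ^ 2 := by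
      have := mul_le_mul_of_nonneg_right h3 (sq_nonneg (vnorm y))
      nlinarith
    refine le_of_mul_le_mul_left (a := b) ?_ h0
    linarith

/-- A condition at the points of a net that bounds a tall matrix from below. -/
lemma gram_lower_bound {N : Finset (Fin r → ℝ)} (hN : IsHalfNet N) {M : Matrix (Fin m) (Fin r) ℝ}
    (h : ∀ x ∈ N, ∀ y ∈ N, (M *ᵥ x) ⬝ᵥ (M *ᵥ y) - m * (x ⬝ᵥ y) ≤ m / 8) (y : Fin r → ℝ) :
    (m / 2 : ℝ) * vnorm y ^ 2 ≤ vnorm (M *ᵥ y) ^ 2 := by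
  have hdot : ∀ x y, x ⬝ᵥ (Mᵀ * M - (m : ℝ) • (1 : Matrix (Fin r) (Fin r) ℝ)) *ᵥ y =
      (M *ᵥ x) ⬝ᵥ (M *ᵥ y) - m * (x ⬝ᵥ y) := by
    intro x y
    rw [Matrix.sub_mulVec, Matrix.smul_mulVec, Matrix.one_mulVec, dotProduct_sub, dotProduct_smul,
      smul_eq_mul, ← Matrix.mulVec_mulVec, Matrix.dotProduct_mulVec, Matrix.vecMul_transpose]
  have h1 : ‖Mᵀ * M - (m : ℝ) • (1 : Matrix (Fin r) (Fin r) ℝ)‖ ≤ 4 * (m / 8) :=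
    l2norm_le_of_net hN hN (by positivity) fun x hx y hy => by rw [hdot]; exact h x hx y hy
  have h2 := (abs_le.1 (dotProduct_mulVec_le (Mᵀ * M - (m : ℝ) • 1) y y)).1
  rw [hdot, ← vnorm_sq, ← vnorm_sq] at h2
  nlinarith [mul_le_mul_of_nonneg_right h1 (sq_nonneg (vnorm y))]

end PseudoInverse

/-! ### Linear forms supported on a single measurement. -/

section Rows

variable {n q m r : ℕ} {Ω : Type*} [MeasurableSpace Ω] {P : Measure Ω}

/-- Indices of the entries of one batch: row `(k, i)`, and a column of the sensing matrix or the
noise entry. -/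
abbrev BatchIndex (n q m : ℕ) : Type := (Fin q × Fin m) × (Fin n ⊕ Unit)

/-- Variances of the entries of one batch. -/
def batchVar (n q m : ℕ) (σv : ℝ≥0) : BatchIndex n q m → ℝ≥0 :=
  fun p => Sum.elim (fun _ => 1) (fun _ => σv ^ 2) p.2

/-- The sensing matrices of a batch with entries `Z`. -/
def batchA (z : BatchIndex n q m → ℝ) (k : Fin q) : Matrix (Fin m) (Fin n) ℝ :=
  Matrix.of fun i l => z ((k, i), Sum.inl l)

/-- The noise of a batch with entries `Z`. -/
def batchV (z : BatchIndex n q m → ℝ) (k : Fin q) (i : Fin m) : ℝ := z ((k, i), Sum.inr ())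

/-- Coefficients of a linear form in one row. -/
def rowCoef (j : Fin q × Fin m) (w : Fin n → ℝ) (a : ℝ) : BatchIndex n q m → ℝ :=
  fun p => if p.1 = j then Sum.elim w (fun _ => a) p.2 else 0

lemma linForm_rowCoef (Z : BatchIndex n q m → Ω → ℝ) (k : Fin q) (i : Fin m) (w : Fin n → ℝ)
    (a : ℝ) (ω : Ω) : linForm Z (rowCoef (k, i) w a) ω =
      (batchA (fun p => Z p ω) k *ᵥ w) i + a * batchV (fun p => Z p ω) k i := by
  simp only [linForm, rowCoef, ite_mul, zero_mul, Fintype.sum_prod_type (α₁ := Fin q × Fin m)]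
  rw [Finset.sum_eq_single (k, i)]
  · simp [batchA, batchV, Matrix.mulVec, dotProduct, mul_comm]
  · intro b _ hb
    simp [hb]
  · simp

lemma covForm_rowCoef (σv : ℝ≥0) (j j' : Fin q × Fin m) (w w' : Fin n → ℝ) (a a' : ℝ) :
    covForm (batchVar n q m σv) (rowCoef j w a) (rowCoef j' w' a') =
      if j = j' then w ⬝ᵥ w' + a * a' * σv ^ 2 else 0 := by
  simp only [covForm, rowCoef, batchVar, Fintype.sum_prod_type (α₁ := Fin q × Fin m)]
  rw [Finset.sum_eq_single j]
  · by_cases h : j = j'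
    · simp [h, dotProduct]
    · simp [h]
  · intro b _ hb
    simp [hb]
  · simp

end Rows

/-! ### Gram matrices, residuals and their independence. -/

section LeastSquares

variable {n q m r : ℕ} {Ω : Type*} [MeasurableSpace Ω] {P : Measure Ω} {σv : ℝ≥0}
  {Z : BatchIndex n q m → Ω → ℝ}

/-- The bilinear deviation of the compressed sensing matrix of one column. -/
lemma tail_gram (h : IsGaussianFamily P (batchVar n q m σv) Z) {U : Matrix (Fin n) (Fin r) ℝ}
    (hU : Uᵀ * U = 1) (k : Fin q) {x y : Fin r → ℝ} (hx : vnorm x = 1) (hy : vnorm y = 1)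
    {u : ℝ} (hu : 0 ≤ u) (hm : 0 < m) (h1 : 128 * u ≤ m) (h2 : 4096 * u ≤ m) :
    P {ω | (m / 8 : ℝ) ≤ ((batchA (fun p => Z p ω) k * U) *ᵥ x) ⬝ᵥ
      ((batchA (fun p => Z p ω) k * U) *ᵥ y) - m * (x ⬝ᵥ y)} ≤ ENNReal.ofReal (Real.exp (-u)) := by
  have hm' : (0 : ℝ) < m := by exact_mod_cast hm
  have hUU : ∀ x y : Fin r → ℝ, (U *ᵥ x) ⬝ᵥ (U *ᵥ y) = x ⬝ᵥ y := by
    intro x y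
    rw [dotProduct_mulVec_transpose, Matrix.mulVec_mulVec, hU, Matrix.one_mulVec, dotProduct_comm]
  set c : Fin m → BatchIndex n q m → ℝ := fun i => rowCoef (k, i) (U *ᵥ x) 0 with hc
  set d : Fin m → BatchIndex n q m → ℝ := fun i => rowCoef (k, i) (U *ᵥ y) 0 with hd
  have hne : ∀ i i' : Fin m, i ≠ i' → ((k, i) : Fin q × Fin m) ≠ (k, i') := by
    intro i i' h h'
    exact h (Prod.ext_iff.1 h').2
  have hone : ∀ i, covForm (batchVar n q m σv) (c i) (c i) *
      covForm (batchVar n q m σv) (d i) (d i) = 1 := by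
    intro i
    rw [hc, hd, covForm_rowCoef, covForm_rowCoef, if_pos rfl, if_pos rfl, hUU, hUU, ← vnorm_sq,
      ← vnorm_sq, hx, hy]
    norm_num
  -- The rows contribute `m` independent products of two standard Gaussians. With `τ = m / 8` the
  -- Bernstein conditions read `128 u ≤ m` and `4096 u ≤ m`.
  have := h.bernstein (u := u) (M := 1) (V := m) (τ := m / 8) c d
    (fun i i' hi => by rw [hc, covForm_rowCoef, if_neg (hne i i' hi)])
    (fun i i' hi => by rw [hc, hd, covForm_rowCoef, if_neg (hne i i' hi)])
    (fun i i' hi => by rw [hd, covForm_rowCoef, if_neg (hne i i' hi)]) hu (by positivity)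
    zero_le_one (fun i => by rw [hone]; norm_num) (by simp [hone]) (by linarith) (by nlinarith)
  convert this using 6 with ω
  rw [Finset.sum_sub_distrib]
  congr 1
  · simp only [dotProduct, hc, hd, linForm_rowCoef, zero_mul, add_zero, Matrix.mulVec_mulVec]
  · simp [hc, hd, covForm_rowCoef, hUU]

/-- The compressed sensing matrix of column `k`, from the entries of all of them. -/
def stackMat (g : (Fin q × Fin m) × Fin r → ℝ) (k : Fin q) : Matrix (Fin m) (Fin r) ℝ :=
  Matrix.of fun i j => g ((k, i), j)

/-- All compressed sensing matrices are well conditioned at the points of a net. -/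
def GoodGram (N : Finset (Fin r → ℝ)) (G : Fin q → Matrix (Fin m) (Fin r) ℝ) : Prop :=
  ∀ k, ∀ x ∈ N, ∀ y ∈ N, (G k *ᵥ x) ⬝ᵥ (G k *ᵥ y) - m * (x ⬝ᵥ y) ≤ m / 8

lemma measurable_stackMat (k : Fin q) :
    Measurable fun g : (Fin q × Fin m) × Fin r → ℝ => stackMat g k :=
  measurable_matrix_iff.2 fun _ _ => measurable_pi_apply _

lemma measurableSet_goodGram (N : Finset (Fin r → ℝ)) :
    MeasurableSet {g : (Fin q × Fin m) × Fin r → ℝ | GoodGram N (stackMat g)} := by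
  simp only [GoodGram, Set.ofPred_forall]
  refine MeasurableSet.iInter fun k => Finset.measurableSet_biInter _ fun x _ =>
    Finset.measurableSet_biInter _ fun y _ => measurableSet_le ?_ measurable_const
  have h1 := measurable_mulVec (measurable_stackMat (r := r) (m := m) k) (measurable_const (a := x))
  have h2 := measurable_mulVec (measurable_stackMat (r := r) (m := m) k) (measurable_const (a := y))
  rw [measurable_pi_iff] at h1 h2
  exact (Finset.measurable_fun_sum _ fun i _ => (h1 i).mul (h2 i)).sub_const _

/-- The part of the measurements of column `k` that is not explained by the range of `U`. -/
def residual (z : BatchIndex n q m → ℝ) (p : Fin q → Fin n → ℝ) (k : Fin q) : Fin m → ℝ :=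
  batchA z k *ᵥ p k + batchV z k

lemma isGaussianFamily_residual (h : IsGaussianFamily P (batchVar n q m σv) Z)
    (p : Fin q → Fin n → ℝ) :
    IsGaussianFamily P (fun j : Fin q × Fin m => (p j.1 ⬝ᵥ p j.1 + (σv : ℝ) ^ 2).toNNReal)
      fun j ω => residual (fun e => Z e ω) p j.1 j.2 := by
  have := h.linForm_family (fun j : Fin q × Fin m => rowCoef j (p j.1) 1) fun j j' hj => by
    rw [covForm_rowCoef, if_neg hj]
  simp only [covForm_rowCoef, if_true, one_mul] at this
  convert this using 3 with j ω
  obtain ⟨k, i⟩ := j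
  rw [linForm_rowCoef]
  simp [residual]

/-- The covariance of an entry of `A_k U` with the residual of the same row is an entry of `Uᵀ p_k`,
hence zero, and distinct rows share no variables. Uncorrelated jointly Gaussian families are
independent. -/
lemma indepFun_residual (h : IsGaussianFamily P (batchVar n q m σv) Z)
    {U : Matrix (Fin n) (Fin r) ℝ} {p : Fin q → Fin n → ℝ} (hp : ∀ k, Uᵀ *ᵥ p k = 0) :
    IndepFun (fun ω (j : (Fin q × Fin m) × Fin r) =>
        (batchA (fun e => Z e ω) j.1.1 * U) j.1.2 j.2)
      (fun ω (j : Fin q × Fin m) => residual (fun e => Z e ω) p j.1 j.2) P := by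
  have := h.indepFun_linForm
    (fun j : (Fin q × Fin m) × Fin r => rowCoef j.1 (fun l => U l j.2) 0)
    (fun j : Fin q × Fin m => rowCoef j (p j.1) 1) fun j k => by
      rw [covForm_rowCoef]
      split_ifs with hjk
      · have h2 : (fun l => U l j.2) ⬝ᵥ p k.1 = 0 := congrFun (hp k.1) j.2
        rw [h2]; simp
      · rfl
  convert this using 4 with ω j ω j
  · obtain ⟨⟨k, i⟩, l⟩ := j
    rw [linForm_rowCoef, zero_mul, add_zero]
    rfl
  · obtain ⟨k, i⟩ := j
    rw [linForm_rowCoef]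
    simp [residual]

/-- Conditioning on well-conditioned compressed sensing matrices. -/
lemma measure_goodGram_le [IsProbabilityMeasure P]
    (h : IsGaussianFamily P (batchVar n q m σv) Z) {U : Matrix (Fin n) (Fin r) ℝ}
    {p : Fin q → Fin n → ℝ} (hp : ∀ k, Uᵀ *ᵥ p k = 0) (N : Finset (Fin r → ℝ))
    {φ : (Fin q → Matrix (Fin r) (Fin m) ℝ) → (Fin q × Fin m → ℝ) → ℝ}
    (hφ : Measurable fun a : (Fin q → Matrix (Fin r) (Fin m) ℝ) × (Fin q × Fin m → ℝ) =>
      φ a.1 a.2) {τ : ℝ} {b : ℝ≥0∞}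
    (hb : ∀ G : Fin q → Matrix (Fin m) (Fin r) ℝ, GoodGram N G →
      P {ω | τ ≤ φ (fun k => pinv (G k)) fun j => residual (fun e => Z e ω) p j.1 j.2} ≤ b) :
    P {ω | GoodGram N (fun k => batchA (fun e => Z e ω) k * U) ∧
      τ ≤ φ (fun k => pinv (batchA (fun e => Z e ω) k * U))
        fun j => residual (fun e => Z e ω) p j.1 j.2} ≤ b := by
  set S : Set (((Fin q × Fin m) × Fin r → ℝ) × (Fin q × Fin m → ℝ)) :=
    {a | GoodGram N (stackMat a.1) ∧ τ ≤ φ (fun k => pinv (stackMat a.1 k)) a.2} with hS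
  have hSm : MeasurableSet S := by
    have e : S = Prod.fst ⁻¹' {g | GoodGram N (stackMat g)} ∩
        {a | τ ≤ φ (fun k => pinv (stackMat a.1 k)) a.2} := by ext; rfl
    rw [e]
    refine (measurable_fst (measurableSet_goodGram N)).inter (measurableSet_le measurable_const ?_)
    exact hφ.comp ((measurable_pi_iff.2 fun k => measurable_pinv
      ((measurable_stackMat k).comp measurable_fst)).prodMk measurable_snd)
  have hZ : Measurable fun ω (e : BatchIndex n q m) => Z e ω := measurable_pi_iff.2 h.meas
  have hX : Measurable fun ω (j : (Fin q × Fin m) × Fin r) =>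
      (batchA (fun e => Z e ω) j.1.1 * U) j.1.2 j.2 := by
    refine measurable_pi_iff.2 fun j => ?_
    simp only [Matrix.mul_apply, batchA, Matrix.of_apply]
    exact Finset.measurable_fun_sum _ fun l _ => (h.meas _).mul_const _
  have hY : Measurable fun ω (j : Fin q × Fin m) => residual (fun e => Z e ω) p j.1 j.2 :=
    measurable_pi_iff.2 (isGaussianFamily_residual h p).meas
  have := measure_le_of_indepFun hX hY (indepFun_residual h hp) hSm (Q := fun _ => True)
    (Filter.Eventually.of_forall fun _ => trivial) (p := b) fun g _ => by
      -- For a badly conditioned frozen Gram family the slice of the event is empty, so the tail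
      -- bound is needed only for good ones.
      by_cases hg : GoodGram N (stackMat g)
      · exact (measure_mono fun ω hω => hω.2).trans (hb (stackMat g) hg)
      · have : {ω | (g, fun j : Fin q × Fin m => residual (fun e => Z e ω) p j.1 j.2) ∈ S} = ∅ :=
          Set.eq_empty_of_forall_notMem fun ω hω => hg hω.1
        rw [this]; simp
  exact this

end LeastSquares

/-! ### Tail bounds for the least squares errors. -/

section LeastSquaresTails

variable {n q m r : ℕ} {Ω : Type*} [MeasurableSpace Ω] {P : Measure Ω} {σv : ℝ≥0}
  {Z : BatchIndex n q m → Ω → ℝ}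

lemma measure_exists_le {α : Type*} (N : Finset α) {Q : α → Ω → Prop} {b : ℝ≥0∞}
    (h : ∀ x ∈ N, P {ω | Q x ω} ≤ b) : P {ω | ∃ x ∈ N, Q x ω} ≤ N.card * b := by
  have : {ω | ∃ x ∈ N, Q x ω} = ⋃ x ∈ N, {ω | Q x ω} := by ext; simp
  rw [this]
  refine (measure_biUnion_finset_le N _).trans ((Finset.sum_le_card_nsmul _ _ _ h).trans_eq ?_)
  simp

lemma GoodGram.vnorm_pinv_le {N : Finset (Fin r → ℝ)} (hN : IsHalfNet N) (hm : 0 < m)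
    {G : Fin q → Matrix (Fin m) (Fin r) ℝ} (hG : GoodGram N G) (k : Fin q) {y : Fin r → ℝ}
    (hy : vnorm y = 1) : vnorm ((pinv (G k))ᵀ *ᵥ y) ^ 2 ≤ 2 / m := by
  have hm' : (0 : ℝ) < m := by exact_mod_cast hm
  have := vnorm_pinv_transpose_sq_le (a := m / 2) (by positivity) (gram_lower_bound hN (hG k)) y
  rw [hy] at this
  refine this.trans_eq ?_
  field_simp

lemma measurable_leastSquares (y : Fin r → ℝ) (k : Fin q) :
    Measurable fun a : (Fin q → Matrix (Fin r) (Fin m) ℝ) × (Fin q × Fin m → ℝ) =>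
      y ⬝ᵥ (a.1 k *ᵥ fun i => a.2 (k, i)) := by
  have h1 : Measurable fun a : (Fin q → Matrix (Fin r) (Fin m) ℝ) × (Fin q × Fin m → ℝ) =>
      a.1 k := (measurable_pi_apply k).comp measurable_fst
  have h2 : Measurable fun a : (Fin q → Matrix (Fin r) (Fin m) ℝ) × (Fin q × Fin m → ℝ) =>
      fun i => a.2 (k, i) := measurable_pi_iff.2 fun i => (measurable_pi_apply _).comp measurable_snd
  have h3 := measurable_pi_iff.1 (measurable_mulVec h1 h2)
  exact Finset.measurable_fun_sum _ fun j _ => (h3 j).const_mul _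

/-- Tail of a linear form in the least squares errors. -/
lemma tail_leastSquares_linear [IsProbabilityMeasure P]
    (h : IsGaussianFamily P (batchVar n q m σv) Z) {U : Matrix (Fin n) (Fin r) ℝ}
    {p : Fin q → Fin n → ℝ} (hp : ∀ k, Uᵀ *ᵥ p k = 0) {N : Finset (Fin r → ℝ)} (hN : IsHalfNet N)
    (hm : 0 < m) {s : ℝ} (hs : ∀ k, p k ⬝ᵥ p k + (σv : ℝ) ^ 2 ≤ s ^ 2) (a : Fin q → ℝ)
    {y : Fin r → ℝ} (hy : vnorm y = 1) {u τ : ℝ} (hu : 0 ≤ u) (hτ : 0 < τ)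
    (hτu : 4 * u * s ^ 2 * ∑ k, a k ^ 2 ≤ m * τ ^ 2) :
    P {ω | GoodGram N (fun k => batchA (fun e => Z e ω) k * U) ∧
      τ ≤ ∑ k, a k * (y ⬝ᵥ (pinv (batchA (fun e => Z e ω) k * U) *ᵥ
        residual (fun e => Z e ω) p k))} ≤ ENNReal.ofReal (Real.exp (-u)) := by
  have hm' : (0 : ℝ) < m := by exact_mod_cast hm
  refine measure_goodGram_le h hp N (φ := fun B z => ∑ k, a k * (y ⬝ᵥ (B k *ᵥ fun i => z (k, i))))
    (Finset.measurable_fun_sum _ fun k _ => (measurable_leastSquares y k).const_mul _) fun G hG => ?_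
  have hR := isGaussianFamily_residual h p
  -- For frozen pseudoinverses the quantity is a single linear form in the residuals, of variance at
  -- most `(2 s² / m) ∑ a_k²`.
  set c : Fin q × Fin m → ℝ := fun j => a j.1 * ((pinv (G j.1))ᵀ *ᵥ y) j.2 with hc
  refine le_trans (measure_mono fun ω hω => ?_) (hR.tail_linForm c hu hτ ?_)
  · refine le_of_le_of_eq (show τ ≤ _ from hω) ?_
    simp only [linForm, hc, Fintype.sum_prod_type]
    refine Finset.sum_congr rfl fun k _ => ?_
    rw [dotProduct_mulVec_transpose, dotProduct_comm, dotProduct, Finset.mul_sum]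
    exact Finset.sum_congr rfl fun i _ => by ring
  · have hcov : covForm (fun j : Fin q × Fin m =>
        (p j.1 ⬝ᵥ p j.1 + (σv : ℝ) ^ 2).toNNReal) c c ≤ ∑ k, a k ^ 2 * (s ^ 2 * (2 / m)) := by
      simp only [covForm, hc, Fintype.sum_prod_type]
      refine Finset.sum_le_sum fun k _ => ?_
      have hk : 0 ≤ p k ⬝ᵥ p k + (σv : ℝ) ^ 2 := by rw [← vnorm_sq]; positivity
      have e : ∑ i, a k * ((pinv (G k))ᵀ *ᵥ y) i * (a k * ((pinv (G k))ᵀ *ᵥ y) i) *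
          ((p k ⬝ᵥ p k + (σv : ℝ) ^ 2).toNNReal : ℝ) =
          a k ^ 2 * ((p k ⬝ᵥ p k + (σv : ℝ) ^ 2) * vnorm ((pinv (G k))ᵀ *ᵥ y) ^ 2) := by
        rw [Real.coe_toNNReal _ hk, vnorm_sq_eq_sum, Finset.mul_sum, Finset.mul_sum]
        exact Finset.sum_congr rfl fun i _ => by ring
      rw [e]
      gcongr
      · exact hs k
      · exact hG.vnorm_pinv_le hN hm k hy
    calc _ ≤ 2 * u * ∑ k, a k ^ 2 * (s ^ 2 * (2 / m)) := by gcongr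
      _ = (4 * u * s ^ 2 * ∑ k, a k ^ 2) / m := by
          rw [← Finset.sum_mul]; field_simp; ring
      _ ≤ τ ^ 2 := by rw [div_le_iff₀ hm']; linarith

/-- Tail of the sum of squares of the least squares errors in one direction. -/
lemma tail_leastSquares_sq [IsProbabilityMeasure P]
    (h : IsGaussianFamily P (batchVar n q m σv) Z) {U : Matrix (Fin n) (Fin r) ℝ}
    {p : Fin q → Fin n → ℝ} (hp : ∀ k, Uᵀ *ᵥ p k = 0) {N : Finset (Fin r → ℝ)} (hN : IsHalfNet N)
    (hm : 0 < m) {s S : ℝ} (hs : ∀ k, p k ⬝ᵥ p k + (σv : ℝ) ^ 2 ≤ s ^ 2)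
    (hS : ∑ k, (2 / m) * (p k ⬝ᵥ p k + (σv : ℝ) ^ 2) ≤ S)
    {y : Fin r → ℝ} (hy : vnorm y = 1) {u τ : ℝ} (hu : 0 ≤ u) (hτ : 0 < τ)
    (h1 : 16 * u * (2 * s ^ 2 / m) ≤ τ) (h2 : 64 * u * (2 * s ^ 2 / m * S) ≤ τ ^ 2) :
    P {ω | GoodGram N (fun k => batchA (fun e => Z e ω) k * U) ∧
      τ + S ≤ ∑ k, (y ⬝ᵥ (pinv (batchA (fun e => Z e ω) k * U) *ᵥ
        residual (fun e => Z e ω) p k)) ^ 2} ≤ ENNReal.ofReal (Real.exp (-u)) := by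
  have hm' : (0 : ℝ) < m := by exact_mod_cast hm
  refine measure_goodGram_le h hp N (φ := fun B z => ∑ k, (y ⬝ᵥ (B k *ᵥ fun i => z (k, i))) ^ 2)
    (Finset.measurable_fun_sum _ fun k _ => (measurable_leastSquares y k).pow_const _) fun G hG => ?_
  have hR := isGaussianFamily_residual h p
  set w : Fin q × Fin m → ℝ≥0 := fun j => (p j.1 ⬝ᵥ p j.1 + (σv : ℝ) ^ 2).toNNReal with hw
  -- One form per column `k`, supported on its own block of residuals. Distinct columns are
  -- uncorrelated, and Bernstein with both families equal to `c` controls the sum of squares about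
  -- its mean, which is at most `S`.
  set c : Fin q → Fin q × Fin m → ℝ := fun k j => if j.1 = k then ((pinv (G k))ᵀ *ᵥ y) j.2 else 0
    with hc
  have hlin : ∀ k ω, linForm (fun (j : Fin q × Fin m) ω => residual (fun e => Z e ω) p j.1 j.2)
      (c k) ω = y ⬝ᵥ (pinv (G k) *ᵥ fun i => residual (fun e => Z e ω) p k i) := by
    intro k ω
    simp only [linForm, hc, Fintype.sum_prod_type]
    rw [Finset.sum_eq_single k (fun k' _ hk' => by simp [hk']) (by simp),
      dotProduct_mulVec_transpose, dotProduct_comm, dotProduct]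
    simp
  have hne : ∀ k k', k ≠ k' → covForm w (c k) (c k') = 0 := by
    intro k k' hk
    refine Finset.sum_eq_zero fun j _ => ?_
    simp only [hc]
    by_cases h : j.1 = k
    · have : j.1 ≠ k' := fun h' => hk (h.symm.trans h')
      simp [this]
    · simp [h]
  have hk0 : ∀ k, 0 ≤ p k ⬝ᵥ p k + (σv : ℝ) ^ 2 := fun k => by rw [← vnorm_sq]; positivity
  have hcov : ∀ k, covForm w (c k) (c k) =
      (p k ⬝ᵥ p k + (σv : ℝ) ^ 2) * vnorm ((pinv (G k))ᵀ *ᵥ y) ^ 2 := by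
    intro k
    simp only [covForm, hc, hw, Fintype.sum_prod_type]
    rw [Finset.sum_eq_single k (fun k' _ hk' => by simp [hk']) (by simp),
      vnorm_sq_eq_sum, Finset.mul_sum, Real.coe_toNNReal _ (hk0 k)]
    exact Finset.sum_congr rfl fun i _ => by simp; ring
  have hcov0 : ∀ k, 0 ≤ covForm w (c k) (c k) := fun k => covForm_self_nonneg _
  have hcov1 : ∀ k, covForm w (c k) (c k) ≤ 2 / m * (p k ⬝ᵥ p k + (σv : ℝ) ^ 2) := by
    intro k
    rw [hcov, mul_comm]
    exact mul_le_mul_of_nonneg_right (hG.vnorm_pinv_le hN hm k hy) (hk0 k)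
  have hcovM : ∀ k, covForm w (c k) (c k) ≤ 2 * s ^ 2 / m := by
    intro k
    refine (hcov1 k).trans ?_
    rw [mul_div_right_comm]
    exact mul_le_mul_of_nonneg_left (hs k) (by positivity)
  have hcovS : ∑ k, covForm w (c k) (c k) ≤ S := (Finset.sum_le_sum fun k _ => hcov1 k).trans hS
  refine le_trans (measure_mono fun ω hω => ?_) (hR.bernstein c c hne hne hne hu hτ
    (M := 2 * s ^ 2 / m) (V := 2 * s ^ 2 / m * S) (by positivity) (fun k => ?_) ?_ h1 h2)
  · have hω' : τ + S ≤ ∑ k, (y ⬝ᵥ (pinv (G k) *ᵥ fun i => residual (fun e => Z e ω) p k i)) ^ 2 :=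
      hω
    rw [Set.mem_ofPred_eq, Finset.sum_sub_distrib]
    simp only [hlin, ← sq]
    linarith
  · rw [sq]
    exact mul_le_mul (hcovM k) (hcovM k) (hcov0 k) (by positivity)
  · calc _ ≤ ∑ k, 2 * s ^ 2 / m * covForm w (c k) (c k) :=
          Finset.sum_le_sum fun k _ => mul_le_mul_of_nonneg_right (hcovM k) (hcov0 k)
      _ ≤ _ := by rw [← Finset.mul_sum]; gcongr

/-- The matrix of least squares errors. -/
def errMat (U : Matrix (Fin n) (Fin r) ℝ) (p : Fin q → Fin n → ℝ) (z : BatchIndex n q m → ℝ) :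
    Matrix (Fin r) (Fin q) ℝ :=
  Matrix.of fun j k => (pinv (batchA z k * U) *ᵥ residual z p k) j

lemma dotProduct_mul_errMat_transpose (U : Matrix (Fin n) (Fin r) ℝ) (p : Fin q → Fin n → ℝ)
    (z : BatchIndex n q m → ℝ) (G : Matrix (Fin r) (Fin q) ℝ) (x y : Fin r → ℝ) :
    x ⬝ᵥ (G * (errMat U p z)ᵀ) *ᵥ y =
      ∑ k, (Gᵀ *ᵥ x) k * (y ⬝ᵥ (pinv (batchA z k * U) *ᵥ residual z p k)) := by
  rw [← Matrix.mulVec_mulVec, dotProduct_mulVec_transpose, dotProduct_comm]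
  refine Finset.sum_congr rfl fun k _ => ?_
  congr 1
  rw [dotProduct_comm]; rfl

/-- The least squares errors are small in all the senses needed for the gradient step. -/
lemma measure_errMat_le [IsProbabilityMeasure P]
    (h : IsGaussianFamily P (batchVar n q m σv) Z) {U : Matrix (Fin n) (Fin r) ℝ}
    (hU : Uᵀ * U = 1)
    {p : Fin q → Fin n → ℝ} (hp : ∀ k, Uᵀ *ᵥ p k = 0) {N : Finset (Fin r → ℝ)} (hN : IsHalfNet N)
    (hm : 0 < m) {s S : ℝ} (hs : ∀ k, p k ⬝ᵥ p k + (σv : ℝ) ^ 2 ≤ s ^ 2)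
    (hS : ∑ k, (2 / m) * (p k ⬝ᵥ p k + (σv : ℝ) ^ 2) ≤ S)
    {G : Matrix (Fin r) (Fin q) ℝ} {s₂ u₁ u₂ ρ a τ : ℝ} (hG : ‖G‖ ≤ s₂) (hu₁ : 0 ≤ u₁) (hu₂ : 0 ≤ u₂)
    (hu₁m : 4096 * u₁ ≤ m) (hρ : 0 < ρ) (hρu : 16 * u₁ * s ^ 2 ≤ m * ρ ^ 2)
    (ha : 0 < a) (hau : 64 * u₂ * s ^ 2 * s₂ ^ 2 ≤ m * a ^ 2) (hτ : 0 < τ)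
    (h1 : 16 * u₂ * (2 * s ^ 2 / m) ≤ τ) (h2 : 64 * u₂ * (2 * s ^ 2 / m * S) ≤ τ ^ 2) :
    P {ω | ¬ (GoodGram N (fun k => batchA (fun e => Z e ω) k * U) ∧
      (∀ k, vnorm (pinv (batchA (fun e => Z e ω) k * U) *ᵥ residual (fun e => Z e ω) p k) ≤ ρ) ∧
      ‖G * (errMat U p fun e => Z e ω)ᵀ‖ ≤ a ∧ ‖errMat U p fun e => Z e ω‖ ^ 2 ≤ 4 * (τ + S))}
    ≤ q * (25 ^ r * ENNReal.ofReal (Real.exp (-u₁))) + q * (5 ^ r * ENNReal.ofReal (Real.exp (-u₁)))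
      + 25 ^ r * ENNReal.ofReal (Real.exp (-u₂)) + 5 ^ r * ENNReal.ofReal (Real.exp (-u₂)) := by
  have hm' : (0 : ℝ) < m := by exact_mod_cast hm
  have hS0 : 0 ≤ S := le_trans (Finset.sum_nonneg fun k _ => by
    rw [← vnorm_sq]; positivity) hS
  set b₁ := ENNReal.ofReal (Real.exp (-u₁)) with hb₁
  set b₂ := ENNReal.ofReal (Real.exp (-u₂)) with hb₂
  have hcard : (N.card : ℝ≥0∞) ≤ 5 ^ r := by exact_mod_cast hN.card_le
  have hcard2 : ((N ×ˢ N).card : ℝ≥0∞) ≤ 25 ^ r := by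
    rw [Finset.card_product, Nat.cast_mul, show (25 : ℝ≥0∞) = 5 * 5 by norm_num, mul_pow]
    exact mul_le_mul' hcard hcard
  have hq : ((Finset.univ : Finset (Fin q)).card : ℝ≥0∞) = q := by simp
  -- the four exceptional events
  have t1 : P {ω | ∃ k ∈ (Finset.univ : Finset (Fin q)), ∃ x ∈ N ×ˢ N, (m / 8 : ℝ) ≤
      ((batchA (fun p => Z p ω) k * U) *ᵥ x.1) ⬝ᵥ
      ((batchA (fun p => Z p ω) k * U) *ᵥ x.2) - m * (x.1 ⬝ᵥ x.2)} ≤ q * (25 ^ r * b₁) := by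
    refine (measure_exists_le _ fun k _ => (measure_exists_le _ fun x hx => ?_).trans
      (mul_le_mul_left hcard2 b₁)).trans (by rw [hq])
    rw [Finset.mem_product] at hx
    exact tail_gram h hU k (hN.unit _ hx.1) (hN.unit _ hx.2) hu₁ hm (by linarith) hu₁m
  -- The weight vector `Pi.single k 1` isolates column `k`. The level `ρ / 2` anticipates the loss
  -- at one net, just as `a / 4` below anticipates two.
  have t2 : P {ω | ∃ k ∈ (Finset.univ : Finset (Fin q)), ∃ y ∈ N,
      GoodGram N (fun k => batchA (fun e => Z e ω) k * U) ∧
      ρ / 2 ≤ ∑ k', (Pi.single k 1 : Fin q → ℝ) k' * (y ⬝ᵥ (pinv (batchA (fun e => Z e ω) k' * U) *ᵥ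
        residual (fun e => Z e ω) p k'))} ≤ q * (5 ^ r * b₁) := by
    refine (measure_exists_le _ fun k _ => (measure_exists_le _ fun y hy => ?_).trans
      (mul_le_mul_left hcard b₁)).trans (by rw [hq])
    refine tail_leastSquares_linear h hp hN hm hs _ (hN.unit y hy) hu₁ (by positivity) ?_
    have : ∑ k', (Pi.single k 1 : Fin q → ℝ) k' ^ 2 = 1 := by
      rw [Finset.sum_eq_single k (fun k' _ hk' => by simp [hk']) (by simp)]; simp
    rw [this]; linarith
  have t3 : P {ω | ∃ x ∈ N ×ˢ N, GoodGram N (fun k => batchA (fun e => Z e ω) k * U) ∧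
      a / 4 ≤ ∑ k, (Gᵀ *ᵥ x.1) k * (x.2 ⬝ᵥ (pinv (batchA (fun e => Z e ω) k * U) *ᵥ
        residual (fun e => Z e ω) p k))} ≤ 25 ^ r * b₂ := by
    refine (measure_exists_le _ fun x hx => ?_).trans (mul_le_mul_left hcard2 b₂)
    rw [Finset.mem_product] at hx
    refine tail_leastSquares_linear h hp hN hm hs _ (hN.unit _ hx.2) hu₂ (by positivity) ?_
    have h3 : ∑ k, (Gᵀ *ᵥ x.1) k ^ 2 ≤ s₂ ^ 2 := by
      have h4 : ∑ k, (Gᵀ *ᵥ x.1) k ^ 2 = vnorm (Gᵀ *ᵥ x.1) ^ 2 := by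
        rw [vnorm_sq_eq_sum]; simp only [sq]
      rw [h4]
      refine pow_le_pow_left₀ (vnorm_nonneg _) ((vnorm_mulVec_le _ _).trans ?_) 2
      rw [l2norm_transpose, hN.unit _ hx.1, mul_one]; exact hG
    calc _ ≤ 4 * u₂ * s ^ 2 * s₂ ^ 2 := by gcongr
      _ ≤ _ := by linarith
  have t4 : P {ω | ∃ y ∈ N, GoodGram N (fun k => batchA (fun e => Z e ω) k * U) ∧
      τ + S ≤ ∑ k, (y ⬝ᵥ (pinv (batchA (fun e => Z e ω) k * U) *ᵥ
        residual (fun e => Z e ω) p k)) ^ 2} ≤ 5 ^ r * b₂ :=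
    (measure_exists_le _ fun y hy => tail_leastSquares_sq h hp hN hm hs hS (hN.unit _ hy) hu₂ hτ
      h1 h2).trans (mul_le_mul_left hcard b₂)
  refine (measure_mono fun ω hω => ?_).trans ((measure_union_le _ _).trans (add_le_add
    ((measure_union_le _ _).trans (add_le_add ((measure_union_le _ _).trans
      (add_le_add t1 t2)) t3)) t4))
  by_contra hcon
  simp only [Set.mem_union, Set.mem_ofPred_eq, not_or, not_exists, not_and, not_le] at hcon
  obtain ⟨⟨⟨c1, c2⟩, c3⟩, c4⟩ := hcon
  have hgood : GoodGram N (fun k => batchA (fun e => Z e ω) k * U) := fun k x hx y hy =>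
    (c1 k (Finset.mem_univ k) (x, y) (Finset.mk_mem_product hx hy)).le
  refine hω ⟨hgood, fun k => ?_, ?_, ?_⟩
  · have := hN.le (pinv (batchA (fun e => Z e ω) k * U) *ᵥ residual (fun e => Z e ω) p k) (ρ / 2)
      (by positivity) fun y hy => by
        refine le_of_eq_of_le ?_ (c2 k (Finset.mem_univ k) y hy hgood).le
        rw [Finset.sum_eq_single k (fun k' _ hk' => by simp [hk']) (by simp)]; simp
    linarith
  · have := l2norm_le_of_net hN hN (M := G * (errMat U p fun e => Z e ω)ᵀ) (τ := a / 4)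
      (by positivity) fun x hx y hy => by
        rw [dotProduct_mul_errMat_transpose]
        exact (c3 (x, y) (Finset.mk_mem_product hx hy) hgood).le
    linarith
  · have h3 := l2norm_le_of_net_right hN (M := (errMat U p fun e => Z e ω)ᵀ) (τ := √(τ + S))
      (Real.sqrt_nonneg _) fun y hy => by
        refine Real.le_sqrt_of_sq_le ?_
        refine le_of_eq_of_le ?_ (c4 y hy hgood).le
        rw [vnorm_sq_eq_sum]
        refine Finset.sum_congr rfl fun k _ => ?_
        rw [← sq, dotProduct_comm]; rfl
    rw [l2norm_transpose] at h3
    have := pow_le_pow_left₀ (norm_nonneg _) h3 2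
    rw [mul_pow, Real.sq_sqrt (by positivity)] at this
    linarith

end LeastSquaresTails

/-! ### One iteration as a measurable map of the batches. -/

section Measurability

variable {n q m r : ℕ} {α : Type*} [MeasurableSpace α]

/-- The measurements of a batch with entries `z`. -/
def batchY (X : Matrix (Fin n) (Fin q) ℝ) (z : BatchIndex n q m → ℝ) (k : Fin q) : Fin m → ℝ :=
  batchA z k *ᵥ (fun i => X i k) + batchV z k

/-- One iteration of AltGDmin with batches `z₁` and `z₂`. -/
def stepMap (qr : Matrix (Fin n) (Fin r) ℝ → Matrix (Fin n) (Fin r) ℝ) (η : ℝ)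
    (X : Matrix (Fin n) (Fin q) ℝ) (U : Matrix (Fin n) (Fin r) ℝ)
    (z₁ z₂ : BatchIndex n q m → ℝ) : Matrix (Fin n) (Fin r) ℝ :=
  qr (U - (η / m) • gradU (batchA z₂) (batchY X z₂) U (updateB (batchA z₁) (batchY X z₁) U))

lemma measurable_batchA {z : α → BatchIndex n q m → ℝ} (hz : Measurable z) (k : Fin q) :
    Measurable fun a => batchA (z a) k :=
  measurable_matrix_iff.2 fun _ _ => measurable_pi_iff.1 hz _

lemma measurable_batchY (X : Matrix (Fin n) (Fin q) ℝ) {z : α → BatchIndex n q m → ℝ}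
    (hz : Measurable z) (k : Fin q) : Measurable fun a => batchY X (z a) k :=
  (measurable_mulVec (measurable_batchA hz k) measurable_const).add
    (measurable_pi_iff.2 fun _ => measurable_pi_iff.1 hz _)

lemma measurable_updateB (X : Matrix (Fin n) (Fin q) ℝ) {z : α → BatchIndex n q m → ℝ}
    (hz : Measurable z) {U : α → Matrix (Fin n) (Fin r) ℝ} (hU : Measurable U) (k : Fin q) :
    Measurable fun a => updateB (batchA (z a)) (batchY X (z a)) (U a) k :=
  measurable_mulVec (measurable_pinv (measurable_matrix_mul (measurable_batchA hz k) hU))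
    (measurable_batchY X hz k)

lemma measurable_gradU (X : Matrix (Fin n) (Fin q) ℝ) {z : α → BatchIndex n q m → ℝ}
    (hz : Measurable z) {U : α → Matrix (Fin n) (Fin r) ℝ} (hU : Measurable U)
    {b : α → Fin q → Fin r → ℝ} (hb : ∀ k, Measurable fun a => b a k) :
    Measurable fun a => gradU (batchA (z a)) (batchY X (z a)) (U a) (b a) := by
  rw [measurable_matrix_iff]
  intro i j
  simp only [gradU, Matrix.sum_apply, Matrix.vecMulVec_apply]
  refine Finset.measurable_fun_sum _ fun k _ => Measurable.mul ?_ (measurable_pi_iff.1 (hb k) j)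
  have hA := measurable_batchA hz k
  exact measurable_pi_iff.1 (measurable_mulVec (measurable_matrix_transpose hA)
    ((measurable_mulVec hA (measurable_mulVec hU (hb k))).sub (measurable_batchY X hz k))) i

lemma measurable_stepMap {qr : Matrix (Fin n) (Fin r) ℝ → Matrix (Fin n) (Fin r) ℝ}
    (hqr : Measurable qr) (η : ℝ) (X : Matrix (Fin n) (Fin q) ℝ)
    {U : α → Matrix (Fin n) (Fin r) ℝ} (hU : Measurable U) {z₁ z₂ : α → BatchIndex n q m → ℝ}
    (hz₁ : Measurable z₁) (hz₂ : Measurable z₂) :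
    Measurable fun a => stepMap qr η X (U a) (z₁ a) (z₂ a) := by
  refine hqr.comp (measurable_matrix_iff.2 fun i j => ?_)
  have h := measurable_gradU X hz₂ hU fun k => measurable_updateB X hz₁ hU k
  exact (measurable_matrix_iff.1 hU i j).sub ((measurable_matrix_iff.1 h i j).const_mul _)

lemma measurable_l2norm {f : α → Matrix (Fin n) (Fin r) ℝ} (hf : Measurable f) :
    Measurable fun a => ‖f a‖ :=
  (continuous_norm (E := Matrix (Fin n) (Fin r) ℝ)).measurable.comp hf

lemma measurable_vnorm {f : α → Fin r → ℝ} (hf : Measurable f) :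
    Measurable fun a => vnorm (f a) := by
  have h : Continuous fun x : Fin r → ℝ => vnorm x := by unfold vnorm; fun_prop
  exact h.measurable.comp hf

lemma measurable_sd2 (Us : Matrix (Fin n) (Fin r) ℝ) {f : α → Matrix (Fin n) (Fin r) ℝ}
    (hf : Measurable f) : Measurable fun a => sd2 Us (f a) :=
  measurable_l2norm (measurable_matrix_mul measurable_const hf)

end Measurability

/-! ### Concentration of the gradient for a fixed right factor. -/

section Gradient

variable {n q m r : ℕ} {Ω : Type*} [MeasurableSpace Ω] {P : Measure Ω} {σv : ℝ≥0}
  {Z : BatchIndex n q m → Ω → ℝ}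

/-- The matrix whose columns are the vectors `b k`. -/
def colMat (b : Fin q → Fin r → ℝ) : Matrix (Fin r) (Fin q) ℝ := Matrix.of fun j k => b k j

/-- Deviation of the gradient from its mean, for fixed right factor. -/
def gradDev (X : Matrix (Fin n) (Fin q) ℝ) (U : Matrix (Fin n) (Fin r) ℝ) (b : Fin q → Fin r → ℝ)
    (z : BatchIndex n q m → ℝ) : Matrix (Fin n) (Fin r) ℝ :=
  gradU (batchA z) (batchY X z) U b - (m : ℝ) • ((U * colMat b - X) * (colMat b)ᵀ)

/-- This puts the deviation in the form required by `IsGaussianFamily.bernstein`. The factors of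
each row are the tested row of `A_k`, scaled by `b_k ⬝ᵥ y`, and the misfit at that measurement; the
noise enters the latter with coefficient `-1`. -/
lemma dotProduct_gradDev (X : Matrix (Fin n) (Fin q) ℝ) (U : Matrix (Fin n) (Fin r) ℝ)
    (b : Fin q → Fin r → ℝ) (ω : Ω) (x : Fin n → ℝ) (y : Fin r → ℝ) :
    x ⬝ᵥ gradDev X U b (fun e => Z e ω) *ᵥ y = ∑ j : Fin q × Fin m,
      (linForm Z (rowCoef j ((b j.1 ⬝ᵥ y) • x) 0) ω *
        linForm Z (rowCoef j (U *ᵥ b j.1 - fun i => X i j.1) (-1)) ω -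
        (b j.1 ⬝ᵥ y) * (x ⬝ᵥ (U *ᵥ b j.1 - fun i => X i j.1))) := by
  rw [gradDev, Matrix.sub_mulVec, dotProduct_sub, Finset.sum_sub_distrib]
  congr 1
  · rw [gradU, Matrix.sum_mulVec, dotProduct_sum, Fintype.sum_prod_type]
    refine Finset.sum_congr rfl fun k _ => ?_
    simp only [linForm_rowCoef, zero_mul, add_zero, Matrix.mulVec_smul, Pi.smul_apply, smul_eq_mul]
    have hmul : ∀ (a : ℝ) (v w : Fin m → ℝ), a * (v ⬝ᵥ w) = ∑ i, a * (v i * w i) :=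
      fun a v w => Finset.mul_sum _ _ _
    rw [Matrix.vecMulVec_mulVec, op_smul_eq_smul, dotProduct_smul, smul_eq_mul,
      dotProduct_mulVec_transpose, Matrix.transpose_transpose, hmul]
    refine Finset.sum_congr rfl fun i _ => ?_
    simp only [batchY, Matrix.mulVec_sub, Pi.sub_apply, Pi.add_apply]
    ring
  · rw [Fintype.sum_prod_type, Matrix.smul_mulVec, dotProduct_smul, ← Matrix.mulVec_mulVec,
      dotProduct_mulVec_transpose, dotProduct_comm]
    simp only [Finset.sum_const, Finset.card_univ, Fintype.card_fin, nsmul_eq_mul, ← Finset.mul_sum,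
      smul_eq_mul]
    congr 1
    rw [dotProduct_comm]
    refine Finset.sum_congr rfl fun k _ => ?_
    congr 1
    rw [dotProduct_comm]
    rfl

/-- Bernstein is applied at each of the at most `5 ^ n * 5 ^ r` pairs of net points. A single
product has scale `β s`; the total variance proxy is `m s² s₂²`, because `∑ (b_k ⬝ᵥ y)² = ‖Bᵀ y‖²`
is bounded by `s₂²` and not merely by `q β²`. -/
lemma measure_gradDev_le (h : IsGaussianFamily P (batchVar n q m σv) Z)
    (X : Matrix (Fin n) (Fin q) ℝ) (U : Matrix (Fin n) (Fin r) ℝ) (b : Fin q → Fin r → ℝ)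
    {β s s₂ u τ : ℝ} (hβ0 : 0 ≤ β) (hs0 : 0 ≤ s) (hβ : ∀ k, vnorm (b k) ≤ β)
    (hs : ∀ k, vnorm (U *ᵥ b k - fun i => X i k) ^ 2 + (σv : ℝ) ^ 2 ≤ s ^ 2)
    (hB : ‖colMat b‖ ≤ s₂) (hu : 0 ≤ u) (hτ : 0 < τ) (h1 : 16 * u * (β * s) ≤ τ)
    (h2 : 64 * u * (m * s ^ 2 * s₂ ^ 2) ≤ τ ^ 2) :
    P {ω | ¬ ‖gradDev X U b (fun e => Z e ω)‖ ≤ 4 * τ} ≤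
      5 ^ n * 5 ^ r * ENNReal.ofReal (Real.exp (-u)) := by
  obtain ⟨N₁, hN₁⟩ := exists_isHalfNet n
  obtain ⟨N₂, hN₂⟩ := exists_isHalfNet r
  have hcard : ((N₁ ×ˢ N₂).card : ℝ≥0∞) ≤ 5 ^ n * 5 ^ r := by
    rw [Finset.card_product, Nat.cast_mul]
    exact mul_le_mul' (by exact_mod_cast hN₁.card_le) (by exact_mod_cast hN₂.card_le)
  have hpt : ∀ x ∈ N₁ ×ˢ N₂, P {ω | τ ≤ x.1 ⬝ᵥ gradDev X U b (fun e => Z e ω) *ᵥ x.2} ≤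
      ENNReal.ofReal (Real.exp (-u)) := by
    rintro ⟨x, y⟩ hxy
    rw [Finset.mem_product] at hxy
    have hx := hN₁.unit x hxy.1
    have hy := hN₂.unit y hxy.2
    have hxx : x ⬝ᵥ x = 1 := by rw [← vnorm_sq, hx]; norm_num
    set c : Fin q × Fin m → BatchIndex n q m → ℝ := fun j => rowCoef j ((b j.1 ⬝ᵥ y) • x) 0 with hc
    set d : Fin q × Fin m → BatchIndex n q m → ℝ :=
      fun j => rowCoef j (U *ᵥ b j.1 - fun i => X i j.1) (-1) with hd
    have hcc : ∀ j, covForm (batchVar n q m σv) (c j) (c j) = (b j.1 ⬝ᵥ y) ^ 2 := by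
      intro j
      rw [hc, covForm_rowCoef, if_pos rfl, smul_dotProduct, dotProduct_smul, hxx]
      simp [sq]
    have hdd : ∀ j, covForm (batchVar n q m σv) (d j) (d j) ≤ s ^ 2 := by
      intro j
      rw [hd, covForm_rowCoef, if_pos rfl, ← vnorm_sq]
      have := hs j.1
      linarith
    have hdd0 : ∀ j, 0 ≤ covForm (batchVar n q m σv) (d j) (d j) := fun j => covForm_self_nonneg _
    have hby : ∀ k, (b k ⬝ᵥ y) ^ 2 ≤ β ^ 2 := by
      intro k
      rw [← sq_abs]
      refine pow_le_pow_left₀ (abs_nonneg _) ((abs_dotProduct_le_vnorm _ _).trans ?_) 2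
      rw [hy, mul_one]; exact hβ k
    have hsum : ∑ k, (b k ⬝ᵥ y) ^ 2 ≤ s₂ ^ 2 := by
      have h4 : ∑ k, (b k ⬝ᵥ y) ^ 2 = vnorm ((colMat b)ᵀ *ᵥ y) ^ 2 := by
        rw [vnorm_sq_eq_sum]; exact Finset.sum_congr rfl fun k _ => sq _
      rw [h4]
      refine pow_le_pow_left₀ (vnorm_nonneg _) ((vnorm_mulVec_le _ _).trans ?_) 2
      rw [l2norm_transpose, hy, mul_one]; exact hB
    refine le_trans (measure_mono fun ω hω => ?_) (h.bernstein c d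
      (fun j j' hj => by rw [hc, covForm_rowCoef, if_neg hj])
      (fun j j' hj => by rw [hc, hd, covForm_rowCoef, if_neg hj])
      (fun j j' hj => by rw [hd, covForm_rowCoef, if_neg hj]) hu hτ
      (M := β * s) (V := m * s ^ 2 * s₂ ^ 2) (by positivity) (fun j => ?_) ?_ h1 h2)
    · refine le_of_le_of_eq (show τ ≤ _ from hω) ?_
      rw [dotProduct_gradDev]
      refine Finset.sum_congr rfl fun j _ => ?_
      rw [hc, hd, covForm_rowCoef, if_pos rfl, smul_dotProduct]
      simp
    · rw [hcc, mul_pow]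
      exact mul_le_mul (hby _) (hdd j) (hdd0 j) (sq_nonneg _)
    · calc _ ≤ ∑ j : Fin q × Fin m, (b j.1 ⬝ᵥ y) ^ 2 * s ^ 2 :=
            Finset.sum_le_sum fun j _ => by
              rw [hcc]; exact mul_le_mul_of_nonneg_left (hdd j) (sq_nonneg _)
        _ = m * s ^ 2 * ∑ k, (b k ⬝ᵥ y) ^ 2 := by
            rw [Fintype.sum_prod_type, Finset.mul_sum]
            simp only [Finset.sum_const, Finset.card_univ, Fintype.card_fin, nsmul_eq_mul]
            exact Finset.sum_congr rfl fun k _ => by ring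
        _ ≤ _ := by gcongr
  refine (measure_mono fun ω hω => ?_).trans ((measure_exists_le _ hpt).trans
    (mul_le_mul_left hcard _))
  by_contra hcon
  simp only [Set.mem_ofPred_eq, not_exists, not_and, not_le] at hcon
  exact hω (l2norm_le_of_net hN₁ hN₂ hτ.le fun x hx y hy =>
    (hcon (x, y) (Finset.mk_mem_product hx hy)).le)

end Gradient

/-! ### One iteration from a fixed iterate. -/

section Step

variable {n q m r : ℕ} {Ω : Type*} [MeasurableSpace Ω] {P : Measure Ω} {σv : ℝ≥0}

/-- Write `x_k = U Uᵀ x_k + p_k`. Under the Gram condition the pseudoinverse is a left inverse of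
`A_k U`, so the first summand is recovered exactly. -/
lemma updateB_eq {U : Matrix (Fin n) (Fin r) ℝ} {X : Matrix (Fin n) (Fin q) ℝ}
    {N : Finset (Fin r → ℝ)} (hN : IsHalfNet N) (hm : 0 < m) {z : BatchIndex n q m → ℝ}
    (hG : GoodGram N fun k => batchA z k * U) (k : Fin q) :
    updateB (batchA z) (batchY X z) U k = Uᵀ *ᵥ (fun i => X i k) +
      pinv (batchA z k * U) *ᵥ residual z (fun k => (1 - U * Uᵀ) *ᵥ fun i => X i k) k := by
  have hm' : (0 : ℝ) < m := by exact_mod_cast hm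
  have h1 := pinv_mul_self (a := m / 2) (by positivity) (gram_lower_bound hN (hG k))
  have h2 : batchY X z k = (batchA z k * U) *ᵥ (Uᵀ *ᵥ fun i => X i k) +
      residual z (fun k => (1 - U * Uᵀ) *ᵥ fun i => X i k) k := by
    rw [batchY, residual, ← add_assoc]
    congr 1
    rw [← Matrix.mulVec_mulVec, ← Matrix.mulVec_add, Matrix.mulVec_mulVec, ← Matrix.add_mulVec]
    simp
  rw [updateB, h2, Matrix.mulVec_add, Matrix.mulVec_mulVec, h1, Matrix.one_mulVec]

/-- The squared Frobenius norm, read by rows: there are `r` of them, each of norm at most the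
operator norm. -/
lemma sum_vnorm_col_sq_le {Bs : Matrix (Fin r) (Fin q) ℝ} {s₂ : ℝ} (h : ‖Bs‖ ≤ s₂) :
    ∑ k, vnorm (fun j => Bs j k) ^ 2 ≤ r * s₂ ^ 2 := by
  have h1 : ∑ k, vnorm (fun j => Bs j k) ^ 2 = ∑ j, vnorm (Bsᵀ *ᵥ Pi.single j 1) ^ 2 := by
    simp only [vnorm_sq_eq_sum]
    rw [Finset.sum_comm]
    simp
  rw [h1]
  calc _ ≤ ∑ _ : Fin r, s₂ ^ 2 := by
        refine Finset.sum_le_sum fun j _ => pow_le_pow_left₀ (vnorm_nonneg _) ?_ 2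
        have h2 := vnorm_mulVec_le Bsᵀ (Pi.single j 1)
        have h3 : vnorm (Pi.single j (1 : ℝ) : Fin r → ℝ) = 1 := by
          rw [← sq_eq_sq₀ (vnorm_nonneg _) zero_le_one, vnorm_sq]; simp
        rw [l2norm_transpose, h3, mul_one] at h2
        exact h2.trans h
    _ = _ := by simp

set_option maxHeartbeats 1000000 in
/-- One iteration of AltGDmin from a fixed iterate. -/
lemma measure_step_le [IsProbabilityMeasure P] {Z₁ Z₂ : BatchIndex n q m → Ω → ℝ}
    (h₁ : IsGaussianFamily P (batchVar n q m σv) Z₁)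
    (h₂ : IsGaussianFamily P (batchVar n q m σv) Z₂)
    (hind : IndepFun (fun ω e => Z₁ e ω) (fun ω e => Z₂ e ω) P)
    {qr : Matrix (Fin n) (Fin r) ℝ → Matrix (Fin n) (Fin r) ℝ} (hqr : ∀ M, IsQRFactor M (qr M))
    {U Us : Matrix (Fin n) (Fin r) ℝ} {Bs : Matrix (Fin r) (Fin q) ℝ}
    {s₁ s₂ β δ η ξ s S u₁ u₂ τ₁ τ₂ : ℝ} (hU : Uᵀ * U = 1) (hUs : Usᵀ * Us = 1) (hs₁ : 0 < s₁)
    (hs₂ : s₁ ≤ s₂) (hlow : ∀ y, s₁ * vnorm y ≤ vnorm (Bsᵀ *ᵥ y)) (hhigh : ‖Bs‖ ≤ s₂)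
    (hcol : ∀ k, vnorm (fun j => Bs j k) ≤ β) (hβ : 0 < β) (hδ0 : 0 < δ)
    (hδ : sd2 Us U ≤ δ) (hδs : δ * s₂ ^ 2 ≤ 0.01 * s₁ ^ 2) (hη : 0 < η) (hηs : η * s₂ ^ 2 ≤ 0.5)
    (hξ : ξ ≤ 1) (hξ0 : 0 ≤ ξ) (hm : 0 < m) (hs : s = δ * β + σv) (hu₁ : 0 ≤ u₁) (hu₂ : 0 ≤ u₂)
    (hu₁m : 4096 * u₁ ≤ m) (hu₁β : 16 * u₁ * s ^ 2 ≤ m * β ^ 2)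
    (hu₂a : 64 * u₂ * s ^ 2 * s₂ ^ 2 ≤ m * (0.01 * s₁ ^ 2) ^ 2)
    (hS : S = 2 / m * (r * δ ^ 2 * s₂ ^ 2 + q * (σv : ℝ) ^ 2)) (hτ₁ : 0 < τ₁)
    (h₁τ₁ : 16 * u₂ * (2 * s ^ 2 / m) ≤ τ₁) (h₂τ₁ : 64 * u₂ * (2 * s ^ 2 / m * S) ≤ τ₁ ^ 2)
    (hτ₁S : 4 * (τ₁ + S) ≤ 0.01 * s₁ ^ 2) (hτ₂ : τ₂ = m * (0.01 * s₁ ^ 2 * (δ + ξ)) / 4)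
    (h₁τ₂ : 16 * u₂ * (2 * β * (2 * s)) ≤ τ₂)
    (h₂τ₂ : 64 * u₂ * (m * (2 * s) ^ 2 * (1.1 * s₂) ^ 2) ≤ τ₂ ^ 2) :
    P {ω | ¬ sd2 Us (stepMap qr η (Us * Bs) U (fun e => Z₁ e ω) (fun e => Z₂ e ω)) ≤
      (1 - 0.5 * η * s₁ ^ 2) * δ + 0.02 * (η * s₁ ^ 2) * ξ} ≤
    q * (25 ^ r * ENNReal.ofReal (Real.exp (-u₁))) + q * (5 ^ r * ENNReal.ofReal (Real.exp (-u₁)))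
      + 25 ^ r * ENNReal.ofReal (Real.exp (-u₂)) + 5 ^ r * ENNReal.ofReal (Real.exp (-u₂)) +
      5 ^ n * 5 ^ r * ENNReal.ofReal (Real.exp (-u₂)) := by
  obtain ⟨N, hN⟩ := exists_isHalfNet r
  have hm' : (0 : ℝ) < m := by exact_mod_cast hm
  have hσ0 : (0 : ℝ) ≤ σv := σv.2
  have hs₂0 : 0 < s₂ := hs₁.trans_le hs₂
  have hs0 : 0 < s := by rw [hs]; positivity
  have hδ1 : δ ≤ 0.01 := by
    have : δ * s₁ ^ 2 ≤ 0.01 * s₁ ^ 2 :=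
      (mul_le_mul_of_nonneg_left (pow_le_pow_left₀ hs₁.le hs₂ 2) hδ0.le).trans hδs
    exact le_of_mul_le_mul_right this (by positivity)
  set X := Us * Bs with hX
  set p : Fin q → Fin n → ℝ := fun k => (1 - U * Uᵀ) *ᵥ fun i => X i k with hp
  set G := Uᵀ * X with hG
  have hXcol : ∀ k, (fun i => X i k) = Us *ᵥ fun j => Bs j k := fun k => rfl
  have hpn : ∀ k, vnorm (p k) ≤ δ * vnorm (fun j => Bs j k) := by
    intro k
    rw [hp]
    simp only [hXcol, Matrix.mulVec_mulVec]
    refine (vnorm_mulVec_le _ _).trans (mul_le_mul_of_nonneg_right ?_ (vnorm_nonneg _))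
    exact l2norm_proj_symm hU hUs (by linarith) hδ
  have hpβ : ∀ k, vnorm (p k) ≤ δ * β := fun k =>
    (hpn k).trans (mul_le_mul_of_nonneg_left (hcol k) hδ0.le)
  have hpU : ∀ k, Uᵀ *ᵥ p k = 0 := by
    intro k
    rw [hp]
    simp only [Matrix.mulVec_mulVec]
    rw [Matrix.mul_sub, Matrix.mul_one, ← Matrix.mul_assoc, hU, Matrix.one_mul, sub_self,
      Matrix.zero_mulVec]
  have hps : ∀ k, p k ⬝ᵥ p k + (σv : ℝ) ^ 2 ≤ s ^ 2 := by
    intro k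
    rw [← vnorm_sq, hs]
    have h3 := hpβ k
    have h4 := vnorm_nonneg (p k)
    have h5 : 0 ≤ δ * β := by positivity
    nlinarith [mul_nonneg h5 hσ0]
  have hpS : ∑ k, (2 / m) * (p k ⬝ᵥ p k + (σv : ℝ) ^ 2) ≤ S := by
    rw [← Finset.mul_sum, hS, Finset.sum_add_distrib]
    refine mul_le_mul_of_nonneg_left (add_le_add ?_ (by simp)) (by positivity)
    calc ∑ k, p k ⬝ᵥ p k ≤ ∑ k, δ ^ 2 * vnorm (fun j => Bs j k) ^ 2 := by
          refine Finset.sum_le_sum fun k _ => ?_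
          rw [← vnorm_sq, ← mul_pow]
          exact pow_le_pow_left₀ (vnorm_nonneg _) (hpn k) 2
      _ ≤ δ ^ 2 * (r * s₂ ^ 2) := by
          rw [← Finset.mul_sum]; gcongr; exact sum_vnorm_col_sq_le hhigh
      _ = _ := by ring
  have hUn := l2norm_le_one_of_orthonormal hU
  have hUsn := l2norm_le_one_of_orthonormal hUs
  have hGn : ‖G‖ ≤ s₂ := by
    calc ‖G‖ ≤ ‖Uᵀ‖ * (‖Us‖ * ‖Bs‖) := (Matrix.l2_opNorm_mul _ _).trans
          (mul_le_mul_of_nonneg_left (Matrix.l2_opNorm_mul _ _) (norm_nonneg _))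
      _ ≤ 1 * (1 * s₂) := by rw [l2norm_transpose]; gcongr
      _ = s₂ := by ring
  -- The column error bound is used twice: `β` keeps `‖b_k‖ ≤ 2 β`, and `s` keeps the misfit and
  -- noise within `(2 s)²`.
  set ρ := min s β with hρdef
  have hρ : 0 < ρ := lt_min hs0 hβ
  have hρu : 16 * u₁ * s ^ 2 ≤ m * ρ ^ 2 := by
    rcases min_choice s β with h | h <;> rw [hρdef, h]
    · exact mul_le_mul_of_nonneg_right (by linarith) (sq_nonneg _)
    · exact hu₁β
  have t1 := measure_errMat_le h₁ hU hpU hN hm hps hpS hGn hu₁ hu₂ hu₁m hρ hρu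
    (a := 0.01 * s₁ ^ 2) (by positivity) hu₂a hτ₁ h₁τ₁ h₂τ₁
  set b : (BatchIndex n q m → ℝ) → Fin q → Fin r → ℝ :=
    fun z => updateB (batchA z) (batchY X z) U with hb
  have hbm : ∀ k, Measurable fun z : BatchIndex n q m → ℝ => b z k := fun k =>
    measurable_updateB X measurable_id measurable_const k
  -- The outcomes of the first batch for which the gradient concentrates. `C` is measurable and
  -- depends on that batch alone, so the independent second batch can be analysed with the first one
  -- frozen in `C`.
  set C : Set (BatchIndex n q m → ℝ) := {z | (∀ k, vnorm (b z k) ≤ 2 * β) ∧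
    (∀ k, vnorm (U *ᵥ b z k - fun i => X i k) ^ 2 + (σv : ℝ) ^ 2 ≤ (2 * s) ^ 2) ∧
    ‖colMat (b z)‖ ≤ 1.1 * s₂} with hC
  have hCm : MeasurableSet C := by
    have e : C = (⋂ k, {z | vnorm (b z k) ≤ 2 * β}) ∩
        ((⋂ k, {z | vnorm (U *ᵥ b z k - fun i => X i k) ^ 2 + (σv : ℝ) ^ 2 ≤ (2 * s) ^ 2}) ∩
        {z | ‖colMat (b z)‖ ≤ 1.1 * s₂}) := by
      ext z; simp [hC]
    rw [e]
    refine (MeasurableSet.iInter fun k =>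
      measurableSet_le (measurable_vnorm (hbm k)) measurable_const).inter
      ((MeasurableSet.iInter fun k => measurableSet_le ?_ measurable_const).inter
      (measurableSet_le (measurable_l2norm ?_) measurable_const))
    · exact ((measurable_vnorm ((measurable_mulVec measurable_const (hbm k)).sub
        measurable_const)).pow_const 2).add_const _
    · exact measurable_matrix_iff.2 fun j k => measurable_pi_iff.1 (hbm k) j
  have hτ₂0 : 0 < τ₂ := by rw [hτ₂]; positivity
  have t2 : P {ω | (fun e => Z₁ e ω) ∈ C ∧
      ¬ ‖gradDev X U (b fun e => Z₁ e ω) (fun e => Z₂ e ω)‖ ≤ 4 * τ₂} ≤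
      5 ^ n * 5 ^ r * ENNReal.ofReal (Real.exp (-u₂)) := by
    set T : Set ((BatchIndex n q m → ℝ) × (BatchIndex n q m → ℝ)) :=
      {a | a.1 ∈ C ∧ ¬ ‖gradDev X U (b a.1) a.2‖ ≤ 4 * τ₂} with hT
    have hTm : MeasurableSet T := by
      have e : T = Prod.fst ⁻¹' C ∩ {a | ‖gradDev X U (b a.1) a.2‖ ≤ 4 * τ₂}ᶜ := by
        ext; rfl
      rw [e]
      refine (measurable_fst hCm).inter (measurableSet_le (measurable_l2norm ?_)
        measurable_const).compl
      have hbm' : ∀ k, Measurable fun a : (BatchIndex n q m → ℝ) × (BatchIndex n q m → ℝ) =>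
          b a.1 k := fun k => (hbm k).comp measurable_fst
      have h3 := measurable_matrix_iff.1
        (measurable_gradU X measurable_snd (measurable_const (a := U)) hbm')
      have h4 : Measurable fun a : (BatchIndex n q m → ℝ) × (BatchIndex n q m → ℝ) =>
          colMat (b a.1) := measurable_matrix_iff.2 fun j k => measurable_pi_iff.1 (hbm' k) j
      have h5 := measurable_matrix_iff.1 (measurable_matrix_mul (measurable_const (a := U)) h4)
      have h6 := measurable_matrix_iff.1 (measurable_matrix_mul
        (measurable_matrix_iff.2 fun i k => (h5 i k).sub_const (X i k))
        (measurable_matrix_transpose h4))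
      exact measurable_matrix_iff.2 fun i j => (h3 i j).sub ((h6 i j).const_mul _)
    exact measure_le_of_indepFun (measurable_pi_iff.2 h₁.meas) (measurable_pi_iff.2 h₂.meas) hind
      hTm (Q := fun _ => True) (Filter.Eventually.of_forall fun _ => trivial) fun z _ => by
        by_cases hz : z ∈ C
        · refine (measure_mono fun ω hω => hω.2).trans (measure_gradDev_le h₂ X U (b z)
            (β := 2 * β) (s := 2 * s) (s₂ := 1.1 * s₂) (by positivity) (by positivity) hz.1 hz.2.1
            hz.2.2 hu₂ hτ₂0 h₁τ₂ h₂τ₂)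
        · have : {ω | (z, fun e => Z₂ e ω) ∈ T} = ∅ :=
            Set.eq_empty_of_forall_notMem fun ω hω => hz hω.1
          rw [this]; simp
  refine (measure_mono fun ω hω => ?_).trans ((measure_union_le _ _).trans (add_le_add t1 t2))
  by_contra hcon
  simp only [Set.mem_union, Set.mem_ofPred_eq, not_or, not_not, not_and_not_right] at hcon
  obtain ⟨⟨hgood, hρb, hGE, hE⟩, hC2⟩ := hcon
  refine hω ?_
  set z := fun e => Z₁ e ω with hz
  set E := errMat U p z with hEdef
  have hbe : ∀ k, b z k = Uᵀ *ᵥ (fun i => X i k) + pinv (batchA z k * U) *ᵥ residual z p k :=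
    updateB_eq hN hm hgood
  have hBE : colMat (b z) - G = E := by
    ext j k
    have : colMat (b z) j k = b z k j := rfl
    rw [Matrix.sub_apply, this, hbe, Pi.add_apply]
    exact add_sub_cancel_left _ _
  have hE' : ‖E‖ ^ 2 ≤ 0.01 * s₁ ^ 2 := hE.trans hτ₁S
  have hEn : ‖E‖ ≤ 0.1 * s₂ := by
    have : ‖E‖ ≤ 0.1 * s₁ :=
      abs_le_of_sq_le_sq' (hE'.trans_eq (by ring)) (by positivity) |>.2
    exact this.trans (by gcongr)
  have hzC : z ∈ C := by
    refine ⟨fun k => ?_, fun k => ?_, ?_⟩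
    · rw [hbe]
      have h3 : vnorm (Uᵀ *ᵥ fun i => X i k) ≤ β := by
        refine (vnorm_mulVec_le _ _).trans ?_
        rw [l2norm_transpose, hXcol, vnorm_mulVec_orthonormal hUs]
        have := mul_le_mul hUn (hcol k) (vnorm_nonneg _) zero_le_one
        linarith
      have h4 := (hρb k).trans (min_le_right s β)
      linarith [vnorm_add_le (Uᵀ *ᵥ fun i => X i k) (pinv (batchA z k * U) *ᵥ residual z p k)]
    · have h3 : U *ᵥ b z k - (fun i => X i k) =
          U *ᵥ (pinv (batchA z k * U) *ᵥ residual z p k) - p k := by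
        have hpk : p k = (fun i => X i k) - U *ᵥ (Uᵀ *ᵥ fun i => X i k) := by
          change (1 - U * Uᵀ) *ᵥ (fun i => X i k) = _
          rw [Matrix.sub_mulVec, Matrix.one_mulVec, Matrix.mulVec_mulVec]
        rw [hbe, hpk, Matrix.mulVec_add]
        abel
      have h4 := (hρb k).trans (min_le_left s β)
      have h5 := vnorm_sub_le (U *ᵥ (pinv (batchA z k * U) *ᵥ residual z p k)) (p k)
      rw [vnorm_mulVec_orthonormal hU, ← h3] at h5
      have h6 := hpβ k
      -- The error contributes at most `s` and `p_k` at most `δ β = s - σv`. Since `σv ≤ s`, it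
      -- follows that `(2 s - σv)² + σv² ≤ 4 s²`.
      have h7 : vnorm (U *ᵥ b z k - fun i => X i k) ≤ 2 * s - σv := by linarith
      have h8 := pow_le_pow_left₀ (vnorm_nonneg _) h7 2
      have h9 : (σv : ℝ) ≤ s := by rw [hs]; linarith [mul_pos hδ0 hβ]
      have h10 := mul_le_mul_of_nonneg_right h9 hσ0
      linarith [sq_nonneg (σv : ℝ)]
    · have h3 : colMat (b z) = G + E := by rw [← hBE]; abel
      rw [h3]
      linarith [norm_add_le G E]
  have hgrad := hC2 hzC
  set D := (1 / m : ℝ) • gradDev X U (b z) (fun e => Z₂ e ω) with hD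
  have hDn : ‖D‖ ≤ 0.01 * s₁ ^ 2 * (δ + ξ) := by
    rw [hD, norm_smul, Real.norm_of_nonneg (by positivity), one_div, inv_mul_le_iff₀ hm']
    rw [hτ₂] at hgrad
    linarith
  refine sd2_step_le (B := colMat (b z)) (D := D) hU hUs hs₁ hs₂ hlow hhigh hδ hδs hη hηs hξ hξ0
    ?_ ?_ hDn ?_
  · rw [← hX, ← hG, hBE]; exact hGE
  · rw [← hX, ← hG, hBE]; exact hE'
  · have h3 : U - η • ((U * colMat (b z) - Us * Bs) * (colMat (b z))ᵀ + D) =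
        U - (η / m) • gradU (batchA fun e => Z₂ e ω) (batchY X fun e => Z₂ e ω) U (b z) := by
      congr 1
      rw [hD, gradDev, ← hX, smul_sub, smul_smul, one_div, inv_mul_cancel₀ hm'.ne', one_smul,
        add_sub_cancel, smul_smul, div_eq_mul_inv]
    rw [h3]
    exact hqr _

end Step

/-! ### Failure probabilities and numerical conditions of a step. -/

section Numerics

/-- Total failure probability of one iteration. -/
lemma failure_probability_le {n q r : ℕ} (hn : 2 ≤ n) (hrn : r ≤ n) (hq : 0 < q) :
    (q : ℝ≥0∞) * (25 ^ r * ENNReal.ofReal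
        (Real.exp (-(20 * (r + Real.log q + Real.log n))))) +
      q * (5 ^ r * ENNReal.ofReal (Real.exp (-(20 * (r + Real.log q + Real.log n))))) +
      25 ^ r * ENNReal.ofReal (Real.exp (-(20 * n))) +
      5 ^ r * ENNReal.ofReal (Real.exp (-(20 * n))) +
      5 ^ n * 5 ^ r * ENNReal.ofReal (Real.exp (-(20 * n))) ≤
    ENNReal.ofReal ((n : ℝ) ^ (-10 : ℤ) / 2) := by
  have hn' : (2 : ℝ) ≤ n := by exact_mod_cast hn
  have hn0 : (0 : ℝ) < n := by linarith
  have hq' : (1 : ℝ) ≤ q := by exact_mod_cast hq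
  have hrn' : (r : ℝ) ≤ n := by exact_mod_cast hrn
  have hlq : 0 ≤ Real.log q := Real.log_nonneg hq'
  have hln : 0 ≤ Real.log n := Real.log_nonneg (by linarith)
  have hlnn : Real.log n ≤ n := (Real.log_le_sub_one_of_pos hn0).trans (by linarith)
  have hr0 : (0 : ℝ) ≤ r := Nat.cast_nonneg r
  have he : (25 : ℝ) ≤ Real.exp 4 := by
    have := Real.exp_one_gt_d9
    rw [show (4 : ℝ) = (4 : ℕ) * 1 by norm_num, Real.exp_nat_mul]
    calc (25 : ℝ) ≤ 2.7 ^ 4 := by norm_num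
      _ ≤ _ := pow_le_pow_left₀ (by norm_num) (by linarith) 4
  have h25 : ∀ k : ℕ, (25 : ℝ) ^ k ≤ Real.exp (4 * k) := by
    intro k
    rw [mul_comm, Real.exp_nat_mul]
    exact pow_le_pow_left₀ (by norm_num) he k
  have h5 : ∀ k : ℕ, (5 : ℝ) ^ k ≤ 25 ^ k := fun k => pow_le_pow_left₀ (by norm_num) (by norm_num) k
  -- Each of the five terms is at most `w = n⁻¹⁶`, and `5 w ≤ n⁻¹⁰ / 2` because `10 ≤ 2⁶ ≤ n⁶`. The
  -- net cardinalities are absorbed through `25 ≤ e⁴`.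
  set w := Real.exp (-(16 * Real.log n)) with hw
  have hw' : w * 10 ≤ (n : ℝ) ^ (-10 : ℤ) := by
    have h1 : w = ((n : ℝ) ^ 16)⁻¹ := by
      rw [hw, Real.exp_neg, show (16 : ℝ) = (16 : ℕ) by norm_num, Real.exp_nat_mul,
        Real.exp_log hn0]
    have h2 : (n : ℝ) ^ (-10 : ℤ) = ((n : ℝ) ^ 10)⁻¹ := by
      rw [zpow_neg]; norm_cast
    rw [h1, h2, inv_mul_eq_div, div_le_iff₀ (by positivity)]
    have h3 : (n : ℝ) ^ 16 = n ^ 10 * n ^ 6 := by ring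
    rw [h3, inv_mul_cancel_left₀ (by positivity)]
    calc (10 : ℝ) ≤ 2 ^ 6 := by norm_num
      _ ≤ _ := pow_le_pow_left₀ (by norm_num) hn' 6
  have e1 : (q : ℝ) * (25 ^ r * Real.exp (-(20 * (r + Real.log q + Real.log n)))) ≤ w := by
    calc _ ≤ Real.exp (Real.log q) * (Real.exp (4 * r) *
          Real.exp (-(20 * (r + Real.log q + Real.log n)))) := by
          rw [Real.exp_log (by linarith)]
          gcongr
          exact h25 r
      _ ≤ w := by
          rw [← Real.exp_add, ← Real.exp_add, hw]
          exact Real.exp_le_exp.2 (by linarith)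
  have e2 : (q : ℝ) * (5 ^ r * Real.exp (-(20 * (r + Real.log q + Real.log n)))) ≤ w :=
    le_trans (by gcongr; norm_num) e1
  have e3 : (25 : ℝ) ^ n * Real.exp (-(20 * n)) ≤ w := by
    calc _ ≤ Real.exp (4 * n) * Real.exp (-(20 * n)) := by gcongr; exact h25 n
      _ ≤ w := by
          rw [← Real.exp_add, hw]
          exact Real.exp_le_exp.2 (by linarith)
  have e4 : (25 : ℝ) ^ r * Real.exp (-(20 * n)) ≤ w :=
    le_trans (by gcongr; norm_num) e3
  have e5 : (5 : ℝ) ^ r * Real.exp (-(20 * n)) ≤ w :=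
    le_trans (by gcongr; norm_num) e4
  have e6 : (5 : ℝ) ^ n * 5 ^ r * Real.exp (-(20 * n)) ≤ w := by
    refine le_trans ?_ e3
    gcongr
    calc (5 : ℝ) ^ n * 5 ^ r ≤ 5 ^ n * 5 ^ n := by gcongr; norm_num
      _ = 25 ^ n := by rw [← mul_pow]; norm_num
  have c1 : ∀ (a : ℝ) (k : ℕ) (x : ℝ), 0 ≤ a →
      (ENNReal.ofReal a) ^ k * ENNReal.ofReal x = ENNReal.ofReal (a ^ k * x) := fun a k x ha => by
    rw [ENNReal.ofReal_mul (by positivity), ENNReal.ofReal_pow ha]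
  have h25e : (25 : ℝ≥0∞) = ENNReal.ofReal 25 := by simp
  have h5e : (5 : ℝ≥0∞) = ENNReal.ofReal 5 := by simp
  have hqe : (q : ℝ≥0∞) = ENNReal.ofReal q := by simp
  rw [mul_assoc (5 ^ n : ℝ≥0∞), h25e, h5e, hqe, c1 25 _ _ (by norm_num), c1 5 _ _ (by norm_num),
    c1 5 _ _ (by norm_num), c1 5 _ _ (by norm_num), c1 25 _ _ (by norm_num),
    ← ENNReal.ofReal_mul (by positivity), ← ENNReal.ofReal_mul (by positivity),
    ← ENNReal.ofReal_add (by positivity) (by positivity),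
    ← ENNReal.ofReal_add (by positivity) (by positivity),
    ← ENNReal.ofReal_add (by positivity) (by positivity),
    ← ENNReal.ofReal_add (by positivity) (by positivity)]
  refine ENNReal.ofReal_le_ofReal ?_
  rw [mul_assoc] at e6
  linarith

variable {n q r m L M β σ s₁ s₂ δ ξ s S : ℝ}

/-- The variance proxy of the gradient deviation. -/
lemma proxy_le (hn : 0 ≤ n) (hδ : 0 ≤ δ) (hξ : 0 ≤ ξ) (hm : 0 ≤ m)
    (f3 : 10 ^ 10 * (n * β ^ 2 * s₂ ^ 2) ≤ m * s₁ ^ 4)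
    (f4 : 10 ^ 10 * (n * s₂ ^ 2 * σ ^ 2) ≤ m * s₁ ^ 4 * ξ ^ 2) (hs : s = δ * β + σ) :
    10 ^ 10 * (n * s ^ 2 * s₂ ^ 2) ≤ 2 * m * s₁ ^ 4 * (δ + ξ) ^ 2 := by
  have h1 : s ^ 2 ≤ 2 * (δ ^ 2 * β ^ 2) + 2 * σ ^ 2 := by
    rw [hs]; nlinarith [sq_nonneg (δ * β - σ)]
  have h2 : n * s ^ 2 * s₂ ^ 2 ≤ n * (2 * (δ ^ 2 * β ^ 2) + 2 * σ ^ 2) * s₂ ^ 2 := by gcongr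
  have h3 := mul_le_mul_of_nonneg_left f3 (sq_nonneg δ)
  have h4 : 0 ≤ m * s₁ ^ 4 * (δ * ξ) := by positivity
  -- The signal part of `s²` contributes `δ²` and the noise part `ξ²`; their sum is at most `(δ +
  -- ξ)²`, the discarded cross term being nonnegative.
  linarith

lemma contraction_numerics_sq (hm : 0 < m) (hs₁ : 0 < s₁)
    (hδξ : (δ + ξ) ^ 2 ≤ 1.1)
    (hw : 10 ^ 10 * (n * s ^ 2 * s₂ ^ 2) ≤ 2 * m * s₁ ^ 4 * (δ + ξ) ^ 2) :
    64 * (20 * n) * s ^ 2 * s₂ ^ 2 ≤ m * (0.01 * s₁ ^ 2) ^ 2 := by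
  have h1 : 2 * m * s₁ ^ 4 * (δ + ξ) ^ 2 ≤ 2 * m * s₁ ^ 4 * 1.1 := by gcongr
  have h2 : 0 ≤ m * s₁ ^ 4 := by positivity
  nlinarith

lemma contraction_numerics_errMat (hm : 0 < m)
    (hs₁ : 0 < s₁) (hs₂ : s₁ ≤ s₂) (hδ : 0 ≤ δ) (hrm : r ≤ m) (hδξ : (δ + ξ) ^ 2 ≤ 1.1)
    (hδs : δ * s₂ ^ 2 ≤ 0.01 * s₁ ^ 2) (f5 : 10 ^ 5 * (q * σ ^ 2) ≤ m * s₁ ^ 2)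
    (hw : 10 ^ 10 * (n * s ^ 2 * s₂ ^ 2) ≤ 2 * m * s₁ ^ 4 * (δ + ξ) ^ 2)
    (hS : S = 2 / m * (r * δ ^ 2 * s₂ ^ 2 + q * σ ^ 2)) :
    4 * (16 * (20 * n) * (2 * s ^ 2 / m) + S + S) ≤ 0.01 * s₁ ^ 2 := by
  have hs₂0 : 0 < s₂ := hs₁.trans_le hs₂
  have hs₁₂ : s₁ ^ 2 ≤ s₂ ^ 2 := pow_le_pow_left₀ hs₁.le hs₂ 2
  have h1 : 10 ^ 10 * (n * s ^ 2) ≤ 2.2 * m * s₁ ^ 2 := by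
    have h2 : 10 ^ 10 * (n * s ^ 2) * s₂ ^ 2 ≤ 2.2 * m * s₁ ^ 2 * s₂ ^ 2 := by
      calc _ = 10 ^ 10 * (n * s ^ 2 * s₂ ^ 2) := by ring
        _ ≤ 2 * m * s₁ ^ 4 * 1.1 := hw.trans (by gcongr)
        _ = 2.2 * m * s₁ ^ 2 * s₁ ^ 2 := by ring
        _ ≤ _ := by gcongr
    exact le_of_mul_le_mul_right h2 (by positivity)
  have h3 : δ ≤ 0.01 := by
    have : δ * s₁ ^ 2 ≤ 0.01 * s₁ ^ 2 := (mul_le_mul_of_nonneg_left hs₁₂ hδ).trans hδs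
    exact le_of_mul_le_mul_right this (by positivity)
  have h4 : r * δ ^ 2 * s₂ ^ 2 ≤ m * (0.0001 * s₁ ^ 2) := by
    calc r * δ ^ 2 * s₂ ^ 2 = r * (δ * (δ * s₂ ^ 2)) := by ring
      _ ≤ m * (0.01 * (0.01 * s₁ ^ 2)) := by gcongr
      _ = _ := by ring
  have h5 : m * S = 2 * (r * δ ^ 2 * s₂ ^ 2 + q * σ ^ 2) := by rw [hS]; field_simp
  have h6 : m * (16 * (20 * n) * (2 * s ^ 2 / m)) = 640 * (n * s ^ 2) := by field_simp; ring
  refine le_of_mul_le_mul_left (a := m) ?_ hm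
  calc m * (4 * (16 * (20 * n) * (2 * s ^ 2 / m) + S + S)) =
        4 * (m * (16 * (20 * n) * (2 * s ^ 2 / m)) + 2 * (m * S)) := by ring
    _ ≤ m * (0.01 * s₁ ^ 2) := by
      rw [h5, h6]
      have : 0 ≤ m * s₁ ^ 2 := by positivity
      nlinarith

/-- Multiplying the two hypotheses bounds the square of `n β s s₂²`. Taking the root and cancelling
`s₂² ≥ s₁²` gives the Bernstein condition on single terms. -/
lemma gradient_numerics_linear (hn : 0 ≤ n) (hm : 0 < m) (hs₁ : 0 < s₁) (hs₂ : s₁ ≤ s₂)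
    (hδ : 0 ≤ δ) (hξ : 0 ≤ ξ)
    (f3 : 10 ^ 10 * (n * β ^ 2 * s₂ ^ 2) ≤ m * s₁ ^ 4)
    (hw : 10 ^ 10 * (n * s ^ 2 * s₂ ^ 2) ≤ 2 * m * s₁ ^ 4 * (δ + ξ) ^ 2) :
    16 * (20 * n) * (2 * β * (2 * s)) ≤ m * (0.01 * s₁ ^ 2 * (δ + ξ)) / 4 := by
  have hs₂0 : 0 < s₂ := hs₁.trans_le hs₂
  have hs₁₂ : s₁ ^ 2 ≤ s₂ ^ 2 := pow_le_pow_left₀ hs₁.le hs₂ 2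
  have h1 : (10 ^ 10 * (n * β * s * s₂ ^ 2)) ^ 2 ≤ (2 * (m * s₁ ^ 4 * (δ + ξ))) ^ 2 := by
    calc _ = (10 ^ 10 * (n * β ^ 2 * s₂ ^ 2)) * (10 ^ 10 * (n * s ^ 2 * s₂ ^ 2)) := by ring
      _ ≤ (m * s₁ ^ 4) * (2 * m * s₁ ^ 4 * (δ + ξ) ^ 2) := by gcongr
      _ ≤ _ := by nlinarith [sq_nonneg (m * s₁ ^ 4 * (δ + ξ))]
  have h2 : 10 ^ 10 * (n * β * s * s₂ ^ 2) ≤ 2 * (m * s₁ ^ 4 * (δ + ξ)) :=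
    abs_le_of_sq_le_sq' h1 (by positivity) |>.2
  have h3 : 10 ^ 10 * (n * β * s) * s₂ ^ 2 ≤ 2 * (m * s₁ ^ 2 * (δ + ξ)) * s₂ ^ 2 := by
    calc _ = 10 ^ 10 * (n * β * s * s₂ ^ 2) := by ring
      _ ≤ 2 * (m * s₁ ^ 2 * (δ + ξ)) * s₁ ^ 2 := h2.trans_eq (by ring)
      _ ≤ _ := by gcongr
  have h4 := le_of_mul_le_mul_right h3 (by positivity)
  have h5 : 0 ≤ m * s₁ ^ 2 * (δ + ξ) := by positivity
  nlinarith

lemma gradient_numerics_sq (hm : 0 < m)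
    (hw : 10 ^ 10 * (n * s ^ 2 * s₂ ^ 2) ≤ 2 * m * s₁ ^ 4 * (δ + ξ) ^ 2) :
    64 * (20 * n) * (m * (2 * s) ^ 2 * (1.1 * s₂) ^ 2) ≤
      (m * (0.01 * s₁ ^ 2 * (δ + ξ)) / 4) ^ 2 := by
  have h1 := mul_le_mul_of_nonneg_left hw hm.le
  have h2 : 0 ≤ m * (m * s₁ ^ 4 * (δ + ξ) ^ 2) := by positivity
  have h3 : 64 * (20 * n) * (m * (2 * s) ^ 2 * (1.1 * s₂) ^ 2) =
      6195.2 * (m * (n * s ^ 2 * s₂ ^ 2)) := by ring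
  have h4 : (m * (0.01 * s₁ ^ 2 * (δ + ξ)) / 4) ^ 2 =
      0.00000625 * (m * (m * s₁ ^ 4 * (δ + ξ) ^ 2)) := by ring
  rw [h3, h4]
  linarith

lemma leastSquares_numerics (hL : 0 ≤ L) (hδ0 : 0 ≤ δ) (hδ : δ ≤ 0.01)
    (f1 : 10 ^ 5 * L ≤ m) (f2 : 10 ^ 5 * (L * σ ^ 2) ≤ m * β ^ 2) (hs : s = δ * β + σ) :
    16 * (20 * L) * s ^ 2 ≤ m * β ^ 2 := by
  have h1 : s ^ 2 ≤ 2 * (δ ^ 2 * β ^ 2) + 2 * σ ^ 2 := by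
    rw [hs]; nlinarith [sq_nonneg (δ * β - σ)]
  have h2 : 16 * (20 * L) * s ^ 2 ≤ 16 * (20 * L) * (2 * (δ ^ 2 * β ^ 2) + 2 * σ ^ 2) := by gcongr
  have h3 : L * (δ ^ 2 * β ^ 2) ≤ L * (1 * β ^ 2) := by gcongr; nlinarith
  have h4 := mul_le_mul_of_nonneg_right f1 (sq_nonneg β)
  have h5 : 0 ≤ L * β ^ 2 := by positivity
  have h6 : 0 ≤ L * σ ^ 2 := by positivity
  linarith

end Numerics

/-! ### Sample size and the logarithm of the dimension. -/

section SampleSize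

variable {n q r : ℕ} {m M : ℝ}

/-- The sample size assumptions also control `log n`. -/
lemma log_sample_size (hn : 2 ≤ n) (hq : 0 < q) (hM : 1 ≤ M)
    (h1 : 10 ^ 10 * (n * M) ≤ m * q) (h2 : 4 * 10 ^ 5 * (max (Real.log q) r * M) ≤ m) :
    10 ^ 5 * ((r + Real.log q + Real.log n) * M) ≤ m := by
  have hn' : (2 : ℝ) ≤ n := by exact_mod_cast hn
  have hq' : (1 : ℝ) ≤ q := by exact_mod_cast hq
  have hlq := Real.log_nonneg hq'
  have a1 : 4 * 10 ^ 5 * (r * M) ≤ m :=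
    le_trans (by gcongr; exact le_max_right _ _) h2
  have a2 : 4 * 10 ^ 5 * (Real.log q * M) ≤ m :=
    le_trans (by gcongr; exact le_max_left _ _) h2
  have hm0 : 0 ≤ m := le_trans (by positivity) a1
  have a3 : 2 * 10 ^ 5 * (Real.log n * M) ≤ m := by
    -- For `q² ≤ n`, `q log n ≤ √n * 2 √n = 2 n` and the bound on `m q` suffices. Otherwise `log n ≤
    -- 2 log q` and the bound on `m` does.
    by_cases hqn : (q : ℝ) ^ 2 ≤ n
    · have hlog : Real.log n ≤ 2 * √n := by
        have h3 := Real.log_le_sub_one_of_pos (x := √n) (Real.sqrt_pos.2 (by linarith))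
        rw [Real.log_sqrt (by linarith)] at h3
        linarith
      have hqs : (q : ℝ) ≤ √n := Real.le_sqrt_of_sq_le hqn
      have h4 : Real.log n * q ≤ 2 * n := by
        calc Real.log n * q ≤ 2 * √n * √n := by gcongr
          _ = 2 * n := by rw [mul_assoc, Real.mul_self_sqrt (by linarith)]
      have h5 : 2 * 10 ^ 5 * (Real.log n * M) * q ≤ m * q := by
        calc _ = 2 * 10 ^ 5 * (Real.log n * q * M) := by ring
          _ ≤ 2 * 10 ^ 5 * (2 * n * M) := by gcongr
          _ ≤ 10 ^ 10 * (n * M) := by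
            have : 0 ≤ n * M := by positivity
            linarith
          _ ≤ _ := h1
      exact le_of_mul_le_mul_right h5 (by linarith)
    · have h3 : Real.log n ≤ 2 * Real.log q := by
        rw [← Real.log_rpow (by linarith)]
        refine Real.log_le_log (by linarith) ?_
        norm_cast
        norm_cast at hqn
        omega
      have h4 : Real.log n * M ≤ 2 * Real.log q * M := by gcongr
      linarith
  linarith

end SampleSize

/-! ### Extreme singular values of the right factor. -/

section SVD

variable {n q r : ℕ} {X : Matrix (Fin n) (Fin q) ℝ} {U : Matrix (Fin n) (Fin r) ℝ}
  {V : Matrix (Fin q) (Fin r) ℝ} {σ : Fin r → ℝ}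

lemma sigmaMin_le (σ : Fin r → ℝ) (i : Fin r) : sigmaMin σ ≤ σ i :=
  ciInf_le (Set.finite_range σ).bddBelow i

lemma le_sigmaMax (σ : Fin r → ℝ) (i : Fin r) : σ i ≤ sigmaMax σ :=
  le_ciSup (Set.finite_range σ).bddAbove i

lemma sigmaMin_pos (hr : 0 < r) (hσ : ∀ i, 0 < σ i) : 0 < sigmaMin σ := by
  have : Nonempty (Fin r) := ⟨⟨0, hr⟩⟩
  obtain ⟨i, hi⟩ := exists_eq_ciInf_of_finite (f := σ)
  rw [sigmaMin, ← hi]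
  exact hσ i

lemma card_le_of_orthonormal (hU : Uᵀ * U = 1) : r ≤ n := by
  have h1 := Matrix.rank_mul_le_right Uᵀ U
  rw [hU, Matrix.rank_one, Fintype.card_fin] at h1
  exact h1.trans ((Matrix.rank_le_card_height U).trans_eq (Fintype.card_fin n))

lemma sigmaMin_mul_vnorm_le (hr : 0 < r) (hσ : ∀ i, 0 < σ i) (hV : Vᵀ * V = 1) (y : Fin r → ℝ) :
    sigmaMin σ * vnorm y ≤ vnorm ((Matrix.diagonal σ * Vᵀ)ᵀ *ᵥ y) := by
  rw [Matrix.transpose_mul, Matrix.transpose_transpose, Matrix.diagonal_transpose,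
    ← Matrix.mulVec_mulVec, vnorm_mulVec_orthonormal hV]
  have h0 := sigmaMin_pos hr hσ
  refine le_of_sq_le_sq ?_ (vnorm_nonneg _)
  rw [mul_pow, vnorm_sq_eq_sum, vnorm_sq_eq_sum, Finset.mul_sum]
  refine Finset.sum_le_sum fun i _ => ?_
  rw [Matrix.mulVec_diagonal, mul_mul_mul_comm, ← sq, ← sq]
  gcongr
  exact sigmaMin_le σ i

lemma l2norm_diagonal_mul_le (hr : 0 < r) (hσ : ∀ i, 0 < σ i) (hV : Vᵀ * V = 1) :
    ‖Matrix.diagonal σ * Vᵀ‖ ≤ sigmaMax σ := by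
  have h0 : 0 ≤ sigmaMax σ := (hσ ⟨0, hr⟩).le.trans (le_sigmaMax σ _)
  rw [← l2norm_transpose]
  refine l2norm_le h0 fun y => ?_
  rw [Matrix.transpose_mul, Matrix.transpose_transpose, Matrix.diagonal_transpose,
    ← Matrix.mulVec_mulVec, vnorm_mulVec_orthonormal hV]
  refine le_of_sq_le_sq ?_ (mul_nonneg h0 (vnorm_nonneg _))
  rw [mul_pow, vnorm_sq_eq_sum, vnorm_sq_eq_sum, Finset.mul_sum]
  refine Finset.sum_le_sum fun i _ => ?_
  rw [Matrix.mulVec_diagonal, mul_mul_mul_comm, ← sq, ← sq]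
  have := (hσ i).le
  gcongr
  exact le_sigmaMax σ i

end SVD

/-! ### One iteration under sample size assumptions. -/

section Step

variable {n q m r : ℕ} {Ω : Type*} [MeasurableSpace Ω] {P : Measure Ω} {σv : ℝ≥0}

/-- The sample size and step size assumptions under which one iteration contracts the bound `δ` on
the subspace distance, up to the noise floor `ξ`. -/
structure StepAssumptions (n q m r : ℕ) (σv s₁ s₂ β δ ξ : ℝ) : Prop where
  two_le : 2 ≤ n
  rank_pos : 0 < r
  rank_le_left : r ≤ n
  rank_le_right : r ≤ q
  s₁_pos : 0 < s₁
  s₁_le : s₁ ≤ s₂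
  β_pos : 0 < β
  δ_pos : 0 < δ
  ξ_nonneg : 0 ≤ ξ
  ξ_le : ξ ≤ 0.01
  δ_le : δ * s₂ ^ 2 ≤ 0.01 * s₁ ^ 2
  log_le : 10 ^ 5 * (r + Real.log q + Real.log n) ≤ m
  log_noise_le : 10 ^ 5 * ((r + Real.log q + Real.log n) * σv ^ 2) ≤ m * β ^ 2
  signal_le : 10 ^ 10 * (n * β ^ 2 * s₂ ^ 2) ≤ m * s₁ ^ 4
  noise_le : 10 ^ 10 * (n * s₂ ^ 2 * σv ^ 2) ≤ m * s₁ ^ 4 * ξ ^ 2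
  total_noise_le : 10 ^ 5 * (q * σv ^ 2) ≤ m * s₁ ^ 2

/-- One iteration of AltGDmin from a fixed iterate, under sample size assumptions. -/
lemma measure_step_le_zpow [IsProbabilityMeasure P] {Z₁ Z₂ : BatchIndex n q m → Ω → ℝ}
    (h₁ : IsGaussianFamily P (batchVar n q m σv) Z₁)
    (h₂ : IsGaussianFamily P (batchVar n q m σv) Z₂)
    (hind : IndepFun (fun ω e => Z₁ e ω) (fun ω e => Z₂ e ω) P)
    {qr : Matrix (Fin n) (Fin r) ℝ → Matrix (Fin n) (Fin r) ℝ} (hqr : ∀ M, IsQRFactor M (qr M))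
    {U Us : Matrix (Fin n) (Fin r) ℝ} {Bs : Matrix (Fin r) (Fin q) ℝ}
    {s₁ s₂ β δ η ξ : ℝ} (hU : Uᵀ * U = 1) (hUs : Usᵀ * Us = 1)
    (hlow : ∀ y, s₁ * vnorm y ≤ vnorm (Bsᵀ *ᵥ y)) (hhigh : ‖Bs‖ ≤ s₂)
    (hcol : ∀ k, vnorm (fun j => Bs j k) ≤ β)
    (hδ : sd2 Us U ≤ δ) (hη : 0 < η) (hηs : η * s₂ ^ 2 ≤ 0.5)
    (H : StepAssumptions n q m r σv s₁ s₂ β δ ξ) :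
    P {ω | ¬ sd2 Us (stepMap qr η (Us * Bs) U (fun e => Z₁ e ω) (fun e => Z₂ e ω)) ≤
      (1 - 0.5 * η * s₁ ^ 2) * δ + 0.02 * (η * s₁ ^ 2) * ξ} ≤
    ENNReal.ofReal ((n : ℝ) ^ (-10 : ℤ) / 2) := by
  obtain ⟨hn, hr, hrn, hrq, hs₁, hs₂, hβ, hδ0, hξ0, hξ, hδs, f1, f2, f3, f4, f5⟩ := H
  have hq : 0 < q := hr.trans_le hrq
  have hn' : (2 : ℝ) ≤ n := by exact_mod_cast hn
  have hr' : (1 : ℝ) ≤ r := by exact_mod_cast hr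
  have hq' : (1 : ℝ) ≤ q := by exact_mod_cast hq
  have hlq := Real.log_nonneg hq'
  have hln := Real.log_nonneg (show (1 : ℝ) ≤ n by linarith)
  have hσ0 : (0 : ℝ) ≤ σv := σv.2
  set L := r + Real.log q + Real.log n with hL
  have hL1 : 1 ≤ L := by linarith
  have hm' : (0 : ℝ) < m := by linarith
  have hrm : (r : ℝ) ≤ m := by linarith
  have hs₂0 : 0 < s₂ := hs₁.trans_le hs₂
  have hδ1 : δ ≤ 0.01 := by
    have : δ * s₁ ^ 2 ≤ 0.01 * s₁ ^ 2 :=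
      (mul_le_mul_of_nonneg_left (pow_le_pow_left₀ hs₁.le hs₂ 2) hδ0.le).trans hδs
    exact le_of_mul_le_mul_right this (by positivity)
  have hδξ : (δ + ξ) ^ 2 ≤ 1.1 := by nlinarith
  have hw := proxy_le (s := δ * β + σv) (Nat.cast_nonneg n) hδ0.le hξ0 hm'.le f3 f4 rfl
  set s := δ * β + σv with hs
  have hs0 : 0 < s := by positivity
  set S := 2 / (m : ℝ) * (r * δ ^ 2 * s₂ ^ 2 + q * (σv : ℝ) ^ 2) with hS
  have hS0 : 0 ≤ S := by positivity
  have hmono := failure_probability_le hn hrn hq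
  refine (measure_step_le h₁ h₂ hind hqr hU hUs hs₁ hs₂ hlow hhigh hcol hβ hδ0 hδ hδs hη hηs
    (by linarith) hξ0 (by exact_mod_cast hm') hs (u₁ := 20 * L) (u₂ := 20 * n)
    (τ₁ := 16 * (20 * n) * (2 * s ^ 2 / m) + S) (by positivity) (by positivity) (by linarith)
    (leastSquares_numerics (by linarith) hδ0.le hδ1 f1 f2 hs)
    (contraction_numerics_sq hm' hs₁ hδξ hw) hS (by positivity) (by linarith) ?_
    (contraction_numerics_errMat hm' hs₁ hs₂ hδ0.le hrm hδξ hδs f5 hw hS) rfl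
    (gradient_numerics_linear (Nat.cast_nonneg n) hm' hs₁ hs₂ hδ0.le hξ0 f3 hw)
    (gradient_numerics_sq hm' hw)).trans hmono
  -- With `a = 16 u₂ (2 s² / m)` and `τ₁ = a + S`, the quadratic Bernstein condition is `4 a S ≤ (a
  -- + S)²`.
  have h6 := sq_nonneg (16 * (20 * n) * (2 * s ^ 2 / m) - S)
  linarith

end Step

/-! ### Splitting the data into independent batches. -/

section Batches

variable {N n q m r : ℕ} {Ω α : Type*} [MeasurableSpace Ω] [MeasurableSpace α] {P : Measure Ω}
  {σv : ℝ≥0}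

/-- The restrictions of an independent family to disjoint sets of indices are independent. -/
lemma indepFun_ite_of_iIndepFun {ι : Type*} {Z : ι → Ω → ℝ} (hZ : iIndepFun Z P)
    (hm : ∀ i, Measurable (Z i)) (S S' : Finset ι) [DecidableEq ι] (hS : Disjoint S S') :
    IndepFun (fun ω i => if i ∈ S then Z i ω else 0) (fun ω i => if i ∈ S' then Z i ω else 0) P := by
  have hext : ∀ R : Finset ι, Measurable fun (w : R → ℝ) (i : ι) =>
      if h : i ∈ R then w ⟨i, h⟩ else 0 := by
    intro R
    refine measurable_pi_iff.2 fun i => ?_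
    by_cases h : i ∈ R
    · simpa [h] using measurable_pi_apply _
    · simp [h]
  have h := (hZ.indepFun_finset S S' hS hm).comp (hext S) (hext S')
  have e : ∀ R : Finset ι, ((fun (w : R → ℝ) (i : ι) => if h : i ∈ R then w ⟨i, h⟩ else 0) ∘
      fun ω (i : R) => Z i ω) = fun ω i => if i ∈ R then Z i ω else 0 := by
    intro R
    ext ω i
    by_cases h : i ∈ R <;> simp [h]
  rwa [e, e] at h

/-- The variances of all entries. -/
def entryVar (N n q m : ℕ) (σv : ℝ≥0) : EntryIndex N n q m → ℝ≥0 :=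
  Sum.elim (fun _ => 1) fun _ => σv ^ 2

/-- The number of the batch of an entry. -/
def batchNo : EntryIndex N n q m → ℕ := Sum.elim (fun e => e.1) fun e => e.1

/-- The entries of one batch among all entries. -/
def batchEmb {τ : ℕ} (hτ : τ ∈ Finset.Icc 1 N) (p : BatchIndex n q m) : EntryIndex N n q m :=
  Sum.elim (fun l => Sum.inl (⟨τ, hτ⟩, p.1.1, p.1.2, l))
    (fun _ => Sum.inr (⟨τ, hτ⟩, p.1.1, p.1.2)) p.2

/-- One batch, as a function of all entries. -/
def batchOf (y : EntryIndex N n q m → ℝ) (τ : ℕ) (p : BatchIndex n q m) : ℝ :=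
  if h : τ ∈ Finset.Icc 1 N then y (batchEmb h p) else 0

lemma batchEmb_injective {τ : ℕ} (hτ : τ ∈ Finset.Icc 1 N) :
    (batchEmb (n := n) (q := q) (m := m) hτ).Injective := by
  rintro ⟨⟨k, i⟩, l | _⟩ ⟨⟨k', i'⟩, l' | _⟩ h <;> simp_all [batchEmb]

@[simp] lemma batchNo_batchEmb {τ : ℕ} (hτ : τ ∈ Finset.Icc 1 N) (p : BatchIndex n q m) :
    batchNo (batchEmb hτ p) = τ := by
  rcases p with ⟨p, l | _⟩ <;> rfl

lemma entryVar_comp_batchEmb {τ : ℕ} (hτ : τ ∈ Finset.Icc 1 N) :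
    entryVar N n q m σv ∘ batchEmb hτ = batchVar n q m σv := by
  ext ⟨p, l | _⟩ <;> rfl

lemma measurable_batchOf {y : α → EntryIndex N n q m → ℝ} (hy : Measurable y) (τ : ℕ) :
    Measurable fun a => batchOf (y a) τ := by
  refine measurable_pi_iff.2 fun p => ?_
  by_cases h : τ ∈ Finset.Icc 1 N
  · simpa [batchOf, h] using measurable_pi_iff.1 hy _
  · simp [batchOf, h]

/-- The entries of the batches in `S`, the others being replaced by zero. -/
def restrictBatches (S : Finset ℕ) (y : EntryIndex N n q m → ℝ) (e : EntryIndex N n q m) : ℝ :=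
  if batchNo e ∈ S then y e else 0

lemma measurable_restrictBatches (S : Finset ℕ) {y : α → EntryIndex N n q m → ℝ}
    (hy : Measurable y) : Measurable fun a => restrictBatches S (y a) := by
  refine measurable_pi_iff.2 fun e => ?_
  by_cases h : batchNo e ∈ S
  · simpa [restrictBatches, h] using measurable_pi_iff.1 hy _
  · simp [restrictBatches, h]

lemma batchOf_restrictBatches {S : Finset ℕ} {τ : ℕ} (hτ : τ ∈ S) (y : EntryIndex N n q m → ℝ) :
    batchOf (restrictBatches S y) τ = batchOf y τ := by
  ext p
  by_cases h : τ ∈ Finset.Icc 1 N <;> simp [batchOf, restrictBatches, h, hτ]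

lemma indepFun_restrictBatches {Y : EntryIndex N n q m → Ω → ℝ} (hY : iIndepFun Y P)
    (hm : ∀ e, Measurable (Y e)) {S S' : Finset ℕ} (hS : Disjoint S S') :
    IndepFun (fun ω => restrictBatches S fun e => Y e ω)
      (fun ω => restrictBatches S' fun e => Y e ω) P := by
  classical
  have h := indepFun_ite_of_iIndepFun hY hm (Finset.univ.filter fun e => batchNo e ∈ S)
    (Finset.univ.filter fun e => batchNo e ∈ S') (Finset.disjoint_filter.2 fun e _ h1 h2 =>
      Finset.disjoint_left.1 hS h1 h2)
  have e : ∀ R : Finset ℕ, (fun ω (e : EntryIndex N n q m) =>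
      if e ∈ Finset.univ.filter (fun e => batchNo e ∈ R) then Y e ω else 0) =
      fun ω => restrictBatches R fun e => Y e ω := by
    intro R; ext ω e; simp [restrictBatches]
  rwa [e, e] at h

lemma isGaussianFamily_batchOf {Y : EntryIndex N n q m → Ω → ℝ}
    (hY : IsGaussianFamily P (entryVar N n q m σv) Y) {τ : ℕ} (hτ : τ ∈ Finset.Icc 1 N) :
    IsGaussianFamily P (batchVar n q m σv) fun p ω => batchOf (fun e => Y e ω) τ p := by
  have h := hY.precomp (batchEmb_injective (n := n) (q := q) (m := m) hτ)
  rw [entryVar_comp_batchEmb] at h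
  convert h using 3
  simp [batchOf, hτ]

lemma indepFun_batchOf {Y : EntryIndex N n q m → Ω → ℝ} (hY : iIndepFun Y P)
    (hm : ∀ e, Measurable (Y e)) {τ τ' : ℕ} (hτ : τ ≠ τ') :
    IndepFun (fun ω p => batchOf (fun e => Y e ω) τ p)
      (fun ω p => batchOf (fun e => Y e ω) τ' p) P := by
  have h := (indepFun_restrictBatches hY hm (S := {τ}) (S' := {τ'})
    (by simpa using hτ)).comp (measurable_batchOf measurable_id τ)
    (measurable_batchOf measurable_id τ')
  have e : ∀ τ : ℕ, ((fun a => batchOf (id a) τ) ∘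
      fun ω => restrictBatches {τ} fun e => Y e ω) = fun ω p => batchOf (fun e => Y e ω) τ p := by
    intro τ; ext ω : 1
    exact batchOf_restrictBatches (Finset.mem_singleton_self τ) (fun e => Y e ω)
  rwa [e, e] at h

lemma isGaussianFamily_entry {A : ℕ → Fin q → Ω → Matrix (Fin m) (Fin n) ℝ}
    {v : ℕ → Fin q → Ω → Fin m → ℝ} (h : IsGaussianData P N σv A v) :
    IsGaussianFamily P (entryVar N n q m σv) (entry N A v) where
  meas := h.measurable_entry
  law := by
    rintro (⟨τ, k, i, j⟩ | ⟨τ, k, i⟩)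
    · exact h.law_sensing τ τ.2 k i j
    · exact h.law_noise τ τ.2 k i
  indep := h.indep

end Batches

/-! ### The iterates as functions of the batches. -/

section Iterate

variable {T n q m r : ℕ} {α : Type*} [MeasurableSpace α]
  {qr : Matrix (Fin n) (Fin r) ℝ → Matrix (Fin n) (Fin r) ℝ}

/-- The AltGDmin iterates as functions of the initialization and of the batches. -/
def iter (qr : Matrix (Fin n) (Fin r) ℝ → Matrix (Fin n) (Fin r) ℝ) (η : ℝ)
    (X : Matrix (Fin n) (Fin q) ℝ) (T : ℕ) (z : ℕ → BatchIndex n q m → ℝ)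
    (U₀ : Matrix (Fin n) (Fin r) ℝ) : ℕ → Matrix (Fin n) (Fin r) ℝ
  | 0 => U₀
  | t + 1 => stepMap qr η X (iter qr η X T z U₀ t) (z (t + 1)) (z (T + (t + 1)))

/-- The first `t` iterations read only batches `1, …, t` and `T + 1, …, T + t`. This is what makes
the iterate independent of the batches of the next iteration. -/
lemma iter_congr (η : ℝ) (X : Matrix (Fin n) (Fin q) ℝ) {z z' : ℕ → BatchIndex n q m → ℝ}
    (U₀ : Matrix (Fin n) (Fin r) ℝ) (t : ℕ)
    (h : ∀ τ ∈ Finset.Icc 1 t ∪ Finset.Icc (T + 1) (T + t), z τ = z' τ) :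
    iter qr η X T z U₀ t = iter qr η X T z' U₀ t := by
  induction t with
  | zero => rfl
  | succ t ih =>
    rw [iter, iter, ih fun τ hτ => h τ (by simp at hτ ⊢; omega), h (t + 1) (by simp),
      h (T + (t + 1)) (by simp)]

lemma altGDmin_eq_iter (η : ℝ) (X : Matrix (Fin n) (Fin q) ℝ)
    {A : ℕ → Fin q → Matrix (Fin m) (Fin n) ℝ} {v : ℕ → Fin q → Fin m → ℝ}
    {z : ℕ → BatchIndex n q m → ℝ} (hA : ∀ τ ∈ Finset.Icc 1 (2 * T), A τ = batchA (z τ))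
    (hv : ∀ τ ∈ Finset.Icc 1 (2 * T), v τ = batchV (z τ)) (U₀ : Matrix (Fin n) (Fin r) ℝ) (t : ℕ)
    (ht : t ≤ T) : altGDmin qr η T A (measurements X A v) U₀ t = iter qr η X T z U₀ t := by
  have hy : ∀ τ ∈ Finset.Icc 1 (2 * T), measurements X A v τ = batchY X (z τ) := by
    intro τ hτ
    funext k
    rw [measurements, hA τ hτ, hv τ hτ, batchY]
  induction t with
  | zero => rfl
  | succ t ih =>
    have h1 : t + 1 ∈ Finset.Icc 1 (2 * T) := by simp; omega
    have h2 : T + (t + 1) ∈ Finset.Icc 1 (2 * T) := by simp; omega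
    rw [iter, altGDmin, ih (by omega), hA _ h1, hA _ h2, hy _ h1, hy _ h2]
    rfl

lemma measurable_iter (hqr : Measurable qr) (η : ℝ) (X : Matrix (Fin n) (Fin q) ℝ)
    {z : α → ℕ → BatchIndex n q m → ℝ} (hz : ∀ τ, Measurable fun a => z a τ)
    {U₀ : α → Matrix (Fin n) (Fin r) ℝ} (hU₀ : Measurable U₀) (t : ℕ) :
    Measurable fun a => iter qr η X T (z a) (U₀ a) t := by
  induction t with
  | zero => exact hU₀
  | succ t ih => exact measurable_stepMap hqr η X ih (hz _) (hz _)

lemma iter_orthonormal (hqr : ∀ M, IsQRFactor M (qr M)) (η : ℝ) (X : Matrix (Fin n) (Fin q) ℝ)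
    (z : ℕ → BatchIndex n q m → ℝ) {U₀ : Matrix (Fin n) (Fin r) ℝ} (hU₀ : U₀ᵀ * U₀ = 1) (t : ℕ) :
    (iter qr η X T z U₀ t)ᵀ * iter qr η X T z U₀ t = 1 := by
  cases t with
  | zero => exact hU₀
  | succ t => exact (hqr _).1

end Iterate

/-! ### Induction over the iterations. -/

section Induction

variable {T n q m r : ℕ} {Ω : Type*} [MeasurableSpace Ω] {P : Measure Ω} {σv : ℝ≥0}

/-- The bounds on the subspace distance along the iterations. -/
def errorBound (η s₁ ξ δ₀ : ℝ) : ℕ → ℝ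
  | 0 => δ₀
  | t + 1 => (1 - 0.5 * η * s₁ ^ 2) * errorBound η s₁ ξ δ₀ t + 0.02 * (η * s₁ ^ 2) * ξ

/-- The iterates from a fixed initialization obey the error bounds with high probability. -/
lemma measure_iter_le [IsProbabilityMeasure P] {Y : EntryIndex (2 * T) n q m → Ω → ℝ}
    (hY : IsGaussianFamily P (entryVar (2 * T) n q m σv) Y)
    {qr : Matrix (Fin n) (Fin r) ℝ → Matrix (Fin n) (Fin r) ℝ} (hqrm : Measurable qr)
    (hqr : ∀ M, IsQRFactor M (qr M))
    {U₀ Us : Matrix (Fin n) (Fin r) ℝ} {Bs : Matrix (Fin r) (Fin q) ℝ}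
    {s₁ s₂ β δ₀ η ξ : ℝ} (hU₀ : U₀ᵀ * U₀ = 1) (hUs : Usᵀ * Us = 1)
    (hlow : ∀ y, s₁ * vnorm y ≤ vnorm (Bsᵀ *ᵥ y)) (hhigh : ‖Bs‖ ≤ s₂)
    (hcol : ∀ k, vnorm (fun j => Bs j k) ≤ β)
    (hδ : sd2 Us U₀ ≤ δ₀) (hη : 0 < η) (hηs : η * s₂ ^ 2 ≤ 0.5)
    (H : ∀ t, StepAssumptions n q m r σv s₁ s₂ β (errorBound η s₁ ξ δ₀ t) ξ) (t : ℕ) (ht : t ≤ T) :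
    P {ω | ¬ sd2 Us (iter qr η (Us * Bs) T (batchOf fun e => Y e ω) U₀ t) ≤
      errorBound η s₁ ξ δ₀ t} ≤ t * ENNReal.ofReal ((n : ℝ) ^ (-10 : ℤ) / 2) := by
  induction t with
  | zero => simp [iter, errorBound, hδ]
  | succ t ih =>
    have hYm : Measurable fun ω e => Y e ω := measurable_pi_iff.2 hY.meas
    set S₀ := Finset.Icc 1 t ∪ Finset.Icc (T + 1) (T + t) with hS₀
    set S₁ : Finset ℕ := {t + 1, T + (t + 1)} with hS₁
    have hdisj : Disjoint S₀ S₁ := by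
      rw [Finset.disjoint_left]
      intro τ h1 h2
      simp [hS₀, hS₁] at h1 h2
      omega
    have h1 : t + 1 ∈ S₁ := by simp [hS₁]
    have h2 : T + (t + 1) ∈ S₁ := by simp [hS₁]
    have hUt : ∀ y : EntryIndex (2 * T) n q m → ℝ,
        iter qr η (Us * Bs) T (batchOf (restrictBatches S₀ y)) U₀ t =
          iter qr η (Us * Bs) T (batchOf y) U₀ t := fun y =>
      iter_congr η _ U₀ t fun τ hτ => batchOf_restrictBatches hτ y
    have hind := (indepFun_restrictBatches hY.indep hY.meas hdisj).comp
      (measurable_iter (T := T) hqrm η (Us * Bs) (fun τ => measurable_batchOf measurable_id τ)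
        (measurable_const (a := U₀)) t) measurable_id
    -- The event that the bound first fails at the new iteration: it holds for `p.1` and fails after
    -- one step from it. Freezing `p.1` leaves an instance of the fixed-iterate estimate.
    set Sev : Set (Matrix (Fin n) (Fin r) ℝ × (EntryIndex (2 * T) n q m → ℝ)) :=
      {p | sd2 Us p.1 ≤ errorBound η s₁ ξ δ₀ t ∧
        ¬ sd2 Us (stepMap qr η (Us * Bs) p.1 (batchOf p.2 (t + 1)) (batchOf p.2 (T + (t + 1)))) ≤
          errorBound η s₁ ξ δ₀ (t + 1)} with hSev
    have hSm : MeasurableSet Sev := by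
      refine (measurableSet_le (measurable_sd2 Us measurable_fst) measurable_const).inter
        (measurableSet_le (measurable_sd2 Us ?_) measurable_const).compl
      exact measurable_stepMap hqrm η _ measurable_fst (measurable_batchOf measurable_snd _)
        (measurable_batchOf measurable_snd _)
    have hstep := measure_le_of_indepFun (P := P)
      (X := fun ω => iter qr η (Us * Bs) T (batchOf (restrictBatches S₀ fun e => Y e ω)) U₀ t)
      (Y := fun ω => restrictBatches S₁ fun e => Y e ω)
      (measurable_iter hqrm η _ (fun τ => measurable_batchOf (measurable_restrictBatches _ hYm) τ)
        measurable_const t) (measurable_restrictBatches _ hYm) hind hSm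
      (p := ENNReal.ofReal ((n : ℝ) ^ (-10 : ℤ) / 2)) (Q := fun U => Uᵀ * U = 1)
      (ae_of_all _ fun ω => iter_orthonormal hqr η _ _ hU₀ t) fun U hU => by
        by_cases hUδ : sd2 Us U ≤ errorBound η s₁ ξ δ₀ t
        · refine (measure_mono fun ω hω => ?_).trans (measure_step_le_zpow
            (isGaussianFamily_batchOf hY (τ := t + 1) (by simp; omega))
            (isGaussianFamily_batchOf hY (τ := T + (t + 1)) (by simp; omega))
            (indepFun_batchOf hY.indep hY.meas (by omega)) hqr hU hUs hlow hhigh hcol hUδ hη hηs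
            (H t))
          have h3 := hω.2
          simp only [batchOf_restrictBatches h1, batchOf_restrictBatches h2] at h3
          exact h3
        · refine le_of_eq_of_le ?_ zero_le
          refine measure_mono_null (t := ∅) (fun ω hω => hUδ hω.1) measure_empty
    have hsub : {ω | ¬ sd2 Us (iter qr η (Us * Bs) T (batchOf fun e => Y e ω) U₀ (t + 1)) ≤
        errorBound η s₁ ξ δ₀ (t + 1)} ⊆
        {ω | ¬ sd2 Us (iter qr η (Us * Bs) T (batchOf fun e => Y e ω) U₀ t) ≤
          errorBound η s₁ ξ δ₀ t} ∪
        {ω | (iter qr η (Us * Bs) T (batchOf (restrictBatches S₀ fun e => Y e ω)) U₀ t,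
          restrictBatches S₁ fun e => Y e ω) ∈ Sev} := by
      intro ω hω
      by_cases h3 : sd2 Us (iter qr η (Us * Bs) T (batchOf fun e => Y e ω) U₀ t) ≤
          errorBound η s₁ ξ δ₀ t
      · have h4 : ¬ sd2 Us (stepMap qr η (Us * Bs)
            (iter qr η (Us * Bs) T (batchOf fun e => Y e ω) U₀ t)
            (batchOf (fun e => Y e ω) (t + 1)) (batchOf (fun e => Y e ω) (T + (t + 1)))) ≤
            errorBound η s₁ ξ δ₀ (t + 1) := hω
        refine Or.inr ⟨?_, ?_⟩
        · simpa only [hUt] using h3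
        · simpa only [hUt, batchOf_restrictBatches h1, batchOf_restrictBatches h2] using h4
      · exact Or.inl h3
    refine (measure_mono hsub).trans ((measure_union_le _ _).trans ?_)
    rw [Nat.cast_succ, add_mul, one_mul]
    exact add_le_add (ih (by omega)) hstep

end Induction

/-! ### Solving the recursion for the error bounds. -/

section ErrorBound

variable {η s₁ ξ δ₀ : ℝ}

lemma errorBound_pos (hη : 0 ≤ η) (hx : η * s₁ ^ 2 ≤ 0.5) (hξ : 0 ≤ ξ) (hδ₀ : 0 < δ₀) (t : ℕ) :
    0 < errorBound η s₁ ξ δ₀ t := by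
  induction t with
  | zero => exact hδ₀
  | succ t ih =>
    have h1 : 0 < 1 - 0.5 * η * s₁ ^ 2 := by linarith
    rw [errorBound]
    positivity

/-- The additive term is `0.5 η s₁²` times `0.04 ξ`, so `0.04 ξ` is the fixed point of the
recursion. -/
lemma errorBound_le (hx : η * s₁ ^ 2 ≤ 0.5) (hξ : 0 ≤ ξ) (t : ℕ) :
    errorBound η s₁ ξ δ₀ t ≤ (1 - 0.5 * η * s₁ ^ 2) ^ t * δ₀ + 0.04 * ξ := by
  induction t with
  | zero => simp only [errorBound, pow_zero]; linarith
  | succ t ih =>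
    have h1 : 0 ≤ 1 - 0.5 * η * s₁ ^ 2 := by linarith
    rw [errorBound, pow_succ (1 - 0.5 * η * s₁ ^ 2)]
    have h2 := mul_le_mul_of_nonneg_left ih h1
    linarith

lemma errorBound_succ_le (hη : 0 ≤ η) (hx : η * s₁ ^ 2 ≤ 0.5) (hξ : 0 ≤ ξ) (hδ₀ : 0 ≤ δ₀) (t : ℕ) :
    errorBound η s₁ ξ δ₀ (t + 1) ≤ (1 - 0.5 * η * s₁ ^ 2) ^ t * δ₀ + 0.04 * ξ := by
  refine (errorBound_le hx hξ (t + 1)).trans ?_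
  have h0 : 0 ≤ η * s₁ ^ 2 := by positivity
  have h1 : (1 - 0.5 * η * s₁ ^ 2) ^ (t + 1) ≤ (1 - 0.5 * η * s₁ ^ 2) ^ t :=
    pow_le_pow_of_le_one (by linarith) (by linarith) (Nat.le_succ t)
  have h2 := mul_le_mul_of_nonneg_right h1 hδ₀
  linarith

/-- With `ξ ≤ δ₀` every bound stays below `2 δ₀`, so the step assumptions hold uniformly in `t`. -/
lemma errorBound_le_add (hη : 0 ≤ η) (hx : η * s₁ ^ 2 ≤ 0.5) (hξ : 0 ≤ ξ) (hδ₀ : 0 ≤ δ₀) (t : ℕ) :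
    errorBound η s₁ ξ δ₀ t ≤ δ₀ + 0.04 * ξ := by
  have h0 : 0 ≤ η * s₁ ^ 2 := by positivity
  have h1 : (1 - 0.5 * η * s₁ ^ 2) ^ t ≤ 1 := pow_le_one₀ (by linarith) (by linarith)
  have h2 := mul_le_mul_of_nonneg_right h1 hδ₀
  linarith [errorBound_le (δ₀ := δ₀) hx hξ t]

end ErrorBound

/-! ### From the assumptions of the theorem to those of a step. -/

section SampleSize

variable {n q m r : ℕ} {σv s₁ s₂ μ β κ ε δ₀ δ w : ℝ}

set_option maxHeartbeats 1000000 in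
/-- The sample size assumptions of the theorem imply those of one iteration. -/
lemma stepAssumptions_of_sampleSize (hn : 2 ≤ n) (hr : 0 < r) (hrn : r ≤ n) (hrq : r ≤ q)
    (hs₁ : 0 < s₁) (hs₂ : s₁ ≤ s₂) (hμ : 1 ≤ μ) (hβ : β = μ * √((r : ℝ) / q) * s₂)
    (hκ : κ = s₂ / s₁) (hε : 0 < ε) (hε1 : ε ≤ 1) (hδ₀ : δ₀ = 0.005 / (√(r : ℝ) * κ ^ 2))
    (hw : w = q * σv ^ 2 / s₁ ^ 2)
    (h1 : 10 ^ 10 * κ ^ 4 * μ ^ 2 * (n + r) * r +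
      4 * 10 ^ 14 * ((n + r) * r / ε ^ 2) * w * μ ^ 2 * κ ^ 6 ≤ (m : ℝ) * q)
    (h2 : 4 * 10 ^ 5 * (max (Real.log q) r * max 1 (w / (ε ^ 2 * r))) ≤ (m : ℝ))
    (hδ : 0 < δ) (hδ2 : δ ≤ 2 * δ₀) : StepAssumptions n q m r σv s₁ s₂ β δ (ε * δ₀) := by
  have hn' : (2 : ℝ) ≤ n := by exact_mod_cast hn
  have hr' : (1 : ℝ) ≤ r := by exact_mod_cast hr
  have hr0 : (0 : ℝ) < r := by linarith
  have hq : 0 < q := hr.trans_le hrq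
  have hq' : (1 : ℝ) ≤ q := by exact_mod_cast hq
  have hq0 : (0 : ℝ) < q := by linarith
  have hlq := Real.log_nonneg hq'
  have hln := Real.log_nonneg (show (1 : ℝ) ≤ n by linarith)
  have hs₂0 : 0 < s₂ := hs₁.trans_le hs₂
  have hκ1 : 1 ≤ κ := by rw [hκ, le_div_iff₀ hs₁, one_mul]; exact hs₂
  have hκ0 : 0 < κ := by linarith
  have hκs : s₂ = κ * s₁ := by rw [hκ]; field_simp
  have hw0 : 0 ≤ w := by rw [hw]; positivity
  have hws : w * s₁ ^ 2 = q * σv ^ 2 := by rw [hw]; field_simp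
  have hsr : 1 ≤ √(r : ℝ) := Real.one_le_sqrt.2 hr'
  have hβ2 : β ^ 2 * q = μ ^ 2 * r * s₂ ^ 2 := by
    rw [hβ, mul_pow, mul_pow, Real.sq_sqrt (by positivity)]; field_simp
  have hμ2 : 1 ≤ μ ^ 2 := one_le_pow₀ hμ
  have hδκ : δ₀ * √(r : ℝ) * κ ^ 2 = 0.005 := by rw [hδ₀]; field_simp
  have hδ₀0 : 0 < δ₀ := by rw [hδ₀]; positivity
  have hδ₀κ : δ₀ * κ ^ 2 ≤ 0.005 := by
    rw [← hδκ]; gcongr; nlinarith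
  have hδ₀1 : δ₀ ≤ 0.005 := le_trans (by nlinarith [one_le_pow₀ (n := 2) hκ1]) hδ₀κ
  have hδ₀sq : δ₀ ^ 2 * r * κ ^ 4 = 0.005 ^ 2 := by
    rw [← hδκ, mul_pow, mul_pow, Real.sq_sqrt hr0.le]; ring
  have hM : 1 ≤ max 1 (w / (ε ^ 2 * r)) := le_max_left _ _
  have hMw : w ≤ max 1 (w / (ε ^ 2 * r)) * (ε ^ 2 * r) :=
    (div_le_iff₀ (by positivity)).1 (le_max_right _ _)
  have hA : 10 ^ 10 * (κ ^ 4 * μ ^ 2 * (n * r)) ≤ (m : ℝ) * q := by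
    refine le_trans ?_ h1
    have e1 : 0 ≤ 4 * 10 ^ 14 * ((n + r) * r / ε ^ 2) * w * μ ^ 2 * κ ^ 6 := by positivity
    have e2 : 0 ≤ κ ^ 4 * μ ^ 2 * r * r := by positivity
    linarith
  have hB : 4 * 10 ^ 14 * (n * r * w * κ ^ 6) ≤ (m : ℝ) * q * ε ^ 2 := by
    have e1 : 4 * 10 ^ 14 * ((n + r) * r / ε ^ 2) * w * μ ^ 2 * κ ^ 6 ≤ (m : ℝ) * q :=
      le_trans (le_add_of_nonneg_left (by positivity)) h1
    calc 4 * 10 ^ 14 * (n * r * w * κ ^ 6) ≤ 4 * 10 ^ 14 * ((n + r) * r * w * κ ^ 6 * μ ^ 2) := by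
          have e2 : (n * r * w * κ ^ 6 : ℝ) ≤ (n + r) * r * w * κ ^ 6 * 1 := by
            rw [mul_one]; gcongr; linarith
          exact mul_le_mul_of_nonneg_left (e2.trans (by gcongr)) (by norm_num)
      _ = 4 * 10 ^ 14 * ((n + r) * r / ε ^ 2) * w * μ ^ 2 * κ ^ 6 * ε ^ 2 := by field_simp
      _ ≤ _ := by gcongr
  have hL : 10 ^ 5 * ((r + Real.log q + Real.log n) * max 1 (w / (ε ^ 2 * r))) ≤ (m : ℝ) := by
    refine log_sample_size hn hq hM ?_ h2
    -- When the maximum is 1 the signal part of the bound on `m q` suffices; otherwise its noise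
    -- part supplies the factor `w / (ε² r)`.
    rcases max_cases 1 (w / (ε ^ 2 * r)) with ⟨h, -⟩ | ⟨h, -⟩
    · rw [h, mul_one]
      refine le_trans ?_ hA
      have e1 : (1 : ℝ) ≤ κ ^ 4 * μ ^ 2 * r := one_le_mul_of_one_le_of_one_le
        (one_le_mul_of_one_le_of_one_le (one_le_pow₀ hκ1) hμ2) hr'
      have e2 : (n : ℝ) ≤ n * (κ ^ 4 * μ ^ 2 * r) := le_mul_of_one_le_right (by positivity) e1
      linarith
    · rw [h]
      have e1 : (1 : ℝ) ≤ κ ^ 6 * r ^ 2 :=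
        one_le_mul_of_one_le_of_one_le (one_le_pow₀ hκ1) (one_le_pow₀ hr')
      have e2 : (n : ℝ) * w ≤ n * w * (κ ^ 6 * r ^ 2) := le_mul_of_one_le_right (by positivity) e1
      have e3 : 10 ^ 10 * (n * (w / (ε ^ 2 * r))) = 10 ^ 10 * (n * w) / (ε ^ 2 * r) := by ring
      rw [e3, div_le_iff₀ (by positivity)]
      have e4 : 0 ≤ (n : ℝ) * r ^ 2 * w * κ ^ 6 := by positivity
      have e5 := mul_le_mul_of_nonneg_right hB hr0.le
      linarith
  have hL1 : 10 ^ 5 * (r + Real.log q + Real.log n) ≤ (m : ℝ) := by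
    refine le_trans ?_ hL
    gcongr
    exact le_mul_of_one_le_right (by positivity) hM
  have hm0 : (0 : ℝ) ≤ m := Nat.cast_nonneg m
  have hε2 : ε ^ 2 ≤ 1 := pow_le_one₀ hε.le hε1
  have hLw : 10 ^ 5 * ((r + Real.log q + Real.log n) * w) ≤ m * (ε ^ 2 * r) := by
    calc _ ≤ 10 ^ 5 * ((r + Real.log q + Real.log n) *
          (max 1 (w / (ε ^ 2 * r)) * (ε ^ 2 * r))) := by gcongr
      _ = 10 ^ 5 * ((r + Real.log q + Real.log n) * max 1 (w / (ε ^ 2 * r))) * (ε ^ 2 * r) := by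
          ring
      _ ≤ _ := by gcongr
  refine ⟨hn, hr, hrn, hrq, hs₁, hs₂, by rw [hβ]; positivity, hδ, by positivity, ?_, ?_, hL1,
    ?_, ?_, ?_, ?_⟩
  · nlinarith
  · rw [hκs]
    have := mul_le_mul_of_nonneg_right hδ2 (sq_nonneg (κ * s₁))
    have := mul_le_mul_of_nonneg_right hδ₀κ (sq_nonneg s₁)
    linarith
  · refine le_of_mul_le_mul_right ?_ hq0
    calc 10 ^ 5 * ((r + Real.log q + Real.log n) * σv ^ 2) * q =
          10 ^ 5 * ((r + Real.log q + Real.log n) * (w * s₁ ^ 2)) := by rw [hws]; ring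
      _ = 10 ^ 5 * ((r + Real.log q + Real.log n) * w) * s₁ ^ 2 := by ring
      _ ≤ m * (ε ^ 2 * r) * s₁ ^ 2 := by gcongr
      _ ≤ m * (μ ^ 2 * r) * s₂ ^ 2 := by gcongr; linarith
      _ = m * (β ^ 2 * q) := by rw [hβ2]; ring
      _ = _ := by ring
  · refine le_of_mul_le_mul_right ?_ hq0
    calc 10 ^ 10 * (n * β ^ 2 * s₂ ^ 2) * q = 10 ^ 10 * (n * (β ^ 2 * q) * s₂ ^ 2) := by ring
      _ = 10 ^ 10 * (κ ^ 4 * μ ^ 2 * (n * r)) * s₁ ^ 4 := by rw [hβ2, hκs]; ring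
      _ ≤ m * q * s₁ ^ 4 := by gcongr
      _ = _ := by ring
  -- Since `δ₀² r κ⁴ = 0.005²`, the noise floor satisfies `(ε δ₀)² = ε² / (40000 r κ⁴)`. This
  -- explains `C₂ = 10¹⁰ * 40000` and, with `s₂² = κ² s₁²`, the power `κ⁶`.
  · have hpos : 0 < 40000 * (r * κ ^ 4 * q) := by positivity
    refine le_of_mul_le_mul_right ?_ hpos
    calc 10 ^ 10 * (n * s₂ ^ 2 * σv ^ 2) * (40000 * (r * κ ^ 4 * q)) =
          4 * 10 ^ 14 * (n * r * (q * σv ^ 2) * κ ^ 6) * s₁ ^ 2 := by rw [hκs]; ring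
      _ = 4 * 10 ^ 14 * (n * r * w * κ ^ 6) * s₁ ^ 4 := by rw [← hws]; ring
      _ ≤ m * q * ε ^ 2 * s₁ ^ 4 := by gcongr
      _ = m * q * ε ^ 2 * s₁ ^ 4 * 40000 * 0.005 ^ 2 := by ring
      _ = m * s₁ ^ 4 * (ε * δ₀) ^ 2 * (40000 * (r * κ ^ 4 * q)) := by rw [← hδ₀sq]; ring
  · rw [← hws]
    have e1 : 10 ^ 5 * (r * w) ≤ m * r := by
      calc 10 ^ 5 * (r * w) ≤ 10 ^ 5 * ((r + Real.log q + Real.log n) * w) := by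
            gcongr; linarith
        _ ≤ m * (ε ^ 2 * r) := hLw
        _ ≤ m * (1 * r) := by gcongr
        _ = _ := by ring
    have e2 : 10 ^ 5 * w ≤ m := le_of_mul_le_mul_right (by linarith) hr0
    have := mul_le_mul_of_nonneg_right e2 (sq_nonneg s₁)
    linarith

end SampleSize

end LRCS

end

/-! ### The main theorem. -/

theorem mainTheorem3 :
    ∃ c C₁ C₂ C₃ : ℝ, 0 < c ∧ c < 1 ∧ 1 ≤ C₁ ∧ 1 ≤ C₂ ∧ 1 ≤ C₃ ∧
      ∀ (n q r m T : ℕ), 0 < r →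
      ∀ (Xstar : Matrix (Fin n) (Fin q) ℝ) (Ustar : Matrix (Fin n) (Fin r) ℝ)
        (σ : Fin r → ℝ) (Vstar : Matrix (Fin q) (Fin r) ℝ),
        LRCS.IsReducedSVD Xstar Ustar σ Vstar →
      ∀ μ : ℝ, 1 ≤ μ → LRCS.RightIncoherent μ σ Vstar →
      ∀ (σv : ℝ≥0) (Ω : Type*) [MeasurableSpace Ω] (P : Measure Ω) [IsProbabilityMeasure P]
        (A : ℕ → Fin q → Ω → Matrix (Fin m) (Fin n) ℝ) (v : ℕ → Fin q → Ω → Fin m → ℝ),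
        LRCS.IsGaussianData P (2 * T) σv A v →
      ∀ qr : Matrix (Fin n) (Fin r) ℝ → Matrix (Fin n) (Fin r) ℝ,
        Measurable qr → (∀ M, LRCS.IsQRFactor M (qr M)) →
      ∀ U₀ : Ω → Matrix (Fin n) (Fin r) ℝ, Measurable U₀ →
        IndepFun U₀ (fun ω e => LRCS.entry (2 * T) A v e ω) P →
        (∀ᵐ ω ∂P, (U₀ ω)ᵀ * U₀ ω = 1) →
      ∀ η ε δ₀ : ℝ, 0 < η → η ≤ 0.5 / LRCS.sigmaMax σ ^ 2 → 0 < ε →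
        δ₀ = c / (√(r : ℝ) * LRCS.kappa σ ^ 2) →
        (∀ᵐ ω ∂P, LRCS.sd2 Ustar (U₀ ω) ≤ δ₀) →
        C₁ * LRCS.kappa σ ^ 4 * μ ^ 2 * (n + r) * r
          + C₂ * ((n + r) * r / ε ^ 2) * LRCS.nsr q σv σ * μ ^ 2 * LRCS.kappa σ ^ 6
          ≤ (m : ℝ) * q →
        C₃ * (max (Real.log q) r * max 1 (LRCS.nsr q σv σ / (ε ^ 2 * r))) ≤ (m : ℝ) →
      ∀ t : ℕ, t + 1 ≤ T →
        1 - (max t 1 : ℕ) * (n : ℝ) ^ (-10 : ℤ) ≤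
          P.real {ω | LRCS.sd2 Ustar
              (LRCS.altGDmin qr η T (fun τ k => A τ k ω)
                (LRCS.measurements Xstar (fun τ k => A τ k ω) (fun τ k => v τ k ω))
                (U₀ ω) (t + 1))
            ≤ (1 - 0.5 * η * LRCS.sigmaMin σ ^ 2) ^ t * δ₀ + ε} := by
  refine ⟨0.005, 10 ^ 10, 4 * 10 ^ 14, 4 * 10 ^ 5, by norm_num, by norm_num, by norm_num,
    by norm_num, by norm_num, ?_⟩
  intro n q r m T hr Xstar Ustar σ Vstar hsvd μ hμ hinc σv Ω _ P _ A v hdata qr hqrm hqr U₀ hU₀m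
    hU₀ind hU₀ η ε δ₀ hη hηs hε hδ₀ hU₀δ h1 h2 t ht
  obtain ⟨hUs, hV, hσ, hX⟩ := hsvd
  have hrn := LRCS.card_le_of_orthonormal hUs
  have hrq := LRCS.card_le_of_orthonormal hV
  have hs₁ := LRCS.sigmaMin_pos hr hσ
  have hs₂ : LRCS.sigmaMin σ ≤ LRCS.sigmaMax σ :=
    (LRCS.sigmaMin_le σ ⟨0, hr⟩).trans (LRCS.le_sigmaMax σ _)
  have hs₂0 := hs₁.trans_le hs₂
  have hr' : (0 : ℝ) < r := by exact_mod_cast hr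
  have hκ1 : 1 ≤ LRCS.kappa σ := by rw [LRCS.kappa, le_div_iff₀ hs₁, one_mul]; exact hs₂
  have hδ₀0 : 0 < δ₀ := by rw [hδ₀]; positivity
  have hδ₀1 : δ₀ ≤ 0.005 := by
    rw [hδ₀]
    refine div_le_self (by norm_num) (one_le_mul_of_one_le_of_one_le ?_ (one_le_pow₀ hκ1))
    exact Real.one_le_sqrt.2 (by exact_mod_cast hr)
  have hηs₂ : η * LRCS.sigmaMax σ ^ 2 ≤ 0.5 := (le_div_iff₀ (by positivity)).1 hηs
  have hx : η * LRCS.sigmaMin σ ^ 2 ≤ 0.5 :=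
    le_trans (by gcongr) hηs₂
  have hρ : 0 ≤ 1 - 0.5 * η * LRCS.sigmaMin σ ^ 2 := by linarith
  by_cases hn : 2 ≤ n
  swap
  -- Orthonormality gives `n ≥ r ≥ 1`, so only `n = 1` is left, where the claimed probability bound
  -- is nonpositive.
  · have hn1 : n = 1 := by omega
    have h3 : (1 : ℝ) ≤ (max t 1 : ℕ) := by exact_mod_cast le_max_right _ _
    refine le_trans ?_ measureReal_nonneg
    simp [hn1]
  have hn0 : (0 : ℝ) < n := by exact_mod_cast (by omega : 0 < n)
  have hp0 : (0 : ℝ) < (n : ℝ) ^ (-10 : ℤ) := by positivity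
  rcases le_total 1 ε with hε1 | hε1
  -- For `ε ≥ 1` the conclusion holds surely, as the subspace distance never exceeds 1.
  · have huniv : {ω | LRCS.sd2 Ustar (LRCS.altGDmin qr η T (fun τ k => A τ k ω)
        (LRCS.measurements Xstar (fun τ k => A τ k ω) (fun τ k => v τ k ω)) (U₀ ω) (t + 1)) ≤
        (1 - 0.5 * η * LRCS.sigmaMin σ ^ 2) ^ t * δ₀ + ε} = Set.univ := by
      refine Set.eq_univ_of_forall fun ω => ?_
      have h3 : 0 ≤ (1 - 0.5 * η * LRCS.sigmaMin σ ^ 2) ^ t * δ₀ := by positivity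
      refine le_trans (LRCS.sd2_le_one hUs (hqr _).1) ?_
      linarith
    rw [huniv, probReal_univ]
    have : 0 ≤ ((max t 1 : ℕ) : ℝ) * (n : ℝ) ^ (-10 : ℤ) := by positivity
    linarith
  have hξ : 0 ≤ ε * δ₀ := by positivity
  have hξε : ε * δ₀ ≤ ε := by nlinarith
  have hξδ : ε * δ₀ ≤ δ₀ := by nlinarith
  have H : ∀ k, LRCS.StepAssumptions n q m r σv (LRCS.sigmaMin σ) (LRCS.sigmaMax σ)
      (μ * √((r : ℝ) / q) * LRCS.sigmaMax σ)
      (LRCS.errorBound η (LRCS.sigmaMin σ) (ε * δ₀) δ₀ k) (ε * δ₀) := fun k =>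
    LRCS.stepAssumptions_of_sampleSize hn hr hrn hrq hs₁ hs₂ hμ rfl rfl hε hε1 hδ₀ rfl h1 h2
      (LRCS.errorBound_pos hη.le hx hξ hδ₀0 k)
      ((LRCS.errorBound_le_add hη.le hx hξ hδ₀0.le k).trans (by linarith))
  have hXs : Xstar = Ustar * (Matrix.diagonal σ * Vstarᵀ) := by rw [hX, Matrix.mul_assoc]
  have hYm : Measurable fun ω e => LRCS.entry (2 * T) A v e ω :=
    measurable_pi_iff.2 hdata.measurable_entry
  have hSm : MeasurableSet {p : Matrix (Fin n) (Fin r) ℝ × (LRCS.EntryIndex (2 * T) n q m → ℝ) |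
      ¬ LRCS.sd2 Ustar (LRCS.iter qr η Xstar T (LRCS.batchOf p.2) p.1 (t + 1)) ≤
        LRCS.errorBound η (LRCS.sigmaMin σ) (ε * δ₀) δ₀ (t + 1)} :=
    (measurableSet_le (LRCS.measurable_sd2 Ustar (LRCS.measurable_iter hqrm η Xstar
      (fun τ => LRCS.measurable_batchOf measurable_snd τ) measurable_fst (t + 1)))
      measurable_const).compl
  have hbad := LRCS.measure_le_of_indepFun hU₀m hYm hU₀ind hSm
    (p := (t + 1 : ℕ) * ENNReal.ofReal ((n : ℝ) ^ (-10 : ℤ) / 2))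
    (Q := fun U => Uᵀ * U = 1 ∧ LRCS.sd2 Ustar U ≤ δ₀) (hU₀.and hU₀δ) fun U hU => by
      have h3 := LRCS.measure_iter_le (LRCS.isGaussianFamily_entry hdata) hqrm hqr hU.1 hUs
        (LRCS.sigmaMin_mul_vnorm_le hr hσ hV) (LRCS.l2norm_diagonal_mul_le hr hσ hV) hinc hU.2 hη
        hηs₂ H (t + 1) ht
      rw [← hXs] at h3
      exact h3
  set bad := {ω | (U₀ ω, fun e => LRCS.entry (2 * T) A v e ω) ∈
    {p : Matrix (Fin n) (Fin r) ℝ × (LRCS.EntryIndex (2 * T) n q m → ℝ) |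
      ¬ LRCS.sd2 Ustar (LRCS.iter qr η Xstar T (LRCS.batchOf p.2) p.1 (t + 1)) ≤
        LRCS.errorBound η (LRCS.sigmaMin σ) (ε * δ₀) δ₀ (t + 1)}} with hbad_def
  have hbad' : P.real bad ≤ (max t 1 : ℕ) * (n : ℝ) ^ (-10 : ℤ) := by
    have h3 : P.real bad ≤ (t + 1 : ℕ) * ((n : ℝ) ^ (-10 : ℤ) / 2) := by
      refine ENNReal.toReal_le_of_le_ofReal (by positivity) (hbad.trans_eq ?_)
      rw [ENNReal.ofReal_mul (by positivity), ENNReal.ofReal_natCast]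
    -- The halved failure probability per iteration pays for the shift: `t + 1` iterations cost `(t
    -- + 1) / 2 ≤ max t 1` units of `n⁻¹⁰`, also when `t = 0`.
    have h4 : ((t + 1 : ℕ) : ℝ) ≤ 2 * (max t 1 : ℕ) := by exact_mod_cast (by omega)
    nlinarith
  refine le_trans (by linarith) (show 1 - P.real bad ≤ _ from ?_)
  rw [sub_le_iff_le_add]
  refine le_trans ?_ (measureReal_union_le _ _)
  refine (probReal_univ (μ := P)).symm.le.trans (measureReal_mono fun ω _ => ?_)
  by_cases hω : ω ∈ bad
  · exact Or.inr hω
  · refine Or.inl ?_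
    have h5 := not_not.1 hω
    have h6 := LRCS.altGDmin_eq_iter (qr := qr) (T := T) η Xstar (A := fun τ k => A τ k ω)
      (v := fun τ k => v τ k ω) (z := LRCS.batchOf fun e => LRCS.entry (2 * T) A v e ω)
      (fun τ hτ => by
        ext k i j
        simp only [LRCS.batchA, LRCS.batchOf, hτ, dite_true]
        rfl)
      (fun τ hτ => by
        ext k i
        simp only [LRCS.batchV, LRCS.batchOf, hτ, dite_true]
        rfl) (U₀ ω) (t + 1) ht
    rw [Set.mem_ofPred_eq, h6]
    refine h5.trans ((LRCS.errorBound_succ_le hη.le hx hξ hδ₀0.le t).trans ?_)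
    linarith
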